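/- Notation. Let $\tau=u+iv\in\mathbb H$, $q=e^{2\pi i\tau}$ and $q^a=e^{2\pi i a\tau}$, $z=x+iy\in\mathbb C$, $\zeta=e^{2\pi i z}$. The rank of a partition is its largest part minus its number of parts (the empty partition has rank $0$); $N(m,n)$ is the number of partitions of $n$ with rank $m$, and $$\mathcal N_{2j}(q)=\sum_{n\ge 0}\Big(\sum_{m\in\mathbb Z}m^{2j}N(m,n)\Big)q^n ,\qquad 0^0:=1 .$$ Let $B_n(x)$ be the Bernoulli polynomials, $E_2(\tau)=1-24\sum_{n\ge1}\sigma_1(n)q^n$, $\widehat{E}_2(\tau)=E_2(\tau)-\frac{3}{\pi v}$, $\eta(\tau)=q^{1/24}\prod_{n\ge1}(1-q^n)$, $E(x)=2\int_0^x e^{-\pi t^2}\,dt$ and $$S(z;\tau)=\sum_{n\in\frac12+\mathbb Z}\Big(\operatorname{sgn}(n)-E\big((n+\tfrac yv)\sqrt{2v}\big)\Big)(-1)^{n-\frac12}q^{-\frac{n^2}2}e^{-2\pi i n z}.$$ Write $\frac{\partial}{\partial z}=\frac12\big(\frac{\partial}{\partial x}-i\frac{\partial}{\partial y}\big)$, $\frac{\partial}{\partial\overline\tau}=\frac12\big(\frac{\partial}{\partial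 u}+i\frac{\partial}{\partial v}\big)$, and let $L=-2iv^2\frac{\partial}{\partial\overline\tau}$ be the Maass lowering operator. For an integer $\ell\ge1$ put $r_{2\ell-1}=r^+_{2\ell-1}+r^-_{2\ell-1}$, where $$r^+_{2\ell-1}(\tau)=(2\pi i)^{2\ell-1}\sum_{\substack{j,n\ge0\\ j+n\le \ell}}\frac{B_{2n}(\frac12)}{(2n)!\,(\ell-j-n)!}\Big(\frac{E_2(\tau)}8\Big)^{\ell-j-n}\frac{\mathcal N_{2j}(q)\,q^{-\frac1{24}}}{(2j)!},$$ $$r^-_{2\ell-1}(\tau)=\frac1{(2\ell-1)!}\left[\frac{\partial^{2\ell-1}}{\partial z^{2\ell-1}}\Big(\zeta^{-1}q^{-\frac16}S(3z+\tau;3\tau)\,e^{-\frac{\pi^2}2E_2(\tau)z^2}\Big)\right]_{z=0}.$$ Non-integral powers of $c\tau+d$ are taken with the principal branch. Theorem 1.1. There is a multiplier $\psi$ of $\eta$, that is, numbers $\psi(\gamma)$ with $\eta\big(\frac{a\tau+b}{c\tau+d}\big)=\psi(\gamma)(c\tau+d)^{\frac12}\eta(\tau)$ for all $\gamma=\left(\begin{smallmatrix}a&b\\c&d\end{smallmatrix}\right)\in\mathrm{SL}_2(\mathbb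 Z)$ and $\tau\in\mathbb H$. The series for $S(z;\tau)$ and for all rank moment generating functions $\sum_{n\ge0}\big(\sum_{m\in\mathbb Z} m^kN(m,n)\big)q^n$, $k\ge0$, converge absolutely for all $z\in\mathbb C$, $\tau\in\mathbb H$, and the function of $z$ that is differentiated in the definition of $r^-_{2\ell-1}$ is smooth on $\mathbb C=\mathbb R^2$. For every integer $\ell\ge1$ and all $\gamma=\left(\begin{smallmatrix}a&b\\c&d\end{smallmatrix}\right)\in\mathrm{SL}_2(\mathbb Z)$, $\tau\in\mathbb H$, $$r_{2\ell-1}\Big(\frac{a\tau+b}{c\tau+d}\Big)=\psi(\gamma)^{-1}(c\tau+d)^{2\ell-\frac12}\,r_{2\ell-1}(\tau).$$ Moreover $r_{2\ell-1}$ is real-differentiable on $\mathbb H$ and $$L(r_{2\ell-1})(\tau)=\frac{i\sqrt3}{\sqrt2}\,\frac{v^{\frac12}\,\eta(-\overline\tau)}{(\ell-1)!}\left(-\frac{\pi^2\widehat{E}_2(\tau)}2\right)^{\ell-1},\qquad \eta(-\overline\tau)=\overline{\eta(\tau)} .$$ -/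

import Mathlib

open scoped UpperHalfPlane MatrixGroups ContDiff ComplexConjugate

namespace RankMoment

noncomputable section

/-! ### Ranks of partitions and their moments -/

/-- Dyson's rank of a partition: its largest part minus its number of parts.
The empty partition has rank `0`. -/
def rank {n : ℕ} (p : Nat.Partition n) : ℤ :=
  (p.parts.sup : ℤ) - (Multiset.card p.parts : ℤ)

/-- `N(m, n)`: the number of partitions of `n` with rank `m`. -/
def N (m : ℤ) (n : ℕ) : ℕ :=
  Fintype.card {p : Nat.Partition n // rank p = m}

/-- For given `n` only finitely many ranks occur, so that the sum over all `m` below is finite. -/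
lemma finite_support_N (n : ℕ) : (Function.support fun m : ℤ => N m n).Finite := by
  refine (Set.finite_range (fun p : Nat.Partition n => rank p)).subset ?_
  intro m hm
  have h : 0 < N m n := Nat.pos_of_ne_zero hm
  obtain ⟨p, hp⟩ := Fintype.card_pos_iff.mp h
  exact ⟨p, hp⟩

/-- The `k`-th rank moment `N_k(n) = ∑_{m ∈ ℤ} m ^ k N(m, n)`. -/
def rankMoment (k n : ℕ) : ℤ :=
  ∑ᶠ m : ℤ, m ^ k * (N m n : ℤ)

/-- `q ^ a = exp (2 π i a τ)`, where `q = exp (2 π i τ)`. -/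
def qPow (a τ : ℂ) : ℂ :=
  Complex.exp (2 * Real.pi * Complex.I * a * τ)

/-- The rank moment generating function `∑_{n ≥ 0} N_k(n) q ^ n`, as a function of `τ`. -/
def rankGen (k : ℕ) (τ : ℍ) : ℂ :=
  ∑' n : ℕ, (rankMoment k n : ℂ) * qPow n τ

/-! ### The non-holomorphic theta function `S` -/

/-- `E(x) = 2 ∫_0^x exp (-π t ^ 2) dt`. -/
def gaussE (x : ℝ) : ℝ :=
  2 * ∫ t in (0 : ℝ)..x, Real.exp (-Real.pi * t ^ 2)

/-- The summand of `S(z; τ)` with index `n = k + 1/2`, where `y = Im z` and `v = Im τ`. -/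
def STerm (z τ : ℂ) (k : ℤ) : ℂ :=
  ((Real.sign ((k : ℝ) + 1 / 2)
      - gaussE (((k : ℝ) + 1 / 2 + z.im / τ.im) * Real.sqrt (2 * τ.im)) : ℝ) : ℂ)
    * (-1 : ℂ) ^ k
    * qPow (-((k : ℂ) + 1 / 2) ^ 2 / 2) τ
    * Complex.exp (-2 * Real.pi * Complex.I * ((k : ℂ) + 1 / 2) * z)

/-- `S(z; τ) = ∑_{n ∈ 1/2 + ℤ} (sgn n - E((n + y/v) √(2v))) (-1)^(n - 1/2) q^(-n²/2) e^(-2πinz)`. -/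
def S (z τ : ℂ) : ℂ :=
  ∑' k : ℤ, STerm z τ k

/-! ### Wirtinger derivatives and the lowering operator -/

/-- `∂f/∂z = (∂f/∂x - i ∂f/∂y) / 2`. -/
def dz (f : ℂ → ℂ) (z : ℂ) : ℂ :=
  (1 / 2) * (fderiv ℝ f z 1 - Complex.I * fderiv ℝ f z Complex.I)

/-- `∂f/∂z̄ = (∂f/∂x + i ∂f/∂y) / 2`. -/
def dzbar (f : ℂ → ℂ) (z : ℂ) : ℂ :=
  (1 / 2) * (fderiv ℝ f z 1 + Complex.I * fderiv ℝ f z Complex.I)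

/-- The Maass lowering operator `L = -2 i v² ∂/∂τ̄`. -/
def lowering (f : ℍ → ℂ) (τ : ℍ) : ℂ :=
  -2 * Complex.I * (τ.im : ℂ) ^ 2 * dzbar (f ∘ UpperHalfPlane.ofComplex) τ

/-! ### The completed rank moments -/

/-- `r⁺_{2ℓ-1}`, for `ℓ ≥ 1`. -/
def rPlus (ℓ : ℕ) (τ : ℍ) : ℂ :=
  (2 * Real.pi * Complex.I) ^ (2 * ℓ - 1)
    * ∑ p ∈ (Finset.range (ℓ + 1) ×ˢ Finset.range (ℓ + 1)).filter (fun p => p.1 + p.2 ≤ ℓ),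
        (((Polynomial.bernoulli (2 * p.2)).eval (1 / 2 : ℚ) : ℚ) : ℂ)
          / (((2 * p.2).factorial : ℂ) * ((ℓ - p.1 - p.2).factorial : ℂ))
          * (EisensteinSeries.E2 τ / 8) ^ (ℓ - p.1 - p.2)
          * (rankGen (2 * p.1) τ * qPow (-1 / 24) τ / ((2 * p.1).factorial : ℂ))

/-- The function `z ↦ ζ⁻¹ q^(-1/6) S(3z + τ; 3τ) exp (-π² E₂(τ) z² / 2)`, `ζ = exp (2 π i z)`. -/
def minusFun (τ : ℍ) (z : ℂ) : ℂ :=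
  Complex.exp (-2 * Real.pi * Complex.I * z) * qPow (-1 / 6) τ * S (3 * z + τ) (3 * τ)
    * Complex.exp (-(Real.pi : ℂ) ^ 2 / 2 * EisensteinSeries.E2 τ * z ^ 2)

/-- `r⁻_{2ℓ-1}`, for `ℓ ≥ 1`: the Taylor coefficient of `z ^ (2ℓ-1)` of `minusFun`. -/
def rMinus (ℓ : ℕ) (τ : ℍ) : ℂ :=
  1 / ((2 * ℓ - 1).factorial : ℂ) * (dz^[2 * ℓ - 1] (minusFun τ)) 0

/-- `r_{2ℓ-1} = r⁺_{2ℓ-1} + r⁻_{2ℓ-1}`, for `ℓ ≥ 1`. -/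
def r (ℓ : ℕ) (τ : ℍ) : ℂ :=
  rPlus ℓ τ + rMinus ℓ τ

/-- The completed Eisenstein series `E₂(τ) - 3 / (π v)`. -/
def E2hat (τ : ℍ) : ℂ :=
  EisensteinSeries.E2 τ - 3 / (Real.pi * τ.im)

/-! ### The multiplier of the eta function -/

/-- `c τ + d` for `γ = (a, b; c, d)`. -/
def cd (γ : SL(2, ℤ)) (τ : ℍ) : ℂ :=
  (γ 1 0 : ℂ) * τ + (γ 1 1 : ℂ)

/-- The multiplier `ψ(γ) = η(γτ) / ((cτ + d)^(1/2) η(τ))` of `η` (principal branch), read off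
at the point `τ = i`; that it does not depend on `τ` is part of the theorem. -/
def etaMultiplier (γ : SL(2, ℤ)) : ℂ :=
  ModularForm.eta ((γ • UpperHalfPlane.I : ℍ) : ℂ)
    / ((cd γ UpperHalfPlane.I) ^ (1 / 2 : ℂ) * ModularForm.eta (UpperHalfPlane.I : ℍ))

end

end RankMoment

namespace RankMoment

/-! ### Dyson's bijection -/

/-! The moments are Taylor coefficients of a two-variable function. Dyson's bijection gives a
recursion for the generating function `G_s` of partitions with rank at least `s`, namely `G_s =
q^(s+1) (P - G_(s+3))` for `s ≥ 1`. Iterating it yields partial theta series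
(`rankGEGen_eq_mul_partialTheta`), and summing over `s` writes the rank generating function `R(ζ,
q)` as an Appell–Lerch sum (`rankGF_eq`). Thus `-ζ^(1/2) / (1 - ζ) * R`, multiplied by the Euler
product, is the function `appell`, which fails to be elliptic only by theta terms.

Adding `η` times the odd part of `ζ⁻¹ q^(-1/6) S(3z + τ; 3τ)` removes the failure: `appellHat`
transforms like a Jacobi form of weight `1` and index `-3/2`. Multiplication by `z exp(-π² E₂ z² /
2)` absorbs both the index, by quasimodularity of `E₂`, and the weight. In the resulting even
function the coefficient of `z^(2ℓ)` is `η r_{2ℓ-1}`; the values `B_{2n}(1/2)` come from `y /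
(exp(y/2) - exp(-y/2))`. So `η r_{2ℓ-1}` has weight `2ℓ`, and division by `η` gives the
transformation law.

The inversion law of `appellHat` is the main point. The conjugate of `z` is replaced by an
independent variable `w`. The `w`-derivative of the error function series is a Gaussian times a
unary theta series (`hasDerivAt_errJac`), and the inversion formula `thetaEven_inv`, a Poisson
summation twisted by the character modulo `12`, shows that the defect of the inversion law does not
depend on `w` (`oddJac_inv_sub_const`). The defect is then a function of `z` alone, with removable
singularities and elliptic of negative index, hence zero (`eq_zero_of_elliptic_of_removable`).

For the lowering operator, `s = √(v/6)` is also made an independent variable. Then `r` depends on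
`conj τ` only through `s`, and the `s`-derivative is explicit (`dirDeriv_minusExt`): the theta
series at `-conj τ` gives `η(-conj τ)`, and the Gaussian turns `E₂` into its completion. -/

lemma sup_mem_of_ne_zero {s : Multiset ℕ} (h : s ≠ 0) : s.sup ∈ s := by
  induction s using Multiset.induction with
  | empty => exact absurd rfl h
  | cons a t ih =>
    rw [Multiset.sup_cons]
    by_cases ht : t = 0
    · simp [ht]
    · rcases le_total a t.sup with h1 | h1
      · rw [sup_eq_right.2 h1]; exact Multiset.mem_cons_of_mem (ih ht)
      · rw [sup_eq_left.2 h1]; exact Multiset.mem_cons_self _ _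

lemma card_le_sum_of_pos {s : Multiset ℕ} (h : ∀ i ∈ s, 0 < i) : Multiset.card s ≤ s.sum := by
  induction s using Multiset.induction with
  | empty => simp
  | cons a t ih =>
    have h1 := h a (Multiset.mem_cons_self _ _)
    have h2 := ih fun i hi => h i (Multiset.mem_cons_of_mem hi)
    simp only [Multiset.card_cons, Multiset.sum_cons]; lia

lemma sum_map_succ (s : Multiset ℕ) : (s.map (· + 1)).sum = s.sum + Multiset.card s := by
  induction s using Multiset.induction with
  | empty => simp
  | cons a t ih => simp only [Multiset.map_cons, Multiset.sum_cons, ih, Multiset.card_cons]; lia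

lemma sum_map_pred_add_card {s : Multiset ℕ} (h : ∀ i ∈ s, 0 < i) :
    (s.map (· - 1)).sum + Multiset.card s = s.sum := by
  induction s using Multiset.induction with
  | empty => simp
  | cons a t ih =>
    have h1 := h a (Multiset.mem_cons_self _ _)
    have h2 := ih fun i hi => h i (Multiset.mem_cons_of_mem hi)
    simp only [Multiset.map_cons, Multiset.sum_cons, Multiset.card_cons]; lia

/-- Erase a part of maximal size and insert a first column of length `l`. -/
def swapRowCol (s : Multiset ℕ) (l : ℕ) : Multiset ℕ :=
  (s.erase s.sup).map (· + 1) + Multiset.replicate (l - Multiset.card (s.erase s.sup)) 1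

/-- Erase the first column and insert a part `a`. -/
def swapColRow (s : Multiset ℕ) (a : ℕ) : Multiset ℕ :=
  (a ::ₘ s.map (· - 1)).filter (· ≠ 0)

/-- The ones supplied by the new column become zeros when that column is stripped again, and the
filter discards them. For the empty multiset the supremum is `0`, so the reinserted part disappears
too. -/
lemma swapColRow_swapRowCol {s : Multiset ℕ} (h : ∀ i ∈ s, 0 < i) (l : ℕ) :
    swapColRow (swapRowCol s l) s.sup = s := by
  have h1 : ((s.erase s.sup).map (· + 1)).map (· - 1) = s.erase s.sup := by
    rw [Multiset.map_map]; simp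
  have h2 : (s.erase s.sup).filter (· ≠ 0) = s.erase s.sup := by
    rw [Multiset.filter_eq_self]
    intro a ha
    exact (h a (Multiset.mem_of_mem_erase ha)).ne'
  have h3 : (Multiset.replicate (l - Multiset.card (s.erase s.sup)) 0).filter (· ≠ 0) = 0 := by
    rw [Multiset.filter_eq_nil]
    intro a ha; simpa using Multiset.eq_of_mem_replicate ha
  rw [swapColRow, swapRowCol, Multiset.map_add, h1, Multiset.map_replicate]
  by_cases h0 : s = 0
  · subst h0; simpa using fun a => Multiset.eq_of_mem_replicate (b := a) (a := 0) (n := l)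
  · have h4 := sup_mem_of_ne_zero h0
    rw [Multiset.filter_cons_of_pos (p := (· ≠ 0)) _ (h _ h4).ne', Multiset.filter_add, h2]
    simp only [Nat.sub_self]
    rw [h3, add_zero, Multiset.cons_erase h4]

lemma sup_swapColRow {s : Multiset ℕ} {a : ℕ} (ha : ∀ i ∈ s, i ≤ a + 1) :
    (swapColRow s a).sup = a := by
  apply le_antisymm
  · rw [Multiset.sup_le]
    intro b hb
    rw [swapColRow, Multiset.mem_filter, Multiset.mem_cons, Multiset.mem_map] at hb
    rcases hb.1 with rfl | ⟨c, hc, rfl⟩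
    · exact le_rfl
    · have := ha c hc; lia
  · rcases Nat.eq_zero_or_pos a with rfl | h0
    · exact Nat.zero_le _
    · apply Multiset.le_sup
      rw [swapColRow, Multiset.mem_filter]
      exact ⟨Multiset.mem_cons_self _ _, h0.ne'⟩

lemma erase_swapColRow {s : Multiset ℕ} {a : ℕ} (ha : ∀ i ∈ s, i ≤ a + 1) :
    (swapColRow s a).erase a = (s.map (· - 1)).filter (· ≠ 0) := by
  rcases Nat.eq_zero_or_pos a with rfl | h0
  · rw [swapColRow, Multiset.filter_cons_of_neg _ (by simp), Multiset.erase_of_notMem]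
    simp
  · rw [swapColRow, Multiset.filter_cons_of_pos (p := (· ≠ 0)) _ h0.ne', Multiset.erase_cons_head]

/-- Stripping the first column loses exactly the parts equal to `1`. Their number is the drop in
cardinality, so that many ones restore the partition. -/
lemma map_succ_filter_map_pred {s : Multiset ℕ} (h : ∀ i ∈ s, 0 < i) :
    ((s.map (· - 1)).filter (· ≠ 0)).map (· + 1)
      + Multiset.replicate (Multiset.card s - Multiset.card ((s.map (· - 1)).filter (· ≠ 0))) 1
      = s := by
  induction s using Multiset.induction with
  | empty => simp
  | cons a t ih =>
    have h1 := h a (Multiset.mem_cons_self _ _)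
    have h2 := ih fun i hi => h i (Multiset.mem_cons_of_mem hi)
    have h3 : Multiset.card ((t.map (· - 1)).filter (· ≠ 0)) ≤ Multiset.card t :=
      (Multiset.card_le_card (Multiset.filter_le _ _)).trans (by simp)
    rw [Multiset.map_cons]
    by_cases h4 : a = 1
    · subst h4
      rw [Multiset.filter_cons_of_neg _ (by simp), Multiset.card_cons,
        Nat.sub_add_comm h3, Multiset.replicate_succ, Multiset.add_cons, h2]
    · rw [Multiset.filter_cons_of_pos _ (by lia), Multiset.map_cons, Multiset.card_cons,
        Multiset.card_cons, Nat.add_sub_add_right, Multiset.cons_add, h2]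
      congr 1; lia

lemma swapRowCol_swapColRow {s : Multiset ℕ} (h : ∀ i ∈ s, 0 < i) {a : ℕ}
    (ha : ∀ i ∈ s, i ≤ a + 1) : swapRowCol (swapColRow s a) (Multiset.card s) = s := by
  rw [swapRowCol, sup_swapColRow ha, erase_swapColRow ha, map_succ_filter_map_pred h]

lemma card_erase_sup_le (s : Multiset ℕ) :
    Multiset.card (s.erase s.sup) ≤ Multiset.card s - 1 ∧
      (s.erase s.sup).sum + s.sup = s.sum := by
  by_cases h0 : s = 0
  · subst h0; simp
  · have h4 := sup_mem_of_ne_zero h0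
    refine ⟨by rw [Multiset.card_erase_of_mem h4]; rfl, ?_⟩
    conv_rhs => rw [← Multiset.cons_erase h4]
    rw [Multiset.sum_cons, add_comm]

/-- **Dyson's bijection** between the partitions of `n' + s + 1` with rank `≥ s` and the partitions
of `n'` with rank `≤ s + 2`. -/
theorem card_le_rank_eq_card_rank_le {s : ℤ} {n n' : ℕ} (hn : (n' : ℤ) + s + 1 = n) :
    Fintype.card {p : Nat.Partition n // s ≤ rank p}
      = Fintype.card {p : Nat.Partition n' // rank p ≤ s + 2} := by
  -- The largest part is traded for a first column shorter by `s + 1`. The rank bound says exactly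
  -- that this column is at least as long as the number of remaining parts.
  have key1 : ∀ p : Nat.Partition n, s ≤ rank p →
      ((p.parts.sup - s - 1).toNat : ℤ) = p.parts.sup - s - 1 ∧
      Multiset.card (p.parts.erase p.parts.sup) ≤ (p.parts.sup - s - 1).toNat := by
    intro p hp
    have hc := (card_erase_sup_le p.parts).1
    unfold rank at hp
    by_cases h0 : p.parts = 0
    · have : n = 0 := by rw [← p.parts_sum, h0]; rfl
      simp [h0] at hp hc ⊢; lia
    · have := Multiset.card_pos.2 h0
      lia
  -- Conversely, the restored part must dominate all parts after the loss of the first column, so it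
  -- must be at least the largest part minus one. This is the bound `s + 2` on the rank.
  have key2 : ∀ p : Nat.Partition n', rank p ≤ s + 2 →
      ((Multiset.card p.parts + s + 1).toNat : ℤ) = Multiset.card p.parts + s + 1 ∧
      ∀ i ∈ p.parts, i ≤ (Multiset.card p.parts + s + 1).toNat + 1 := by
    intro p hp
    unfold rank at hp
    have h1 : (0 : ℤ) ≤ Multiset.card p.parts + s + 1 := by
      by_cases h0 : p.parts = 0
      · have : n' = 0 := by rw [← p.parts_sum, h0]; rfl
        simp [h0]; lia
      · have h2 := p.parts_pos (sup_mem_of_ne_zero h0)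
        lia
    refine ⟨Int.toNat_of_nonneg h1, fun i hi => ?_⟩
    have := Multiset.le_sup hi
    lia
  have key3 : ∀ p : Nat.Partition n, s ≤ rank p →
      Multiset.card (swapRowCol p.parts (p.parts.sup - s - 1).toNat)
        = (p.parts.sup - s - 1).toNat := by
    intro p hp
    have := (key1 p hp).2
    simp only [swapRowCol, Multiset.card_add, Multiset.card_map, Multiset.card_replicate]
    lia
  refine Fintype.card_congr
    { toFun := fun p => ⟨⟨swapRowCol p.1.parts (p.1.parts.sup - s - 1).toNat, ?_, ?_⟩, ?_⟩
      invFun := fun p => ⟨⟨swapColRow p.1.parts (Multiset.card p.1.parts + s + 1).toNat, ?_, ?_⟩, ?_⟩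
      left_inv := ?_
      right_inv := ?_ }
  · intro i hi
    rcases Multiset.mem_add.1 hi with h | h
    · obtain ⟨j, -, rfl⟩ := Multiset.mem_map.1 h; lia
    · rw [Multiset.eq_of_mem_replicate h]; lia
  · have h1 := key1 p.1 p.2
    have h2 := (card_erase_sup_le p.1.parts).2
    have h3 := p.1.parts_sum
    simp only [swapRowCol, Multiset.sum_add, sum_map_succ, Multiset.sum_replicate, smul_eq_mul,
      mul_one]
    lia
  · have h1 := key1 p.1 p.2
    have h3 := key3 p.1 p.2
    show ((swapRowCol p.1.parts (p.1.parts.sup - s - 1).toNat).sup : ℤ) - _ ≤ _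
    rw [h3, h1.1]
    have : (swapRowCol p.1.parts (p.1.parts.sup - s - 1).toNat).sup ≤ p.1.parts.sup + 1 := by
      rw [Multiset.sup_le]
      intro b hb
      rcases Multiset.mem_add.1 hb with h | h
      · obtain ⟨j, hj, rfl⟩ := Multiset.mem_map.1 h
        have := Multiset.le_sup (Multiset.mem_of_mem_erase hj)
        lia
      · rw [Multiset.eq_of_mem_replicate h]; lia
    lia
  · intro i hi
    exact Nat.pos_of_ne_zero (Multiset.mem_filter.1 hi).2
  · have h1 := key2 p.1 p.2
    have h2 := sum_map_pred_add_card (s := p.1.parts) fun i hi => p.1.parts_pos hi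
    have h3 := p.1.parts_sum
    have h4 : ∀ t : Multiset ℕ, (t.filter (· ≠ 0)).sum = t.sum := by
      intro t
      induction t using Multiset.induction with
      | empty => simp
      | cons a t ih =>
        by_cases ha : a = 0
        · rw [Multiset.filter_cons_of_neg _ (by simpa using ha), ih, Multiset.sum_cons, ha, zero_add]
        · rw [Multiset.filter_cons_of_pos (p := (· ≠ 0)) _ ha, Multiset.sum_cons, Multiset.sum_cons, ih]
    rw [swapColRow, h4, Multiset.sum_cons]
    lia
  · have h1 := key2 p.1 p.2
    show s ≤ ((swapColRow p.1.parts (Multiset.card p.1.parts + s + 1).toNat).sup : ℤ)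
      - (Multiset.card (swapColRow p.1.parts (Multiset.card p.1.parts + s + 1).toNat) : ℤ)
    rw [sup_swapColRow h1.2, h1.1]
    have : Multiset.card (swapColRow p.1.parts (Multiset.card p.1.parts + s + 1).toNat)
        ≤ Multiset.card p.1.parts + 1 :=
      (Multiset.card_le_card (Multiset.filter_le _ _)).trans (by simp)
    lia
  · intro p
    apply Subtype.ext
    apply Nat.Partition.ext
    have h1 := key1 p.1 p.2
    have h3 := key3 p.1 p.2
    simp only
    rw [h3, h1.1, show (p.1.parts.sup : ℤ) - s - 1 + s + 1 = p.1.parts.sup by ring, Int.toNat_natCast]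
    exact swapColRow_swapRowCol (fun i hi => p.1.parts_pos hi) _
  · intro p
    apply Subtype.ext
    apply Nat.Partition.ext
    have h1 := key2 p.1 p.2
    simp only
    rw [sup_swapColRow h1.2, h1.1,
      show (Multiset.card p.1.parts : ℤ) + s + 1 - s - 1 = Multiset.card p.1.parts by ring,
      Int.toNat_natCast]
    exact swapRowCol_swapColRow (fun i hi => p.1.parts_pos hi) h1.2

/-! ### Counting partitions by rank -/

/-- The number of partitions of `n` with rank at least `s`. -/
def numRankGE (s : ℤ) (n : ℕ) : ℕ := Fintype.card {p : Nat.Partition n // s ≤ rank p}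

lemma numRankGE_le (s : ℤ) (n : ℕ) : numRankGE s n ≤ Fintype.card (Nat.Partition n) :=
  Fintype.card_subtype_le _

lemma rank_lt {n : ℕ} (hn : n ≠ 0) (p : Nat.Partition n) : rank p < n := by
  have h0 : p.parts ≠ 0 := by
    intro h; apply hn; rw [← p.parts_sum, h]; rfl
  have h1 := Multiset.card_pos.2 h0
  have h2 : p.parts.sup ≤ n := by
    rw [Multiset.sup_le]; intro b hb; exact Nat.Partition.le_of_mem_parts hb
  unfold rank; lia

lemma neg_lt_rank {n : ℕ} (hn : n ≠ 0) (p : Nat.Partition n) : -(n : ℤ) < rank p := by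
  have h0 : p.parts ≠ 0 := by
    intro h; apply hn; rw [← p.parts_sum, h]; rfl
  have h1 := p.parts_pos (sup_mem_of_ne_zero h0)
  have h2 : Multiset.card p.parts ≤ n := by
    exact (card_le_sum_of_pos fun i hi => p.parts_pos hi).trans p.parts_sum.le
  unfold rank; lia

lemma rank_zero (p : Nat.Partition 0) : rank p = 0 := by
  have : p.parts = 0 := by
    rw [Multiset.eq_zero_iff_forall_notMem]
    intro a ha
    have := p.parts_pos ha
    have := Nat.Partition.le_of_mem_parts ha
    lia
  rw [rank, this]; rfl

lemma abs_rank_le {n : ℕ} (p : Nat.Partition n) : |rank p| ≤ n := by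
  by_cases h : n = 0
  · subst h; simp [rank_zero]
  · rw [abs_le]; exact ⟨(neg_lt_rank h p).le, (rank_lt h p).le⟩

lemma numRankGE_eq_zero {s : ℤ} {n : ℕ} (hs : 1 ≤ s) (h : (n : ℤ) ≤ s) : numRankGE s n = 0 := by
  rw [numRankGE, Fintype.card_eq_zero_iff]
  refine ⟨fun p => ?_⟩
  have h1 := p.2
  by_cases h0 : n = 0
  · subst h0; rw [rank_zero] at h1; lia
  · have := rank_lt h0 p.1; lia

lemma numRankGE_eq_card {s : ℤ} {n : ℕ} (hs : s ≤ 0) (h : (n : ℤ) ≤ 1 - s) :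
    numRankGE s n = Fintype.card (Nat.Partition n) := by
  rw [numRankGE]
  apply Fintype.card_of_bijective (f := Subtype.val)
  refine ⟨Subtype.val_injective, fun p => ⟨⟨p, ?_⟩, rfl⟩⟩
  by_cases h0 : n = 0
  · subst h0; rw [rank_zero]; exact hs
  · have := neg_lt_rank h0 p; lia

lemma card_rank_lt_add (s : ℤ) (n : ℕ) :
    Fintype.card {p : Nat.Partition n // rank p < s} + numRankGE s n
      = Fintype.card (Nat.Partition n) := by
  have := Fintype.card_subtype_compl (fun p : Nat.Partition n => s ≤ rank p)
  have h2 : Fintype.card {p : Nat.Partition n // rank p < s}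
      = Fintype.card {p : Nat.Partition n // ¬ s ≤ rank p} :=
    Fintype.card_congr (Equiv.subtypeEquivRight fun p => by rw [not_le])
  have h3 := numRankGE_le s n
  rw [h2, this]
  unfold numRankGE at h3 ⊢
  lia

/-- Dyson's recursion. -/
lemma numRankGE_add {s : ℤ} {n n' : ℕ} (hn : (n' : ℤ) + s + 1 = n) :
    numRankGE s n + numRankGE (s + 3) n' = Fintype.card (Nat.Partition n') := by
  have h1 := card_le_rank_eq_card_rank_le hn
  have h2 := card_rank_lt_add (s + 3) n'
  have h3 : Fintype.card {p : Nat.Partition n' // rank p < s + 3}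
      = Fintype.card {p : Nat.Partition n' // rank p ≤ s + 2} :=
    Fintype.card_congr (Equiv.subtypeEquivRight fun p => by lia)
  unfold numRankGE at *
  lia

/-- Conjugation is not used. Dyson's recursion at `s` and, with the two sizes exchanged, at `-2 - s`
reduces both counts for `n` to counts for `n' = n - s - 1` at `s + 3` and `-2 - s`. These arguments
again add up to `1`, so strong induction applies. -/
lemma numRankGE_symm_of_pos (n : ℕ) : ∀ s : ℤ, 1 ≤ s →
    numRankGE s n + numRankGE (1 - s) n = Fintype.card (Nat.Partition n) := by
  induction n using Nat.strong_induction_on with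
  | _ n ih =>
    intro s hs
    by_cases h : (n : ℤ) ≤ s
    · rw [numRankGE_eq_zero hs h, numRankGE_eq_card (by lia) (by lia), zero_add]
    · obtain ⟨n', hn'⟩ : ∃ n' : ℕ, (n' : ℤ) + s + 1 = n := ⟨(n - s - 1).toNat, by lia⟩
      have h1 := numRankGE_add hn'
      have h2 := numRankGE_add (s := -2 - s) (n := n') (n' := n) (by lia)
      have h3 := ih n' (by lia) (s + 3) (by lia)
      rw [show -2 - s + 3 = 1 - s by ring] at h2
      rw [show 1 - (s + 3) = -2 - s by ring] at h3
      lia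

/-- The symmetry of the rank under conjugation. -/
lemma numRankGE_symm (s : ℤ) (n : ℕ) :
    numRankGE s n + numRankGE (1 - s) n = Fintype.card (Nat.Partition n) := by
  rcases le_or_gt 1 s with h | h
  · exact numRankGE_symm_of_pos n s h
  · have := numRankGE_symm_of_pos n (1 - s) (by lia)
    rw [sub_sub_cancel] at this
    lia

lemma card_rank_le_neg (s : ℤ) (n : ℕ) :
    Fintype.card {p : Nat.Partition n // rank p ≤ -s} = numRankGE s n := by
  have h1 := card_rank_lt_add (1 - s) n
  have h2 := numRankGE_symm s n
  have h3 : Fintype.card {p : Nat.Partition n // rank p < 1 - s}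
      = Fintype.card {p : Nat.Partition n // rank p ≤ -s} :=
    Fintype.card_congr (Equiv.subtypeEquivRight fun p => by lia)
  lia

lemma finsum_mul_N {R : Type*} [CommSemiring R] (f : ℤ → R) (n : ℕ) :
    ∑ᶠ m : ℤ, f m * (N m n : R) = ∑ p : Nat.Partition n, f (rank p) := by
  classical
  rw [finsum_eq_sum_of_support_subset (s := Finset.univ.image (rank (n := n)))]
  · rw [← Finset.sum_fiberwise_of_maps_to (s := Finset.univ) (t := Finset.univ.image (rank (n := n)))
      (g := rank) (fun p _ => Finset.mem_image_of_mem _ (Finset.mem_univ p))]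
    refine Finset.sum_congr rfl fun m _ => ?_
    rw [Finset.sum_congr rfl (g := fun _ => f m)
      (fun p hp => by rw [(Finset.mem_filter.1 hp).2]), Finset.sum_const, N,
      Fintype.card_subtype, nsmul_eq_mul, mul_comm]
  · intro m hm
    have h : N m n ≠ 0 := by
      intro h; apply hm; simp [h]
    obtain ⟨p, hp⟩ := Fintype.card_pos_iff.mp (Nat.pos_of_ne_zero h)
    simpa using ⟨p, hp⟩

lemma rankMoment_eq (k n : ℕ) : rankMoment k n = ∑ p : Nat.Partition n, rank p ^ k := by
  have := finsum_mul_N (R := ℤ) (fun m => m ^ k) n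
  simpa [rankMoment] using this

lemma N_neg (m : ℤ) (n : ℕ) : N (-m) n = N m n := by
  have h1 : ∀ m, N m n + numRankGE (m + 1) n = numRankGE m n := by
    intro m
    rw [N, numRankGE, numRankGE, Fintype.card_subtype, Fintype.card_subtype, Fintype.card_subtype,
      ← Finset.card_union_of_disjoint]
    · congr 1; ext p; simp; lia
    · rw [Finset.disjoint_filter]; intro p _ h; lia
  have h2 := h1 m
  have h3 := h1 (-m)
  have h4 := numRankGE_symm m n
  have h5 := numRankGE_symm (m + 1) n
  rw [show 1 - m = -m + 1 by ring] at h4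
  rw [show 1 - (m + 1) = -m by ring] at h5
  lia

lemma sum_comp_neg_rank {M : Type*} [CommSemiring M] (f : ℤ → M) (n : ℕ) :
    ∑ p : Nat.Partition n, f (-rank p) = ∑ p : Nat.Partition n, f (rank p) := by
  rw [← finsum_mul_N (fun m => f (-m)), ← finsum_mul_N f, ← finsum_comp_equiv (Equiv.neg ℤ)]
  refine finsum_congr fun m => ?_
  simp [N_neg]

lemma rankMoment_odd {k : ℕ} (hk : Odd k) (n : ℕ) : rankMoment k n = 0 := by
  have h := sum_comp_neg_rank (fun m : ℤ => m ^ k) n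
  simp only [hk.neg_pow, Finset.sum_neg_distrib] at h
  rw [rankMoment_eq]
  lia

/-! ### Growth of the partition function -/

lemma sum_count_fin {K n : ℕ} (hn : n ≤ K) (p : Nat.Partition n) :
    ∑ i : Fin K, (i.1 + 1) * p.parts.count (i.1 + 1) = n := by
  rw [Fin.sum_univ_eq_sum_range (fun i => (i + 1) * p.parts.count (i + 1)) K]
  conv_rhs => rw [← p.parts_sum, Finset.sum_multiset_count]
  have h : p.parts.toFinset ⊆ (Finset.range K).image (· + 1) := by
    intro a ha
    rw [Multiset.mem_toFinset] at ha
    have h1 := p.parts_pos ha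
    have h2 := Nat.Partition.le_of_mem_parts ha
    rw [Finset.mem_image]
    exact ⟨a - 1, by rw [Finset.mem_range]; lia, by lia⟩
  rw [Finset.sum_subset h, Finset.sum_image (by intro a _ b _ h; simpa using h)]
  · exact Finset.sum_congr rfl fun i _ => by rw [smul_eq_mul, mul_comm]
  · intro a _ ha
    rw [Multiset.mem_toFinset] at ha
    rw [Multiset.count_eq_zero_of_notMem ha, zero_smul]

/-- A truncated Euler product. A partition of `n ≤ K` is determined, together with `n`, by its
multiplicities of `1, …, K`, each at most `K`; hence the left side is part of the expanded product.
-/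
lemma sum_card_partition_le {x : ℝ} (hx0 : 0 ≤ x) (K : ℕ) :
    ∑ n ∈ Finset.range (K + 1), (Fintype.card (Nat.Partition n) : ℝ) * x ^ n
      ≤ ∏ i : Fin K, ∑ j ∈ Finset.range (K + 1), x ^ ((i.1 + 1) * j) := by
  classical
  rw [Finset.prod_univ_sum]
  have h1 : ∑ n ∈ Finset.range (K + 1), (Fintype.card (Nat.Partition n) : ℝ) * x ^ n
      = ∑ p ∈ (Finset.range (K + 1)).sigma (fun n => (Finset.univ : Finset (Nat.Partition n))),
          x ^ p.1 := by
    rw [Finset.sum_sigma]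
    exact Finset.sum_congr rfl fun n _ => by simp [Finset.card_univ]
  let F : (Σ n, Nat.Partition n) → (Fin K → ℕ) := fun p i => p.2.parts.count (i.1 + 1)
  have hF : Set.InjOn F ((Finset.range (K + 1)).sigma
      (fun n => (Finset.univ : Finset (Nat.Partition n)))) := by
    rintro ⟨n, p⟩ hp ⟨m, r⟩ hr h
    simp only [Finset.coe_sigma, Set.mem_sigma_iff, Finset.coe_range, Set.mem_Iio] at hp hr
    have hpr : ∀ i : Fin K, p.parts.count (i.1 + 1) = r.parts.count (i.1 + 1) :=
      fun i => congrFun h i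
    have hnm : n = m := by
      rw [← sum_count_fin (K := K) (by lia) p, ← sum_count_fin (K := K) (by lia) r]
      exact Finset.sum_congr rfl fun i _ => by rw [hpr]
    subst hnm
    congr 1
    apply Nat.Partition.ext
    ext a
    by_cases ha : 1 ≤ a ∧ a ≤ K
    · have := hpr ⟨a - 1, by lia⟩
      simpa [Nat.sub_add_cancel ha.1] using this
    · rw [Multiset.count_eq_zero_of_notMem, Multiset.count_eq_zero_of_notMem]
      · intro h; have := r.parts_pos h; have := Nat.Partition.le_of_mem_parts h; lia
      · intro h; have := p.parts_pos h; have := Nat.Partition.le_of_mem_parts h; lia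
  have h2 : ∀ p ∈ (Finset.range (K + 1)).sigma (fun n => (Finset.univ : Finset (Nat.Partition n))),
      x ^ p.1 = ∏ i : Fin K, x ^ ((i.1 + 1) * F p i) := by
    rintro ⟨n, p⟩ hp
    simp only [Finset.mem_sigma, Finset.mem_range] at hp
    rw [Finset.prod_pow_eq_pow_sum]
    exact congrArg _ (sum_count_fin (by lia) p).symm
  rw [h1, Finset.sum_congr rfl h2, ← Finset.sum_image (f := fun g : Fin K → ℕ =>
    ∏ i : Fin K, x ^ ((i.1 + 1) * g i)) hF]
  refine Finset.sum_le_sum_of_subset_of_nonneg ?_ fun _ _ _ => Finset.prod_nonneg fun _ _ => by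
    positivity
  intro g hg
  obtain ⟨⟨n, p⟩, hp, rfl⟩ := Finset.mem_image.1 hg
  simp only [Finset.mem_sigma, Finset.mem_range] at hp
  rw [Fintype.mem_piFinset]
  intro i
  rw [Finset.mem_range]
  have h3 : p.parts.count (i.1 + 1) ≤ Multiset.card p.parts := Multiset.count_le_card _ _
  have h4 : Multiset.card p.parts ≤ n :=
    (card_le_sum_of_pos fun i hi => p.parts_pos hi).trans p.parts_sum.le
  show p.parts.count (i.1 + 1) < K + 1
  lia

/-- With `y = x^(i+1)`, each Euler factor is at most `1/(1-y) = 1 + y/(1-y) ≤ exp(x^i / (1-x))`,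
which bounds the truncated products uniformly in `K`. -/
lemma summable_card_partition {x : ℝ} (hx0 : 0 ≤ x) (hx : x < 1) :
    Summable fun n : ℕ => (Fintype.card (Nat.Partition n) : ℝ) * x ^ n := by
  have h1x : 0 < 1 - x := by linarith
  refine summable_of_sum_range_le (c := Real.exp (1 / (1 - x) * (1 / (1 - x))))
    (fun n => by positivity) fun K => ?_
  refine le_trans (Finset.sum_le_sum_of_subset_of_nonneg (t := Finset.range (K + 1)) ?_ ?_) ?_
  · exact Finset.range_mono (Nat.le_succ K)
  · intro n _ _; positivity
  refine (sum_card_partition_le hx0 K).trans ?_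
  have hb : ∀ i : Fin K, ∑ j ∈ Finset.range (K + 1), x ^ ((i.1 + 1) * j)
      ≤ Real.exp (x ^ i.1 * (1 / (1 - x))) := by
    intro i
    have hy1 : x ^ (i.1 + 1) ≤ x := by
      simpa using pow_le_pow_of_le_one hx0 hx.le (Nat.succ_le_succ (Nat.zero_le i.1))
    have hy0 : 0 ≤ x ^ (i.1 + 1) := by positivity
    set y := x ^ (i.1 + 1) with hy
    have h2 : ∑ j ∈ Finset.range (K + 1), x ^ ((i.1 + 1) * j) ≤ (1 - y)⁻¹ := by
      simp_rw [pow_mul, ← hy]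
      rw [← tsum_geometric_of_lt_one hy0 (by linarith)]
      exact (summable_geometric_of_lt_one hy0 (by linarith)).sum_le_tsum _
        (fun j _ => by positivity)
    refine h2.trans ?_
    have h3 : (1 - y)⁻¹ = y / (1 - y) + 1 := by
      have : 1 - y ≠ 0 := by linarith
      field_simp; ring
    have h4 : y / (1 - y) ≤ x ^ i.1 * (1 / (1 - x)) := by
      rw [mul_one_div]
      apply div_le_div₀ (by positivity) _ h1x (by linarith)
      exact pow_le_pow_of_le_one hx0 hx.le (Nat.le_succ _)
    rw [h3]
    exact (Real.add_one_le_exp _).trans (Real.exp_le_exp.2 h4)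
  refine (Finset.prod_le_prod (fun i _ => Finset.sum_nonneg fun _ _ => by positivity)
    fun i _ => hb i).trans ?_
  rw [← Real.exp_sum, ← Finset.sum_mul]
  apply Real.exp_le_exp.2
  apply mul_le_mul_of_nonneg_right _ (by positivity)
  rw [Fin.sum_univ_eq_sum_range (fun i => x ^ i) K, one_div, ← tsum_geometric_of_lt_one hx0 hx]
  exact (summable_geometric_of_lt_one hx0 hx).sum_le_tsum _ (fun j _ => by positivity)

lemma summable_pow_mul_card_partition (k : ℕ) {x : ℝ} (hx0 : 0 ≤ x) (hx : x < 1) :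
    Summable fun n : ℕ => (n : ℝ) ^ k * (Fintype.card (Nat.Partition n) * x ^ n) := by
  obtain ⟨y, hxy, hy1⟩ := exists_between hx
  have hy0 : 0 < y := hx0.trans_lt hxy
  have h1 := (summable_card_partition hy0.le hy1).tendsto_atTop_zero.bddAbove_range
  obtain ⟨C, hC⟩ := h1
  have hxy1 : ‖x / y‖ < 1 := by
    rw [Real.norm_of_nonneg (by positivity), div_lt_one hy0]; exact hxy
  refine Summable.of_nonneg_of_le (fun n => by positivity) (fun n => ?_)
    ((summable_pow_mul_geometric_of_norm_lt_one k hxy1).mul_right C)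
  have h2 : (Fintype.card (Nat.Partition n) : ℝ) * y ^ n ≤ C := hC ⟨n, rfl⟩
  calc (n : ℝ) ^ k * (Fintype.card (Nat.Partition n) * x ^ n)
      = (n : ℝ) ^ k * (x / y) ^ n * (Fintype.card (Nat.Partition n) * y ^ n) := by
        rw [div_pow]; field_simp
    _ ≤ _ := by gcongr

/-! ### Generating functions -/

/-- The generating function of the partitions with rank at least `s`. -/
noncomputable def rankGEGen (s : ℤ) (q : ℂ) : ℂ := ∑' n : ℕ, (numRankGE s n : ℂ) * q ^ n

/-- The generating function of the partitions. -/
noncomputable def partGen (q : ℂ) : ℂ := ∑' n : ℕ, (Fintype.card (Nat.Partition n) : ℂ) * q ^ n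

/-- The pentagonal numbers `1, 5, 12, …`. -/
def pent (j : ℕ) : ℕ := (j + 1) * (3 * j + 2) / 2

lemma pent_zero : pent 0 = 1 := rfl

lemma two_mul_pent (j : ℕ) : 2 * pent j = (j + 1) * (3 * j + 2) := by
  apply Nat.mul_div_cancel'
  rcases Nat.even_or_odd' j with ⟨m, rfl | rfl⟩
  · exact ⟨(2 * m + 1) * (3 * m + 1), by ring⟩
  · exact ⟨(m + 1) * (6 * m + 5), by ring⟩

lemma pent_succ (j : ℕ) : pent (j + 1) = pent j + (3 * j + 4) := by
  have h1 := two_mul_pent j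
  have h2 := two_mul_pent (j + 1)
  nlinarith

lemma le_pent (j : ℕ) : j ≤ pent j := by
  have := two_mul_pent j
  nlinarith

variable {q : ℂ}

lemma summable_norm_partGen (hq : ‖q‖ < 1) :
    Summable fun n : ℕ => ‖(Fintype.card (Nat.Partition n) : ℂ) * q ^ n‖ := by
  simpa [norm_mul, norm_pow] using summable_card_partition (norm_nonneg q) hq

lemma norm_rankGE_term_le (s : ℤ) (n : ℕ) :
    ‖(numRankGE s n : ℂ) * q ^ n‖ ≤ ‖(Fintype.card (Nat.Partition n) : ℂ) * q ^ n‖ := by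
  rw [norm_mul, norm_mul, Complex.norm_natCast, Complex.norm_natCast]
  have := numRankGE_le s n
  gcongr

lemma summable_norm_rankGEGen (s : ℤ) (hq : ‖q‖ < 1) :
    Summable fun n : ℕ => ‖(numRankGE s n : ℂ) * q ^ n‖ :=
  Summable.of_nonneg_of_le (fun _ => norm_nonneg _) (norm_rankGE_term_le s)
    (summable_norm_partGen hq)

lemma norm_rankGEGen_le (s : ℤ) (hq : ‖q‖ < 1) :
    ‖rankGEGen s q‖ ≤ ∑' n : ℕ, ‖(Fintype.card (Nat.Partition n) : ℂ) * q ^ n‖ :=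
  (norm_tsum_le_tsum_norm (summable_norm_rankGEGen s hq)).trans
    ((summable_norm_rankGEGen s hq).tsum_le_tsum (norm_rankGE_term_le s) (summable_norm_partGen hq))

/-- Dyson's recursion, coefficient by coefficient. Below `q^(s+1)` only the empty partition can
contribute, and it does so when `s = 0`. -/
lemma rankGEGen_eq (s : ℕ) (hq : ‖q‖ < 1) :
    rankGEGen s q = (if s = 0 then 1 else 0) + q ^ (s + 1) * (partGen q - rankGEGen (s + 3 : ℕ) q) := by
  have h1 : ∀ n : ℕ, (numRankGE s (n + (s + 1)) : ℂ)
      = Fintype.card (Nat.Partition n) - numRankGE (s + 3 : ℕ) n := by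
    intro n
    have := numRankGE_add (s := s) (n := n + (s + 1)) (n' := n) (by push_cast; ring)
    rw [← this]; push_cast; ring
  rw [rankGEGen, ← (summable_norm_rankGEGen s hq).of_norm.sum_add_tsum_nat_add (s + 1)]
  congr 1
  · split_ifs with h
    · subst h
      have : numRankGE 0 0 = 1 := by
        rw [numRankGE_eq_card le_rfl (by simp)]; rfl
      simp [this]
    · apply Finset.sum_eq_zero
      intro n hn
      rw [Finset.mem_range] at hn
      rw [numRankGE_eq_zero (by lia) (by lia)]; simp
  · rw [partGen, rankGEGen, ← (summable_norm_partGen hq).of_norm.tsum_sub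
      (summable_norm_rankGEGen _ hq).of_norm, ← tsum_mul_left]
    refine tsum_congr fun n => ?_
    rw [h1, pow_add]; ring

/-- The partial theta series in the generating function of the partitions with rank `≥ s`. -/
noncomputable def partialTheta (s : ℕ) (q : ℂ) : ℂ :=
  ∑' j : ℕ, (-1) ^ j * q ^ (pent j + (j + 1) * s)

lemma norm_partialTheta_term_le (s : ℕ) (hq : ‖q‖ < 1) (j : ℕ) :
    ‖(-1) ^ j * q ^ (pent j + (j + 1) * s)‖ ≤ ‖q‖ ^ j := by
  rw [norm_mul, norm_pow, norm_neg, norm_one, one_pow, one_mul, norm_pow]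
  exact pow_le_pow_of_le_one (norm_nonneg _) hq.le ((le_pent j).trans (Nat.le_add_right _ _))

lemma summable_partialTheta (s : ℕ) (hq : ‖q‖ < 1) :
    Summable fun j : ℕ => (-1) ^ j * q ^ (pent j + (j + 1) * s) :=
  Summable.of_norm_bounded (summable_geometric_of_lt_one (norm_nonneg _) hq)
    (norm_partialTheta_term_le s hq)

lemma norm_partialTheta_le (s : ℕ) (hq : ‖q‖ < 1) : ‖partialTheta s q‖ ≤ (1 - ‖q‖)⁻¹ := by
  rw [← tsum_geometric_of_lt_one (norm_nonneg _) hq]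
  exact tsum_of_norm_bounded (summable_geometric_of_lt_one (norm_nonneg _) hq).hasSum
    (norm_partialTheta_term_le s hq)

lemma partialTheta_eq (s : ℕ) (hq : ‖q‖ < 1) :
    partialTheta s q = q ^ (s + 1) * (1 - partialTheta (s + 3) q) := by
  rw [partialTheta, (summable_partialTheta s hq).tsum_eq_zero_add, partialTheta, mul_sub,
    ← tsum_mul_left, pent_zero, sub_eq_add_neg, ← tsum_neg]
  congr 1
  · simp [add_comm]
  · refine tsum_congr fun j => ?_
    rw [pent_succ, pow_succ, show pent j + (3 * j + 4) + (j + 1 + 1) * s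
      = (s + 1) + (pent j + (j + 1) * (s + 3)) by ring, pow_add q (s + 1)]
    ring

/-- Both sides obey the same recursion, so their difference at `s` is `-q^(s+1)` times the
difference at `s + 3`. It is bounded uniformly in `s`, and iteration contracts it to zero. The case
`s = 0` is excluded because of the extra constant in the recursion. -/
lemma rankGEGen_eq_mul_partialTheta {s : ℕ} (hs : s ≠ 0) (hq : ‖q‖ < 1) :
    rankGEGen s q = partGen q * partialTheta s q := by
  set C := (∑' n : ℕ, ‖(Fintype.card (Nat.Partition n) : ℂ) * q ^ n‖)
    + ‖partGen q‖ * (1 - ‖q‖)⁻¹ with hC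
  have hb : ∀ s : ℕ, ‖rankGEGen s q - partGen q * partialTheta s q‖ ≤ C := fun s =>
    (norm_sub_le _ _).trans (add_le_add (norm_rankGEGen_le s hq) (by
      rw [norm_mul]; exact mul_le_mul_of_nonneg_left (norm_partialTheta_le s hq) (norm_nonneg _)))
  have hrec : ∀ k s : ℕ, s ≠ 0 →
      ‖rankGEGen s q - partGen q * partialTheta s q‖ ≤ ‖q‖ ^ k * C := by
    intro k
    induction k with
    | zero => intro s _; simpa using hb s
    | succ k ih =>
      intro s hs
      have h1 : rankGEGen s q - partGen q * partialTheta s q = -(q ^ (s + 1)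
          * (rankGEGen (s + 3 : ℕ) q - partGen q * partialTheta (s + 3) q)) := by
        rw [rankGEGen_eq s hq, partialTheta_eq s hq, if_neg hs]; ring
      rw [h1, norm_neg, norm_mul, norm_pow, pow_succ' ‖q‖ k, mul_assoc]
      have h2 : ‖q‖ ^ (s + 1) ≤ ‖q‖ := by
        simpa using pow_le_pow_of_le_one (norm_nonneg _) hq.le (Nat.succ_le_succ (Nat.zero_le s))
      exact mul_le_mul h2 (ih _ (by lia)) (norm_nonneg _) (norm_nonneg _)
  have hlim : Filter.Tendsto (fun k : ℕ => ‖q‖ ^ k * C) Filter.atTop (nhds 0) := by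
    simpa using (tendsto_pow_atTop_nhds_zero_of_lt_one (norm_nonneg _) hq).mul_const C
  have := ge_of_tendsto' hlim fun k => hrec k s hs
  exact sub_eq_zero.1 (norm_le_zero_iff.1 this)

/-- The reciprocal of the generating function of partitions (Euler's pentagonal number theorem). -/
lemma partGen_mul (hq : ‖q‖ < 1) :
    partGen q * (1 - partialTheta 0 q - partialTheta 1 q) = 1 := by
  -- At `s = 0` the recursion carries the constant `1` of the empty partition. Together with the
  -- symmetry `G_0 + G_1 = P` it gives `P = 1 + P θ_0 + P θ_1`, where `θ_s` is the partial theta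
  -- series.
  have h0 := rankGEGen_eq 0 hq
  have h3 := rankGEGen_eq_mul_partialTheta (s := 3) (by norm_num) hq
  have h1 := rankGEGen_eq_mul_partialTheta (s := 1) (by norm_num) hq
  have h4 := partialTheta_eq 0 hq
  have h5 : rankGEGen (1 : ℕ) q + rankGEGen (0 : ℕ) q = partGen q := by
    rw [rankGEGen, rankGEGen, partGen, ← (summable_norm_rankGEGen _ hq).of_norm.tsum_add
      (summable_norm_rankGEGen _ hq).of_norm]
    refine tsum_congr fun n => ?_
    have := numRankGE_symm 1 n
    rw [sub_self] at this
    rw [← this]; push_cast; ring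
  simp only [zero_add, pow_one, if_true] at h0 h4
  rw [h3] at h0
  linear_combination -h5 + h1 + h0 - partGen q * h4

lemma tsum_swap {f : ℕ → ℕ → ℂ} (h : Summable fun x : ℕ × ℕ => f x.1 x.2) :
    ∑' a, ∑' b, f a b = ∑' b, ∑' a, f a b :=
  (Summable.tsum_comm (f := f) h).symm

lemma hasSum_exp_series (x : ℂ) : HasSum (fun k : ℕ => x ^ k / k.factorial) (Complex.exp x) := by
  have := NormedSpace.expSeries_div_hasSum_exp x
  rwa [← Complex.exp_eq_exp_ℂ] at this

lemma hasSum_real_exp_series (x : ℝ) :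
    HasSum (fun k : ℕ => x ^ k / k.factorial) (Real.exp x) := by
  have := NormedSpace.expSeries_div_hasSum_exp x
  rwa [← Real.exp_eq_exp_ℝ] at this

/-! ### The two-variable rank generating function -/

/-- The generating function `∑ N(m, n) ζ ^ m q ^ n`. -/
noncomputable def rankGF (ζ q : ℂ) : ℂ := ∑' n : ℕ, (∑ p : Nat.Partition n, ζ ^ rank p) * q ^ n

lemma sum_range_indicator_zpow {ζ : ℂ} (c : ℂ) {m : ℤ} {n : ℕ} (hm : m ≤ n) :
    ∑ s ∈ Finset.range n, (if (s + 1 : ℤ) ≤ m then (ζ - 1) * ζ ^ s * c else 0)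
      = (ζ ^ m.toNat - 1) * c := by
  rw [← Finset.sum_filter]
  have : (Finset.range n).filter (fun s : ℕ => (s + 1 : ℤ) ≤ m) = Finset.range m.toNat := by
    ext s; simp; lia
  rw [this, ← Finset.sum_mul, ← Finset.mul_sum, mul_geom_sum]

/-- A telescoping geometric sum trades `ζ^m` for indicators of `s + 1 ≤ m` and `s + 1 ≤ -m`, so that
sums over partitions become sums of the counts `numRankGE`. -/
lemma zpow_eq_sum_range {ζ : ℂ} {m : ℤ} {n : ℕ} (hm : |m| ≤ n) :
    ζ ^ m = 1 + ∑ s ∈ Finset.range n, ((if (s + 1 : ℤ) ≤ m then (ζ - 1) * ζ ^ s else 0)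
      + (if (s + 1 : ℤ) ≤ -m then (ζ⁻¹ - 1) * ζ⁻¹ ^ s else 0)) := by
  have h1 := sum_range_indicator_zpow (ζ := ζ) 1 (m := m) (n := n) (le_of_abs_le hm)
  have h2 := sum_range_indicator_zpow (ζ := ζ⁻¹) 1 (m := -m) (n := n) (by have := neg_le_of_abs_le hm; lia)
  simp only [mul_one] at h1 h2
  rw [Finset.sum_add_distrib, h1, h2]
  rcases le_total 0 m with h | h
  · obtain ⟨k, rfl⟩ := Int.eq_ofNat_of_zero_le h
    simp
  · obtain ⟨k, hk⟩ := Int.eq_ofNat_of_zero_le (neg_nonneg.2 h)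
    obtain rfl : m = -k := by lia
    simp

lemma sum_zpow_rank (ζ : ℂ) (n : ℕ) : ∑ p : Nat.Partition n, ζ ^ rank p
    = Fintype.card (Nat.Partition n) + ∑ s ∈ Finset.range n,
      ((ζ - 1) * ζ ^ s + (ζ⁻¹ - 1) * ζ⁻¹ ^ s) * numRankGE (s + 1 : ℕ) n := by
  rw [Finset.sum_congr rfl fun p _ => zpow_eq_sum_range (ζ := ζ) (abs_rank_le p),
    Finset.sum_add_distrib, Finset.sum_const, nsmul_eq_mul, mul_one, Finset.card_univ,
    Finset.sum_comm]
  congr 1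
  refine Finset.sum_congr rfl fun s _ => ?_
  rw [Finset.sum_add_distrib, ← Finset.sum_filter, ← Finset.sum_filter, Finset.sum_const,
    Finset.sum_const, nsmul_eq_mul, nsmul_eq_mul, ← Fintype.card_subtype, ← Fintype.card_subtype]
  have h1 : Fintype.card {p : Nat.Partition n // (s + 1 : ℤ) ≤ rank p}
      = numRankGE (s + 1 : ℕ) n := rfl
  have h2 : Fintype.card {p : Nat.Partition n // (s + 1 : ℤ) ≤ -rank p}
      = numRankGE (s + 1 : ℕ) n := by
    rw [← card_rank_le_neg]
    exact Fintype.card_congr (Equiv.subtypeEquivRight fun p => by push_cast; lia)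
  rw [h1, h2]; ring

lemma sum_zpow_rank_eq_tsum (ζ : ℂ) (n : ℕ) : ∑ p : Nat.Partition n, ζ ^ rank p
    = Fintype.card (Nat.Partition n) + ∑' s : ℕ,
      ((ζ - 1) * ζ ^ s + (ζ⁻¹ - 1) * ζ⁻¹ ^ s) * numRankGE (s + 1 : ℕ) n := by
  rw [sum_zpow_rank, tsum_eq_sum]
  intro s hs
  rw [Finset.mem_range] at hs
  rw [numRankGE_eq_zero (by lia) (by lia)]; simp

/-- No partition of `n ≤ s` has rank at least `s + 1`. On the remaining range `|ζ|^s` is at most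
`ρ'^n (ρ/ρ')^s`, where `ρ'` is slightly larger than `ρ` and still `ρ' |q| < 1`. -/
lemma summable_pow_mul_rankGE {ζ : ℂ} {ρ : ℝ} (hζ : ‖ζ‖ ≤ ρ) (hρ : 1 ≤ ρ) (hq : ρ * ‖q‖ < 1) :
    Summable fun x : ℕ × ℕ => ‖ζ ^ x.2 * ((numRankGE (x.2 + 1 : ℕ) x.1 : ℂ) * q ^ x.1)‖ := by
  obtain ⟨ρ', h1, h2⟩ : ∃ ρ', ρ < ρ' ∧ ρ' * ‖q‖ < 1 := by
    by_cases h : ‖q‖ = 0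
    · exact ⟨ρ + 1, by linarith, by rw [h]; norm_num⟩
    · have h0 : 0 < ‖q‖ := lt_of_le_of_ne (norm_nonneg _) (Ne.symm h)
      obtain ⟨r, hr1, hr2⟩ := exists_between ((lt_div_iff₀ h0).2 hq)
      exact ⟨r, hr1, (lt_div_iff₀ h0).1 hr2⟩
  have hρ' : 0 < ρ' := by linarith
  have hs1 := summable_card_partition (x := ρ' * ‖q‖) (by positivity) h2
  have hs2 : Summable fun s : ℕ => (ρ / ρ') ^ s :=
    summable_geometric_of_lt_one (by positivity) ((div_lt_one hρ').2 h1)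
  refine Summable.of_nonneg_of_le (fun _ => norm_nonneg _) (fun x => ?_)
    (hs1.mul_of_nonneg hs2 (fun n => by positivity) (fun n => by positivity))
  obtain ⟨n, s⟩ := x
  simp only [norm_mul, norm_pow, Complex.norm_natCast]
  by_cases h : n ≤ s
  · rw [numRankGE_eq_zero (by lia) (by push_cast; lia)]
    simp only [Nat.cast_zero, zero_mul, mul_zero]
    positivity
  · have h3 : ‖ζ‖ ^ s ≤ ρ' ^ n * (ρ / ρ') ^ s := by
      calc ‖ζ‖ ^ s ≤ ρ ^ s := by gcongr
        _ = ρ' ^ s * (ρ / ρ') ^ s := by rw [← mul_pow]; congr 1; field_simp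
        _ ≤ _ := by
          gcongr
          · linarith
          · lia
    have h4 : (numRankGE (s + 1 : ℕ) n : ℝ) ≤ Fintype.card (Nat.Partition n) := by
      exact_mod_cast numRankGE_le _ _
    calc ‖ζ‖ ^ s * ((numRankGE (s + 1 : ℕ) n : ℝ) * ‖q‖ ^ n)
        ≤ (ρ' ^ n * (ρ / ρ') ^ s) * (Fintype.card (Nat.Partition n) * ‖q‖ ^ n) := by gcongr
      _ = _ := by rw [mul_pow]; ring

lemma norm_lt_one_of_mul {ρ : ℝ} (hρ : 1 ≤ ρ) (hq : ρ * ‖q‖ < 1) : ‖q‖ < 1 :=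
  (le_mul_of_one_le_left (norm_nonneg q) hρ).trans_lt hq

/-- Summing over `s` first gives geometric series with ratio `ζ q^(j+1)`, the source of the
denominators in the Appell–Lerch sum. -/
lemma tsum_pow_mul_partialTheta {ζ : ℂ} {ρ : ℝ} (hζ : ‖ζ‖ ≤ ρ) (hρ : 1 ≤ ρ) (hq : ρ * ‖q‖ < 1) :
    HasSum (fun s : ℕ => ζ ^ s * partialTheta (s + 1) q)
      (∑' j : ℕ, (-1) ^ j * q ^ (pent j + (j + 1)) * (1 - ζ * q ^ (j + 1))⁻¹) := by
  have hq1 := norm_lt_one_of_mul hρ hq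
  have hζq : ∀ j : ℕ, ‖ζ * q ^ (j + 1)‖ ≤ ρ * ‖q‖ := by
    intro j
    rw [norm_mul, norm_pow]
    have : ‖q‖ ^ (j + 1) ≤ ‖q‖ := by
      simpa using pow_le_pow_of_le_one (norm_nonneg _) hq1.le (Nat.succ_le_succ (Nat.zero_le j))
    gcongr
  have hterm : ∀ s j : ℕ, ζ ^ s * ((-1) ^ j * q ^ (pent j + (j + 1) * (s + 1)))
      = (-1) ^ j * q ^ (pent j + (j + 1)) * (ζ * q ^ (j + 1)) ^ s := by
    intro s j
    rw [mul_pow, ← pow_mul, show pent j + (j + 1) * (s + 1) = (pent j + (j + 1)) + (j + 1) * s by ring,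
      pow_add]; ring
  have hsum : Summable fun x : ℕ × ℕ => ζ ^ x.1 * ((-1) ^ x.2 * q ^ (pent x.2 + (x.2 + 1) * (x.1 + 1))) := by
    refine Summable.of_norm_bounded (g := fun x : ℕ × ℕ => (ρ * ‖q‖) ^ x.1 * ‖q‖ ^ x.2) ?_ ?_
    · exact (summable_geometric_of_lt_one (by positivity) hq).mul_of_nonneg
        (summable_geometric_of_lt_one (norm_nonneg _) hq1)
        (fun n => by positivity) (fun n => by positivity)
    · rintro ⟨s, j⟩
      rw [hterm, norm_mul, mul_comm, norm_pow]
      refine mul_le_mul (pow_le_pow_left₀ (norm_nonneg _) (hζq j) s) ?_ (norm_nonneg _)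
        (by positivity)
      simpa using norm_partialTheta_term_le 1 hq1 j
  have h1 : Summable fun s : ℕ => ζ ^ s * partialTheta (s + 1) q := by
    refine hsum.prod.congr fun s => ?_
    rw [partialTheta, ← tsum_mul_left]
  have h2 : ∑' s : ℕ, ζ ^ s * partialTheta (s + 1) q
      = ∑' j : ℕ, (-1) ^ j * q ^ (pent j + (j + 1)) * (1 - ζ * q ^ (j + 1))⁻¹ := by
    have h3 : ∑' s : ℕ, ζ ^ s * partialTheta (s + 1) q
        = ∑' s : ℕ, ∑' j : ℕ, ζ ^ s * ((-1) ^ j * q ^ (pent j + (j + 1) * (s + 1))) :=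
      tsum_congr fun s => by rw [partialTheta, ← tsum_mul_left]
    rw [h3, tsum_swap (f := fun s j : ℕ => ζ ^ s * ((-1) ^ j * q ^ (pent j + (j + 1) * (s + 1)))) hsum]
    refine tsum_congr fun j => ?_
    rw [tsum_congr fun s => hterm s j, tsum_mul_left,
      tsum_geometric_of_norm_lt_one ((hζq j).trans_lt hq)]
  rw [← h2]
  exact h1.hasSum

/-- The rank generating function as an Appell–Lerch sum. -/
theorem rankGF_eq {ζ : ℂ} {ρ : ℝ} (hζ : ‖ζ‖ ≤ ρ) (hζ' : ‖ζ⁻¹‖ ≤ ρ) (hρ : 1 ≤ ρ)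
    (hq : ρ * ‖q‖ < 1) :
    rankGF ζ q = partGen q * (1
      + (ζ - 1) * ∑' j : ℕ, (-1) ^ j * q ^ (pent j + (j + 1)) * (1 - ζ * q ^ (j + 1))⁻¹
      + (ζ⁻¹ - 1) * ∑' j : ℕ, (-1) ^ j * q ^ (pent j + (j + 1)) * (1 - ζ⁻¹ * q ^ (j + 1))⁻¹) := by
  have hq1 := norm_lt_one_of_mul hρ hq
  have hs1 := (summable_pow_mul_rankGE hζ hρ hq).of_norm
  have hs2 := (summable_pow_mul_rankGE hζ' hρ hq).of_norm
  have hs : Summable fun x : ℕ × ℕ =>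
      (((ζ - 1) * ζ ^ x.2 + (ζ⁻¹ - 1) * ζ⁻¹ ^ x.2) * numRankGE (x.2 + 1 : ℕ) x.1) * q ^ x.1 := by
    refine ((hs1.mul_left (ζ - 1)).add (hs2.mul_left (ζ⁻¹ - 1))).congr fun x => by ring
  have h1 : rankGF ζ q = partGen q + ∑' n : ℕ, ∑' s : ℕ,
      (((ζ - 1) * ζ ^ s + (ζ⁻¹ - 1) * ζ⁻¹ ^ s) * numRankGE (s + 1 : ℕ) n) * q ^ n := by
    rw [rankGF, partGen, ← (summable_norm_partGen hq1).of_norm.tsum_add hs.prod]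
    refine tsum_congr fun n => ?_
    rw [sum_zpow_rank_eq_tsum, add_mul, ← tsum_mul_right]
  have h2 : ∀ s : ℕ, ∑' n : ℕ,
      (((ζ - 1) * ζ ^ s + (ζ⁻¹ - 1) * ζ⁻¹ ^ s) * numRankGE (s + 1 : ℕ) n) * q ^ n
      = partGen q * ((ζ - 1) * (ζ ^ s * partialTheta (s + 1) q)
        + (ζ⁻¹ - 1) * (ζ⁻¹ ^ s * partialTheta (s + 1) q)) := by
    intro s
    simp_rw [mul_assoc]
    rw [tsum_mul_left]
    have := rankGEGen_eq_mul_partialTheta (s := s + 1) (by lia) hq1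
    rw [rankGEGen] at this
    rw [this]; ring
  rw [h1, tsum_swap (f := fun n s : ℕ =>
      (((ζ - 1) * ζ ^ s + (ζ⁻¹ - 1) * ζ⁻¹ ^ s) * numRankGE (s + 1 : ℕ) n) * q ^ n) hs]
  simp_rw [h2]
  have t1 := tsum_pow_mul_partialTheta hζ hρ hq
  have t2 := tsum_pow_mul_partialTheta hζ' hρ hq
  rw [(((t1.mul_left (ζ - 1)).add (t2.mul_left (ζ⁻¹ - 1))).mul_left (partGen q)).tsum_eq]
  ring

/-! ### Rank moments -/

lemma norm_rankMoment_le (k n : ℕ) :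
    ‖(rankMoment k n : ℂ)‖ ≤ (n : ℝ) ^ k * Fintype.card (Nat.Partition n) := by
  rw [rankMoment_eq]
  push_cast
  refine (norm_sum_le _ _).trans ?_
  rw [mul_comm, ← nsmul_eq_mul, ← Finset.card_univ, ← Finset.sum_const]
  refine Finset.sum_le_sum fun p _ => ?_
  rw [norm_pow, Complex.norm_intCast]
  have : |(rank p : ℝ)| ≤ n := by exact_mod_cast abs_rank_le p
  gcongr

lemma summable_rankMoment (k : ℕ) (hq : ‖q‖ < 1) :
    Summable fun n : ℕ => (rankMoment k n : ℂ) * q ^ n := by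
  refine Summable.of_norm_bounded (summable_pow_mul_card_partition k (norm_nonneg q) hq) fun n => ?_
  rw [norm_mul, norm_pow, ← mul_assoc]
  exact mul_le_mul_of_nonneg_right (norm_rankMoment_le k n) (by positivity)

/-- The Taylor expansion of the rank generating function. -/
lemma hasSum_rankGF {x : ℂ} (hq : Real.exp ‖x‖ * ‖q‖ < 1) :
    HasSum (fun k : ℕ => (∑' n : ℕ, (rankMoment k n : ℂ) * q ^ n) / k.factorial * x ^ k)
      (rankGF (Complex.exp x) q) := by
  have hs : Summable fun y : ℕ × ℕ => x ^ y.2 / y.2.factorial * ((rankMoment y.2 y.1 : ℂ) * q ^ y.1) := by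
    apply Summable.of_norm
    have hb : ∀ n k : ℕ, ‖x ^ k / k.factorial * ((rankMoment k n : ℂ) * q ^ n)‖
        ≤ (n * ‖x‖) ^ k / k.factorial * (Fintype.card (Nat.Partition n) * ‖q‖ ^ n) := by
      intro n k
      rw [norm_mul, norm_mul, norm_div, norm_pow, norm_pow, Complex.norm_natCast]
      calc _ ≤ ‖x‖ ^ k / k.factorial * (((n : ℝ) ^ k * Fintype.card (Nat.Partition n)) * ‖q‖ ^ n) := by
            gcongr; exact norm_rankMoment_le k n
        _ = _ := by rw [mul_pow]; ring
    -- Since `|rank| ≤ n`, the sum over `k` is at most `p(n) (exp|x| |q|)^n`; the hypothesis on `q`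
    -- makes this summable over `n`.
    have he : ∀ n : ℕ, HasSum (fun k : ℕ => (n * ‖x‖) ^ k / k.factorial
        * (Fintype.card (Nat.Partition n) * ‖q‖ ^ n))
        (Fintype.card (Nat.Partition n) * (Real.exp ‖x‖ * ‖q‖) ^ n) := by
      intro n
      have := (hasSum_real_exp_series (n * ‖x‖)).mul_right (Fintype.card (Nat.Partition n) * ‖q‖ ^ n)
      have h0 : Fintype.card (Nat.Partition n) * (Real.exp ‖x‖ * ‖q‖) ^ n
          = Real.exp (n * ‖x‖) * (Fintype.card (Nat.Partition n) * ‖q‖ ^ n) := by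
        rw [mul_pow, ← Real.exp_nat_mul]; ring
      rw [h0]; exact this
    have hs0 : Summable fun y : ℕ × ℕ => ((y.1 : ℝ) * ‖x‖) ^ y.2 / y.2.factorial
        * (Fintype.card (Nat.Partition y.1) * ‖q‖ ^ y.1) := by
      rw [summable_prod_of_nonneg (fun y => by positivity)]
      refine ⟨fun n => (he n).summable, ?_⟩
      simp_rw [fun n : ℕ => (he n).tsum_eq]
      exact summable_card_partition (by positivity) hq
    exact Summable.of_nonneg_of_le (fun _ => norm_nonneg _) (fun y => hb y.1 y.2) hs0
  have h1 : rankGF (Complex.exp x) q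
      = ∑' n : ℕ, ∑' k : ℕ, x ^ k / k.factorial * ((rankMoment k n : ℂ) * q ^ n) := by
    refine tsum_congr fun n => ?_
    have h2 : ∀ p : Nat.Partition n, HasSum (fun k : ℕ => x ^ k / k.factorial * (rank p : ℂ) ^ k)
        (Complex.exp x ^ rank p) := by
      intro p
      rw [← Complex.exp_int_mul]
      refine (hasSum_exp_series ((rank p : ℂ) * x)).congr_fun fun k => ?_
      rw [mul_pow]; ring
    have h3 := (hasSum_sum fun p (_ : p ∈ Finset.univ) => h2 p).mul_right (q ^ n)
    rw [← h3.tsum_eq]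
    refine tsum_congr fun k => ?_
    rw [rankMoment_eq, ← Finset.mul_sum]
    push_cast; ring
  rw [h1, tsum_swap (f := fun n k : ℕ => x ^ k / k.factorial * ((rankMoment k n : ℂ) * q ^ n)) hs]
  have h4 : Summable fun k : ℕ => ∑' n : ℕ, x ^ k / k.factorial * ((rankMoment k n : ℂ) * q ^ n) :=
    ((Equiv.prodComm ℕ ℕ).summable_iff.2 hs).prod
  convert h4.hasSum using 2 with k
  rw [tsum_mul_left]; ring

/-! ### Euler's product and the pentagonal number theorem -/

lemma pentagonal_add_one (k : ℕ) : pentagonal (k + 1) = pent k := by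
  have h1 := two_mul_natCast_pentagonal (k + 1)
  have h2 := two_mul_pent k
  zify at h2 ⊢
  linarith

lemma pentagonal_neg_add_one (k : ℕ) : pentagonal (-(k + 1)) = pent k + (k + 1) := by
  have h1 := two_mul_natCast_pentagonal_neg (k + 1)
  have h2 := two_mul_pent k
  zify at h2 ⊢
  linarith

/-- Euler's pentagonal number theorem for complex numbers in the unit disc. -/
theorem tprod_one_sub_pow_eq {q : ℂ} (hq : ‖q‖ < 1) :
    ∏' n : ℕ, (1 - q ^ (n + 1)) = 1 - partialTheta 0 q - partialTheta 1 q := by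
  have h1q : 0 < 1 - ‖q‖ := by linarith
  set C := Real.exp (1 - ‖q‖)⁻¹ with hC
  -- A bound uniform in the starting index `k` and the length `m`. It yields both the summability of
  -- the auxiliary series and the vanishing of the remainder in `Pentagonal.tprod_one_sub_pow`.
  have hprod : ∀ k m : ℕ, ‖∏ i ∈ Finset.range m, (1 - q ^ (k + i + 1))‖ ≤ C := by
    intro k m
    rw [norm_prod]
    have h2 : ∀ i ∈ Finset.range m, ‖1 - q ^ (k + i + 1)‖ ≤ Real.exp (‖q‖ ^ i) := by
      intro i _
      refine (norm_sub_le _ _).trans ?_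
      rw [norm_one, norm_pow, add_comm]
      refine le_trans ?_ (Real.add_one_le_exp _)
      have := pow_le_pow_of_le_one (norm_nonneg q) hq.le (show i ≤ k + i + 1 by lia)
      linarith
    refine (Finset.prod_le_prod (fun _ _ => norm_nonneg _) h2).trans ?_
    rw [← Real.exp_sum, hC]
    apply Real.exp_le_exp.2
    rw [← tsum_geometric_of_lt_one (norm_nonneg _) hq]
    exact (summable_geometric_of_lt_one (norm_nonneg _) hq).sum_le_tsum _ (fun _ _ => by positivity)
  have hterm : ∀ k n : ℕ, ‖q ^ ((k + 1) * n) * ∏ i ∈ Finset.range (n + 1), (1 - q ^ (k + i + 1))‖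
      ≤ ‖q‖ ^ n * C := by
    intro k n
    rw [norm_mul, norm_pow]
    refine mul_le_mul ?_ (hprod _ _) (norm_nonneg _) (by positivity)
    exact pow_le_pow_of_le_one (norm_nonneg q) hq.le (Nat.le_mul_of_pos_left n (by lia))
  have hgeo := (summable_geometric_of_lt_one (norm_nonneg _) hq).mul_right C
  have hsum : ∀ k : ℕ, Summable
      (fun n ↦ q ^ ((k + 1) * n) * ∏ i ∈ Finset.range (n + 1), (1 - q ^ (k + i + 1))) := fun k =>
    Summable.of_norm_bounded hgeo (hterm k)
  have hmult : ∀ k : ℕ, Multipliable (fun n ↦ 1 - q ^ (n + k + 1)) := by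
    intro k
    apply multipliable_one_add_of_summable (f := fun n ↦ -q ^ (n + k + 1))
    simpa [add_assoc] using (summable_nat_add_iff (k + 1)).mpr
      (summable_geometric_of_lt_one (norm_nonneg _) hq)
  have s0 : HasSum _ (partialTheta 0 q) := (summable_partialTheta 0 hq).hasSum
  have s1 : HasSum _ (partialTheta 1 q) := (summable_partialTheta 1 hq).hasSum
  have hA : HasSum (fun k : ℕ => (-1) ^ k * q ^ pentagonal (-k)) (1 - partialTheta 1 q) := by
    rw [← hasSum_nat_add_iff' 1]
    have h2 : ∀ k : ℕ, (-1) ^ (k + 1) * q ^ pentagonal (-((k + 1 : ℕ) : ℤ))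
        = -((-1) ^ k * q ^ (pent k + (k + 1) * 1)) := by
      intro k
      rw [Nat.cast_succ, pentagonal_neg_add_one]; ring
    simp_rw [h2]
    have h0 : pentagonal 0 = 0 := rfl
    simpa [h0] using s1.neg
  have hB : HasSum (fun k : ℕ => (-1) ^ k * q ^ pentagonal (k + 1)) (partialTheta 0 q) := by
    simp_rw [pentagonal_add_one]
    simpa using s0
  have hAB := hA.sub hB
  simp_rw [← mul_sub] at hAB
  rw [Pentagonal.tprod_one_sub_pow (tendsto_pow_atTop_nhds_zero_of_norm_lt_one hq) hsum hmult
    hAB.summable ?_, hAB.tsum_eq]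
  · ring
  · have hb : ∀ k : ℕ, ‖(-1) ^ (k + 1) * q ^ ((k + 1) * (3 * k + 4) / 2) *
      ∑' (n : ℕ), q ^ ((k + 1) * n) * ∏ i ∈ Finset.range (n + 1), (1 - q ^ (k + i + 1))‖
      ≤ ‖q‖ ^ k * ∑' n : ℕ, ‖q‖ ^ n * C := by
      intro k
      rw [norm_mul, norm_mul, norm_pow, norm_neg, norm_one, one_pow, one_mul, norm_pow]
      refine mul_le_mul ?_ (tsum_of_norm_bounded hgeo.hasSum (hterm k)) (norm_nonneg _)
        (by positivity)
      apply pow_le_pow_of_le_one (norm_nonneg q) hq.le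
      rw [Nat.le_div_iff_mul_le (by norm_num)]
      nlinarith
    refine squeeze_zero_norm hb ?_
    simpa using (tendsto_pow_atTop_nhds_zero_of_lt_one (norm_nonneg _) hq).mul_const
      (∑' n : ℕ, ‖q‖ ^ n * C)

open Filter Topology

/-! ### Locally normally convergent series of holomorphic functions on a normed space -/

section Series

variable {E : Type} [NormedAddCommGroup E] {ι : Type}

/-- The series `∑ f i` converges normally on a ball around each point of `U`. -/
def LocallyNormallySummable {F : Type} [NormedAddCommGroup F] (f : ι → E → F) (U : Set E) : Prop :=
  ∀ x ∈ U, ∃ r > 0, Metric.ball x r ⊆ U ∧ ∃ u : ι → ℝ, Summable u ∧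
    ∀ i, ∀ y ∈ Metric.ball x r, ‖f i y‖ ≤ u i

lemma LocallyNormallySummable.summable {F : Type} [NormedAddCommGroup F]
    [CompleteSpace F] {f : ι → E → F} {U : Set E} (hb : LocallyNormallySummable f U) {x : E} (hx : x ∈ U) :
    Summable fun i => f i x := by
  obtain ⟨r, hr, -, u, hu, hfu⟩ := hb x hx
  exact Summable.of_norm_bounded hu fun i => hfu i x (Metric.mem_ball_self hr)

variable [NormedSpace ℂ E] {F : Type} [NormedAddCommGroup F] [NormedSpace ℂ F] {f : ι → E → F}
  {U : Set E}

/-- Cauchy's estimate on balls of half the radius: normal convergence passes to the series of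
derivatives, with a new majorant. -/
lemma LocallyNormallySummable.fderiv (hb : LocallyNormallySummable f U)
    (hf : ∀ i, DifferentiableOn ℂ (f i) U) :
    LocallyNormallySummable (fun i => fderiv ℂ (f i)) U := by
  intro x hx
  obtain ⟨r, hr, hrU, u, hu, hfu⟩ := hb x hx
  refine ⟨r / 2, by positivity, (Metric.ball_subset_ball (by linarith)).trans hrU,
    fun i => 2 * u i / (r / 2), (hu.mul_left 2).div_const _, fun i y hy => ?_⟩
  have hsub : Metric.ball y (r / 2) ⊆ Metric.ball x r := by
    apply Metric.ball_subset_ball'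
    rw [Metric.mem_ball] at hy; linarith
  apply Complex.norm_fderiv_le_div_of_mapsTo_ball ((hf i).mono (hsub.trans hrU)) _ (by positivity)
  intro w hw
  rw [Metric.mem_closedBall, dist_eq_norm]
  have h1 := hfu i w (hsub hw)
  have h2 := hfu i y (hsub (Metric.mem_ball_self (by positivity)))
  exact (norm_sub_le _ _).trans (by linarith)

variable [CompleteSpace F]

lemma LocallyNormallySummable.hasFDerivAt (hb : LocallyNormallySummable f U) (hU : IsOpen U)
    (hf : ∀ i, DifferentiableOn ℂ (f i) U) {x : E} (hx : x ∈ U) :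
    HasFDerivAt (fun y => ∑' i, f i y) (∑' i, _root_.fderiv ℂ (f i) x) x := by
  obtain ⟨r, hr, hrU, u, hu, hfu⟩ := hb.fderiv hf x hx
  let _ : NormedSpace ℝ E := NormedSpace.restrictScalars ℝ ℂ E
  exact hasFDerivAt_tsum_of_isPreconnected (𝕜 := ℂ) hu Metric.isOpen_ball
    (convex_ball x r).isPreconnected
    (fun i y hy => ((hf i).differentiableAt (hU.mem_nhds (hrU hy))).hasFDerivAt) hfu
    (Metric.mem_ball_self hr) (hb.summable hx) (Metric.mem_ball_self hr)

lemma LocallyNormallySummable.fderiv_apply (hb : LocallyNormallySummable f U) (hU : IsOpen U)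
    (hf : ∀ i, DifferentiableOn ℂ (f i) U) {x : E} (hx : x ∈ U) (e : E) :
    HasSum (fun i => _root_.fderiv ℂ (f i) x e) (_root_.fderiv ℂ (fun y => ∑' i, f i y) x e) := by
  rw [(hb.hasFDerivAt hU hf hx).fderiv]
  have h := ((hb.fderiv hf).summable hx).hasSum
  exact h.mapL (ContinuousLinearMap.apply ℂ F e)

end Series

/-- The target space is quantified inside the induction because the derivative series takes values
in a space of linear maps. -/
lemma LocallyNormallySummable.contDiffOn_nat {E : Type} [NormedAddCommGroup E] [NormedSpace ℂ E]
    {ι : Type} {U : Set E} (hU : IsOpen U) (n : ℕ) :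
    ∀ {F : Type} [NormedAddCommGroup F] [NormedSpace ℂ F] [CompleteSpace F] {f : ι → E → F},
      LocallyNormallySummable f U → (∀ i, ContDiffOn ℂ ∞ (f i) U) →
      ContDiffOn ℂ n (fun x => ∑' i, f i x) U := by
  induction n with
  | zero =>
    intro F _ _ _ f hb hf
    rw [Nat.cast_zero, contDiffOn_zero]
    intro x hx
    exact (hb.hasFDerivAt hU (fun i => (hf i).differentiableOn (by simp))
      hx).continuousAt.continuousWithinAt
  | succ n ih =>
    intro F _ _ _ f hb hf
    have hd : ∀ i, DifferentiableOn ℂ (f i) U := fun i => (hf i).differentiableOn (by simp)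
    rw [Nat.cast_succ, contDiffOn_succ_iff_fderiv_of_isOpen hU]
    refine ⟨fun x hx => (hb.hasFDerivAt hU hd hx).differentiableAt.differentiableWithinAt,
      fun h => by simp at h, ?_⟩
    refine (ih (hb.fderiv hd) fun i => ?_).congr fun x hx => (hb.hasFDerivAt hU hd hx).fderiv
    exact (hf i).fderiv_of_isOpen hU (by simp)

lemma LocallyNormallySummable.contDiffOn {E : Type} [NormedAddCommGroup E] [NormedSpace ℂ E]
    {ι : Type} {U : Set E} (hU : IsOpen U) {F : Type} [NormedAddCommGroup F] [NormedSpace ℂ F]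
    [CompleteSpace F] {f : ι → E → F} (hb : LocallyNormallySummable f U)
    (hf : ∀ i, ContDiffOn ℂ ∞ (f i) U) : ContDiffOn ℂ ∞ (fun x => ∑' i, f i x) U :=
  contDiffOn_infty.2 fun n => contDiffOn_nat hU n hb hf

/-! ### Directional derivatives -/

section Directional

variable {E : Type} [NormedAddCommGroup E] [NormedSpace ℂ E] {U : Set E} {F G : E → ℂ}

/-- The derivative of `F` in the direction `e`. -/
noncomputable def dirDeriv (e : E) (F : E → ℂ) (x : E) : ℂ := fderiv ℂ F x e

lemma contDiffOn_dirDeriv (hU : IsOpen U) (hF : ContDiffOn ℂ ∞ F U) (e : E) :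
    ContDiffOn ℂ ∞ (dirDeriv e F) U :=
  (hF.fderiv_of_isOpen hU (by simp)).clm_apply contDiffOn_const

lemma contDiffOn_dirDeriv_iterate (hU : IsOpen U) (hF : ContDiffOn ℂ ∞ F U) (e : E) (k : ℕ) :
    ContDiffOn ℂ ∞ ((dirDeriv e)^[k] F) U := by
  induction k with
  | zero => exact hF
  | succ k ih => rw [Function.iterate_succ_apply']; exact contDiffOn_dirDeriv hU ih e

lemma eqOn_dirDeriv (hU : IsOpen U) (h : Set.EqOn F G U) (e : E) :
    Set.EqOn (dirDeriv e F) (dirDeriv e G) U := by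
  intro x hx
  have : F =ᶠ[𝓝 x] G := by filter_upwards [hU.mem_nhds hx] with y hy using h hy
  rw [dirDeriv, dirDeriv, this.fderiv_eq]

lemma dirDeriv_comm (hU : IsOpen U) (hF : ContDiffOn ℂ ∞ F U) (e e' : E) :
    Set.EqOn (dirDeriv e (dirDeriv e' F)) (dirDeriv e' (dirDeriv e F)) U := by
  intro x hx
  have hs : IsSymmSndFDerivAt ℂ F x := by
    apply (hF.contDiffAt (hU.mem_nhds hx)).isSymmSndFDerivAt
    rw [minSmoothness_of_isRCLikeNormedField]
    exact WithTop.coe_le_coe.2 le_top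
  have h1 : DifferentiableAt ℂ (fderiv ℂ F) x :=
    ((hF.fderiv_of_isOpen hU (m := ∞) (by simp)).differentiableOn (by simp)).differentiableAt
      (hU.mem_nhds hx)
  have h2 : ∀ e e' : E, dirDeriv e (dirDeriv e' F) x = fderiv ℂ (fderiv ℂ F) x e e' := by
    intro e e'
    have : HasFDerivAt (dirDeriv e' F) ((fderiv ℂ (fderiv ℂ F) x).flip e') x := by
      have := h1.hasFDerivAt.clm_apply (hasFDerivAt_const e' x)
      simpa using! this
    rw [dirDeriv, this.fderiv]; rfl
  rw [h2, h2, hs]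

lemma dirDeriv_iterate_comm (hU : IsOpen U) (hF : ContDiffOn ℂ ∞ F U) (e e' : E) (k : ℕ) :
    Set.EqOn (dirDeriv e ((dirDeriv e')^[k] F)) ((dirDeriv e')^[k] (dirDeriv e F)) U := by
  induction k with
  | zero => exact fun x _ => rfl
  | succ k ih =>
    intro x hx
    rw [Function.iterate_succ_apply', Function.iterate_succ_apply',
      dirDeriv_comm hU (contDiffOn_dirDeriv_iterate hU hF e' k) e e' hx]
    exact eqOn_dirDeriv hU ih e' hx

lemma iteratedDeriv_comp_line (hU : IsOpen U) (hF : ContDiffOn ℂ ∞ F U) (x₀ e : E) (k : ℕ) :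
    ∀ t : ℂ, x₀ + t • e ∈ U →
      iteratedDeriv k (fun t : ℂ => F (x₀ + t • e)) t = (dirDeriv e)^[k] F (x₀ + t • e) := by
  induction k with
  | zero => intro t _; simp
  | succ k ih =>
    intro t ht
    have hline : HasDerivAt (fun t : ℂ => x₀ + t • e) e t := by
      simpa using ((hasDerivAt_id t).smul_const e).const_add x₀
    have hnear : iteratedDeriv k (fun t : ℂ => F (x₀ + t • e))
        =ᶠ[𝓝 t] fun t => (dirDeriv e)^[k] F (x₀ + t • e) := by
      filter_upwards [hline.continuousAt.preimage_mem_nhds (hU.mem_nhds ht)] with t' ht' using ih t' ht'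
    rw [iteratedDeriv_succ, hnear.deriv_eq, Function.iterate_succ_apply']
    have hd : DifferentiableAt ℂ ((dirDeriv e)^[k] F) (x₀ + t • e) :=
      ((contDiffOn_dirDeriv_iterate hU hF e k).differentiableOn (by simp)).differentiableAt
        (hU.mem_nhds ht)
    exact (hd.hasFDerivAt.comp_hasDerivAt t hline).deriv

/-- The Wirtinger derivative of the restriction of a holomorphic function of `(z, w)` to
`w = conj z`. -/
lemma dz_comp_conj {F : ℂ × ℂ → ℂ} (hF : Differentiable ℂ F) :
    dz (fun z => F (z, conj z)) = fun z => dirDeriv (1, 0) F (z, conj z) := by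
  funext z
  have h1 : HasFDerivAt (fun z : ℂ => (z, conj z))
      ((ContinuousLinearMap.id ℝ ℂ).prod (Complex.conjCLE : ℂ →L[ℝ] ℂ)) z :=
    (hasFDerivAt_id z).prodMk Complex.conjCLE.hasFDerivAt
  have h2 := ((hF (z, conj z)).hasFDerivAt.restrictScalars ℝ).comp z h1
  have h3 : fderiv ℝ (fun z => F (z, conj z)) z = _ := h2.fderiv
  rw [dz, h3]
  simp only [ContinuousLinearMap.comp_apply, ContinuousLinearMap.prod_apply,
    ContinuousLinearMap.coe_id', id, ContinuousLinearEquiv.coe_coe, Complex.conjCLE_apply, map_one,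
    Complex.conj_I, ContinuousLinearMap.coe_restrictScalars', dirDeriv]
  have h4 : ((Complex.I, -Complex.I) : ℂ × ℂ) = Complex.I • (1, -1) := by
    ext <;> simp
  have h5 : ((1, 0) : ℂ × ℂ) = (1 / 2 : ℂ) • ((1, 1) + (1, -1)) := by
    ext <;> norm_num
  rw [h4, h5, map_smul, map_smul, map_add, smul_eq_mul, smul_eq_mul, ← mul_assoc, Complex.I_mul_I]
  ring

lemma dz_iterate_comp_conj {F : ℂ × ℂ → ℂ} (hF : ContDiff ℂ ∞ F) (k : ℕ) :
    dz^[k] (fun z => F (z, conj z)) = fun z => (dirDeriv (1, 0))^[k] F (z, conj z) := by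
  induction k with
  | zero => rfl
  | succ k ih =>
    rw [Function.iterate_succ_apply', ih, dz_comp_conj, Function.iterate_succ_apply']
    have := contDiffOn_dirDeriv_iterate isOpen_univ hF.contDiffOn ((1, 0) : ℂ × ℂ) k
    exact (contDiffOn_univ.1 this).differentiable (by simp)

/-- The operator `dz` does not act on `conj z`, so at the origin the second variable can be frozen
at `0`. This turns the Wirtinger derivatives in `rMinus` into ordinary complex ones. -/
lemma dz_iterate_comp_conj_zero {F : ℂ × ℂ → ℂ} (hF : ContDiff ℂ ∞ F) (k : ℕ) :
    dz^[k] (fun z => F (z, conj z)) 0 = iteratedDeriv k (fun z => F (z, 0)) 0 := by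
  have h := iteratedDeriv_comp_line isOpen_univ hF.contDiffOn 0 ((1, 0) : ℂ × ℂ) k 0 trivial
  rw [dz_iterate_comp_conj hF]
  simpa [Prod.mk_zero_zero] using h.symm

end Directional

/-! ### Even Taylor expansions in a punctured neighbourhood of the origin -/

/-- `f z = ∑ a n * z ^ (2 n)` for all small `z ≠ 0`. -/
def EvenExpansion (f : ℂ → ℂ) (a : PowerSeries ℂ) : Prop :=
  ∀ᶠ z in 𝓝[≠] (0 : ℂ), HasSum (fun n => PowerSeries.coeff n a * z ^ (2 * n)) (f z)

namespace EvenExpansion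

variable {f g : ℂ → ℂ} {a b : PowerSeries ℂ}

lemma congr (hf : EvenExpansion f a) (h : f =ᶠ[𝓝[≠] 0] g) : EvenExpansion g a := by
  filter_upwards [hf, h] with z h1 h2
  rwa [← h2]

lemma add (hf : EvenExpansion f a) (hg : EvenExpansion g b) :
    EvenExpansion (fun z => f z + g z) (a + b) := by
  filter_upwards [hf, hg] with z h1 h2
  simpa [add_mul] using h1.add h2

lemma const_mul (c : ℂ) (hf : EvenExpansion f a) :
    EvenExpansion (fun z => c * f z) (PowerSeries.C c * a) := by
  filter_upwards [hf] with z h1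
  simpa [mul_assoc] using h1.mul_left c

lemma mul (hf : EvenExpansion f a) (hg : EvenExpansion g b) :
    EvenExpansion (fun z => f z * g z) (a * b) := by
  filter_upwards [hf, hg] with z h1 h2
  have n1 := h1.summable.norm
  have n2 := h2.summable.norm
  have hs := (summable_norm_sum_mul_antidiagonal_of_summable_norm n1 n2).of_norm
  have he := tsum_mul_tsum_eq_tsum_sum_antidiagonal_of_summable_norm n1 n2
  rw [h1.tsum_eq, h2.tsum_eq] at he
  rw [he]
  refine hs.hasSum.congr_fun fun n => ?_
  rw [PowerSeries.coeff_mul, Finset.sum_mul]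
  refine Finset.sum_congr rfl fun p hp => ?_
  rw [← Finset.HasAntidiagonal.mem_antidiagonal.1 hp, mul_add, pow_add]; ring

lemma comp_const_mul {c : ℂ} (hc : c ≠ 0) (hf : EvenExpansion f a) :
    EvenExpansion (fun z => f (c * z)) (PowerSeries.rescale (c ^ 2) a) := by
  have ht : Tendsto (fun z : ℂ => c * z) (𝓝[≠] 0) (𝓝[≠] 0) := by
    apply tendsto_nhdsWithin_of_tendsto_nhds_of_eventually_within
    · have : Continuous fun z : ℂ => c * z := by fun_prop
      exact (this.tendsto' 0 0 (mul_zero c)).mono_left nhdsWithin_le_nhds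
    · filter_upwards [self_mem_nhdsWithin] with z hz using mul_ne_zero hc hz
  filter_upwards [ht.eventually hf] with z hz
  convert hz using 2 with n
  rw [PowerSeries.coeff_rescale, mul_pow, pow_mul, pow_mul]; ring

/-- Put `y = z ^ 2`. Every small `y ≠ 0` has a small square root, so the series in `y` sums to zero
off the origin. At the origin its value is the constant term, which vanishes by continuity;
uniqueness of power series then applies. -/
lemma eq_zero (ha : EvenExpansion (fun _ => 0) a) : a = 0 := by
  let g : ℂ → ℂ := fun y => if y = 0 then PowerSeries.coeff 0 a else 0
  let p : FormalMultilinearSeries ℂ ℂ ℂ :=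
    FormalMultilinearSeries.ofScalars ℂ fun n => PowerSeries.coeff n a
  obtain ⟨ε, hε, h⟩ := Metric.eventually_nhds_iff.1 (eventually_nhdsWithin_iff.1 ha)
  have hg : HasFPowerSeriesAt g p 0 := by
    rw [hasFPowerSeriesAt_iff]
    apply Metric.eventually_nhds_iff.2
    refine ⟨ε ^ 2, by positivity, fun y hy => ?_⟩
    simp only [p, FormalMultilinearSeries.coeff_ofScalars, smul_eq_mul, zero_add]
    by_cases h0 : y = 0
    · subst h0
      simp only [g, if_pos]
      have := hasSum_single (f := fun n => (0 : ℂ) ^ n * PowerSeries.coeff n a) 0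
        fun n hn => by simp [hn]
      simpa using this
    · obtain ⟨z, rfl⟩ := IsAlgClosed.exists_pow_nat_eq y (n := 2) (by norm_num)
      have hz : z ≠ 0 := by rintro rfl; simp at h0
      have h1 := h (y := z) (by
        rw [dist_zero_right] at hy ⊢
        rw [norm_pow] at hy
        exact lt_of_pow_lt_pow_left₀ 2 hε.le hy) hz
      simp only [g, if_neg h0]
      exact h1.congr_fun fun n => by rw [pow_mul, mul_comm]
  have hg0 : g =ᶠ[𝓝[≠] 0] 0 := by
    filter_upwards [self_mem_nhdsWithin] with y hy using if_neg hy
  have hcont := hg.continuousAt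
  have h00 : g 0 = 0 := by
    have h1 := hcont.tendsto.mono_left (nhdsWithin_le_nhds (s := {0}ᶜ))
    have h2 : Tendsto g (𝓝[≠] 0) (𝓝 0) := tendsto_const_nhds.congr' hg0.symm
    exact tendsto_nhds_unique h1 h2
  have hgz : g = 0 := by
    funext y
    by_cases h0 : y = 0
    · rw [h0, h00]; rfl
    · exact if_neg h0
  rw [hgz] at hg
  have hp := hg.eq_zero
  ext n
  have := FormalMultilinearSeries.coeff_ofScalars (𝕜 := ℂ) (p := fun n => PowerSeries.coeff n a) (n := n)
  rw [show FormalMultilinearSeries.ofScalars ℂ (fun n => PowerSeries.coeff n a) = p from rfl, hp] at this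
  rw [← this]; rfl

lemma unique (ha : EvenExpansion f a) (hb : EvenExpansion f b) : a = b := by
  rw [← sub_eq_zero]
  apply eq_zero
  filter_upwards [ha, hb] with z h1 h2
  simpa [sub_mul] using h1.sub h2

lemma of_analyticAt (hf : AnalyticAt ℂ f 0) (heven : ∀ᶠ z in 𝓝 0, f (-z) = f z) :
    EvenExpansion f (PowerSeries.mk fun n => iteratedDeriv (2 * n) f 0 / (2 * n).factorial) := by
  have hodd : ∀ n, iteratedDeriv (2 * n + 1) f 0 = 0 := by
    intro n
    have h1 : iteratedDeriv (2 * n + 1) (fun z => f (-z)) 0 = iteratedDeriv (2 * n + 1) f 0 :=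
      Filter.EventuallyEq.iteratedDeriv_eq (2 * n + 1) heven
    rw [iteratedDeriv_comp_neg, neg_zero, Odd.neg_one_pow ⟨n, rfl⟩] at h1
    have h2 : -iteratedDeriv (2 * n + 1) f 0 = iteratedDeriv (2 * n + 1) f 0 := by simpa using h1
    linear_combination -h2 / 2
  have h := hf.hasFPowerSeriesAt
  rw [hasFPowerSeriesAt_iff] at h
  apply Filter.Eventually.filter_mono nhdsWithin_le_nhds
  filter_upwards [h] with z hz
  simp only [FormalMultilinearSeries.coeff_ofScalars, smul_eq_mul, zero_add] at hz
  have hinj : Function.Injective fun n : ℕ => 2 * n := fun a b h => by simpa using h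
  rw [← hinj.hasSum_iff] at hz
  · refine hz.congr_fun fun n => ?_
    rw [PowerSeries.coeff_mk, Function.comp_apply, mul_comm]
  · intro n hn
    obtain ⟨k, rfl⟩ : ∃ k, n = 2 * k + 1 := by
      rcases Nat.even_or_odd' n with ⟨k, rfl | rfl⟩
      · exact absurd ⟨k, rfl⟩ hn
      · exact ⟨k, rfl⟩
    rw [hodd]; simp

lemma exp_mul_sq (c : ℂ) : EvenExpansion (fun z => Complex.exp (c * z ^ 2))
    (PowerSeries.mk fun n => c ^ n / n.factorial) := by
  refine Filter.Eventually.of_forall fun z => ?_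
  convert hasSum_exp_series (c * z ^ 2) using 2 with n
  rw [PowerSeries.coeff_mk, mul_pow, pow_mul]; ring

end EvenExpansion

/-! ### Elliptic functions of negative index vanish -/

section Elliptic

variable {τ : ℂ} {f : ℂ → ℂ}

/-- The factor of automorphy of index `-3/2`. -/
noncomputable def ellipticFactor (τ z : ℂ) : ℂ :=
  Complex.exp (3 * Real.pi * Complex.I * τ + 6 * Real.pi * Complex.I * z)

lemma norm_ellipticFactor (τ z : ℂ) :
    ‖ellipticFactor τ z‖ = Real.exp (-(3 * Real.pi * τ.im + 6 * Real.pi * z.im)) := by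
  rw [ellipticFactor, Complex.norm_exp]
  congr 1
  simp only [Complex.add_re, Complex.mul_re, Complex.mul_im, Complex.I_re, Complex.I_im,
    Complex.ofReal_re, Complex.ofReal_im, Complex.re_ofNat, Complex.im_ofNat]
  ring

lemma exists_int_translate (hτ : 0 < τ.im) (z : ℂ) : ∃ m n : ℤ,
    z + m + n * τ ∈ Set.Icc (0 : ℝ) 1 ×ℂ Set.Icc 0 τ.im := by
  set n : ℤ := -⌊z.im / τ.im⌋
  set m : ℤ := -⌊(z + n * τ).re⌋
  refine ⟨m, n, ?_⟩
  rw [Complex.mem_reProdIm]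
  constructor
  · have h1 : (z + m + n * τ).re = (z + n * τ).re - ⌊(z + n * τ).re⌋ := by
      simp [m, -Int.self_sub_floor]; ring
    rw [h1, Set.mem_Icc]
    have := Int.floor_le (z + n * τ).re
    have := Int.lt_floor_add_one (z + n * τ).re
    constructor <;> linarith
  · have h1 : (z + m + n * τ).im = (z.im / τ.im - ⌊z.im / τ.im⌋) * τ.im := by
      simp [n, -Int.self_sub_floor]; field_simp; ring
    rw [h1, Set.mem_Icc]
    have := Int.floor_le (z.im / τ.im)
    have := Int.lt_floor_add_one (z.im / τ.im)
    constructor <;> nlinarith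

lemma comp_add_int {M : Type} {g : ℂ → M} {a : ℂ} (h : ∀ z, g (z + a) = g z) (n : ℤ) (z : ℂ) :
    g (z + n * a) = g z := by
  have : Function.Periodic g a := h
  simpa using this.int_mul n z

/-- An entire function which is elliptic of negative index vanishes. -/
theorem eq_zero_of_elliptic (hτ : 0 < τ.im) (hf : Differentiable ℂ f)
    (h1 : ∀ z, f (z + 1) = -f z) (h2 : ∀ z, f (z + τ) = -ellipticFactor τ z * f z) (z : ℂ) :
    f z = 0 := by
  -- The Gaussian weight offsets the factor of automorphy, because `(y + v)² / v = y² / v + 2y + v`,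
  -- so `g` is periodic for the lattice and bounded. Negative index means that the weight is at
  -- least `1`; hence `f` itself is bounded and Liouville's theorem applies.
  set g : ℂ → ℝ := fun z => ‖f z‖ * Real.exp (3 * Real.pi * z.im ^ 2 / τ.im) with hg
  have hg1 : ∀ z, g (z + 1) = g z := by intro z; simp [hg, h1]
  have hgτ : ∀ z, g (z + τ) = g z := by
    intro z
    simp only [hg, h2, norm_mul, norm_neg, norm_ellipticFactor, Complex.add_im]
    rw [mul_comm (Real.exp _), mul_assoc, ← Real.exp_add]
    congr 2
    field_simp; ring
  have hgc : Continuous g := by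
    have := hf.continuous
    fun_prop
  have hK : IsCompact (Set.Icc (0 : ℝ) 1 ×ℂ Set.Icc 0 τ.im) := isCompact_Icc.reProdIm isCompact_Icc
  obtain ⟨C, hC⟩ := hK.exists_bound_of_continuousOn hgc.continuousOn
  have hb : ∀ z, ‖f z‖ ≤ C * Real.exp (-(3 * Real.pi * z.im ^ 2 / τ.im)) := by
    intro z
    obtain ⟨m, n, hmn⟩ := exists_int_translate hτ z
    have h3 : g (z + m + n * τ) = g z := by
      rw [comp_add_int hgτ, ← mul_one (m : ℂ), comp_add_int hg1]
    have h4 := hC _ hmn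
    rw [h3, Real.norm_of_nonneg (by positivity)] at h4
    rw [Real.exp_neg, ← div_eq_mul_inv, le_div_iff₀ (Real.exp_pos _)]
    exact h4
  have hC0 : 0 ≤ C := by
    have := (norm_nonneg _).trans (hb 0)
    simpa using this
  have hconst : ∀ z, f z = f 0 := by
    intro z
    apply hf.apply_eq_apply_of_bounded
    rw [isBounded_iff_forall_norm_le]
    refine ⟨C, ?_⟩
    rintro _ ⟨w, rfl⟩
    refine (hb w).trans (mul_le_of_le_one_right hC0 (Real.exp_le_one_iff.2 ?_))
    have : 0 ≤ 3 * Real.pi * w.im ^ 2 / τ.im := by positivity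
    linarith
  -- A nonzero constant would force the factor at `0` to be `-1`, but its modulus is `exp(-3πv) <
  -- 1`.
  have h5 := h2 0
  rw [zero_add, hconst τ] at h5
  have h6 : (1 + ellipticFactor τ 0) * f 0 = 0 := by linear_combination h5
  rw [hconst z]
  refine (mul_eq_zero.1 h6).resolve_left fun h7 => ?_
  have h8 := norm_ellipticFactor τ 0
  rw [show ellipticFactor τ 0 = -1 by linear_combination h7, norm_neg, norm_one] at h8
  have h9 : Real.exp (-(3 * Real.pi * τ.im + 6 * Real.pi * (0 : ℂ).im)) < 1 := by
    rw [Real.exp_lt_one_iff, Complex.zero_im]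
    have : 0 < 3 * Real.pi * τ.im := by positivity
    linarith
  linarith

/-- The lattice `ℤ + ℤ τ`. -/
def latticeSet (τ : ℂ) : Set ℂ := {z | ∃ m n : ℤ, z = m + n * τ}

lemma add_one_mem_latticeSet {z : ℂ} : z + 1 ∈ latticeSet τ ↔ z ∈ latticeSet τ := by
  constructor
  · rintro ⟨m, n, h⟩; exact ⟨m - 1, n, by push_cast; linear_combination h⟩
  · rintro ⟨m, n, h⟩; exact ⟨m + 1, n, by push_cast; linear_combination h⟩

lemma add_self_mem_latticeSet {z : ℂ} : z + τ ∈ latticeSet τ ↔ z ∈ latticeSet τ := by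
  constructor
  · rintro ⟨m, n, h⟩; exact ⟨m, n - 1, by push_cast; linear_combination h⟩
  · rintro ⟨m, n, h⟩; exact ⟨m, n + 1, by push_cast; linear_combination h⟩

lemma eventually_notMem_latticeSet (hτ : 0 < τ.im) (z₀ : ℂ) :
    ∀ᶠ z in 𝓝[≠] z₀, z ∉ latticeSet τ := by
  set δ := min 1 τ.im with hδ
  have hδ0 : 0 < δ := lt_min one_pos hτ
  have hsep : ∀ w ∈ latticeSet τ, ∀ w' ∈ latticeSet τ, ‖w - w'‖ < δ → w = w' := by
    rintro _ ⟨m, n, rfl⟩ _ ⟨m', n', rfl⟩ h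
    have him := (Complex.abs_im_le_norm _).trans_lt h
    have hre := (Complex.abs_re_le_norm _).trans_lt h
    have e1 : ((m : ℂ) + n * τ - (m' + n' * τ)).im = ((n - n' : ℤ) : ℝ) * τ.im := by
      simp; ring
    rw [e1, abs_mul, abs_of_pos hτ] at him
    have hn : n - n' = 0 := by
      have h3 : |((n - n' : ℤ) : ℝ)| < 1 := by
        have := him.trans_le (min_le_right _ _)
        by_contra h4
        push Not at h4
        nlinarith
      exact Int.abs_lt_one_iff.1 (by exact_mod_cast h3)
    obtain rfl : n = n' := by lia
    have e2 : ((m : ℂ) + n * τ - (m' + n * τ)).re = ((m - m' : ℤ) : ℝ) := by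
      simp
    rw [e2] at hre
    have h4 : |((m - m' : ℤ) : ℝ)| < 1 := hre.trans_le (min_le_left _ _)
    have hm : m - m' = 0 := Int.abs_lt_one_iff.1 (by exact_mod_cast h4)
    obtain rfl : m = m' := by lia
    rfl
  by_cases hex : ∃ w ∈ latticeSet τ, ‖w - z₀‖ < δ / 2
  · obtain ⟨w, hw, hwz⟩ := hex
    have hb : ∀ᶠ z in 𝓝[≠] z₀, ‖z - z₀‖ < δ / 2 := by
      apply Filter.Eventually.filter_mono nhdsWithin_le_nhds
      filter_upwards [Metric.ball_mem_nhds z₀ (half_pos hδ0)] with z hz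
      rwa [Metric.mem_ball, dist_eq_norm] at hz
    have hne : ∀ᶠ z in 𝓝[≠] z₀, z ≠ w := by
      by_cases h : z₀ = w
      · rw [h]; exact self_mem_nhdsWithin
      · exact Filter.Eventually.filter_mono nhdsWithin_le_nhds (isOpen_ne.mem_nhds h)
    filter_upwards [hb, hne] with z hz hzw hzl
    apply hzw
    apply hsep z hzl w hw
    have : z - w = (z - z₀) - (w - z₀) := by ring
    rw [this]
    exact (norm_sub_le _ _).trans_lt (by linarith)
  · push Not at hex
    apply Filter.Eventually.filter_mono nhdsWithin_le_nhds
    filter_upwards [Metric.ball_mem_nhds z₀ (half_pos hδ0)] with z hz hzl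
    rw [Metric.mem_ball, dist_eq_norm] at hz
    exact absurd hz (not_lt.2 (hex z hzl))

/-- `f` agrees near `z₀`, but not necessarily at `z₀`, with an analytic function. -/
def RemovableAt (f : ℂ → ℂ) (z₀ : ℂ) : Prop := ∃ g, AnalyticAt ℂ g z₀ ∧ f =ᶠ[𝓝[≠] z₀] g

lemma RemovableAt.translate {z₀ a : ℂ} {c : ℂ → ℂ} (hc : Differentiable ℂ c)
    (h : RemovableAt f z₀) (hfa : ∀ᶠ z in 𝓝[≠] (z₀ + a), f z = c z * f (z - a)) :
    RemovableAt f (z₀ + a) := by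
  obtain ⟨g, hg, hfg⟩ := h
  refine ⟨fun z => c z * g (z - a), ?_, ?_⟩
  · refine (hc.analyticAt _).mul (AnalyticAt.fun_comp ?_ (by fun_prop))
    simpa using hg
  · have ht : Tendsto (fun z : ℂ => z - a) (𝓝[≠] (z₀ + a)) (𝓝[≠] z₀) := by
      apply tendsto_nhdsWithin_of_tendsto_nhds_of_eventually_within
      · have : Continuous fun z : ℂ => z - a := by fun_prop
        exact (this.tendsto' _ _ (add_sub_cancel_right z₀ a)).mono_left nhdsWithin_le_nhds
      · filter_upwards [self_mem_nhdsWithin] with z hz h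
        exact hz (sub_eq_iff_eq_add.1 h)
    filter_upwards [hfa, ht.eventually hfg] with z h1 h2
    rw [h1, h2]

lemma tendsto_add_punctured (z₀ a : ℂ) : Tendsto (fun z : ℂ => z + a) (𝓝[≠] z₀) (𝓝[≠] (z₀ + a)) := by
  apply tendsto_nhdsWithin_of_tendsto_nhds_of_eventually_within
  · have : Continuous fun z : ℂ => z + a := by fun_prop
    exact (this.tendsto' _ _ rfl).mono_left nhdsWithin_le_nhds
  · filter_upwards [self_mem_nhdsWithin] with z hz h
    exact hz (add_right_cancel h)

/-- A function all of whose singularities are removable extends to an entire function. -/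
lemma exists_entire_of_removable (h : ∀ z₀, RemovableAt f z₀) :
    ∃ F : ℂ → ℂ, Differentiable ℂ F ∧ ∀ z₀, f =ᶠ[𝓝[≠] z₀] F := by
  -- The extension is the punctured limit at every point, which agrees near `z₀` with any local
  -- analytic extension; no gluing is needed.
  have hF : ∀ z₀, ∃ g, AnalyticAt ℂ g z₀ ∧ f =ᶠ[𝓝[≠] z₀] g ∧
      (fun z => limUnder (𝓝[≠] z) f) =ᶠ[𝓝 z₀] g := by
    intro z₀
    obtain ⟨g, hg, hfg⟩ := h z₀
    refine ⟨g, hg, hfg, ?_⟩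
    have h1 := hg.eventually_analyticAt
    obtain ⟨V, hV, hVo, hzV⟩ := eventually_nhds_iff.1 (eventually_nhdsWithin_iff.1 hfg)
    filter_upwards [h1, hVo.mem_nhds hzV] with z hz hzV'
    apply Tendsto.limUnder_eq
    have h2 : f =ᶠ[𝓝[≠] z] g := by
      by_cases h3 : z = z₀
      · rw [h3]; exact hfg
      · apply Filter.Eventually.filter_mono nhdsWithin_le_nhds
        filter_upwards [hVo.mem_nhds hzV', isOpen_ne.mem_nhds h3] with w hw hwz using hV w hw hwz
    exact (hz.continuousAt.tendsto.mono_left nhdsWithin_le_nhds).congr' h2.symm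
  refine ⟨fun z => limUnder (𝓝[≠] z) f, fun z₀ => ?_, fun z₀ => ?_⟩
  · obtain ⟨g, hg, -, h2⟩ := hF z₀
    exact (hg.congr h2.symm).differentiableAt
  · obtain ⟨g, -, h1, h2⟩ := hF z₀
    exact h1.trans (h2.symm.filter_mono nhdsWithin_le_nhds)

/-- A function with removable singularities in the lattice, which is elliptic of negative index,
vanishes. -/
theorem eq_zero_of_elliptic_of_removable (hτ : 0 < τ.im) (hf : ∀ z ∉ latticeSet τ, AnalyticAt ℂ f z)
    (h0 : RemovableAt f 0) (h1 : ∀ z ∉ latticeSet τ, f (z + 1) = -f z)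
    (h2 : ∀ z ∉ latticeSet τ, f (z + τ) = -ellipticFactor τ z * f z) {z : ℂ} (hz : z ∉ latticeSet τ) :
    f z = 0 := by
  have ht1 : ∀ z₀, RemovableAt f z₀ → RemovableAt f (z₀ + 1) := fun z₀ hz₀ =>
    hz₀.translate (c := fun _ => -1) (by fun_prop) (by
      filter_upwards [eventually_notMem_latticeSet hτ (z₀ + 1)] with z hz
      rw [← sub_add_cancel z 1, add_one_mem_latticeSet] at hz
      have := h1 _ hz
      rw [sub_add_cancel] at this
      rw [this]; ring)
  have ht2 : ∀ z₀, RemovableAt f z₀ → RemovableAt f (z₀ + -1) := fun z₀ hz₀ =>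
    hz₀.translate (c := fun _ => -1) (by fun_prop) (by
      filter_upwards [eventually_notMem_latticeSet hτ (z₀ + -1)] with z hz
      have := h1 _ hz
      rw [sub_neg_eq_add, this]; ring)
  have ht3 : ∀ z₀, RemovableAt f z₀ → RemovableAt f (z₀ + τ) := fun z₀ hz₀ =>
    hz₀.translate (c := fun z => -ellipticFactor τ (z - τ)) (by unfold ellipticFactor; fun_prop) (by
      filter_upwards [eventually_notMem_latticeSet hτ (z₀ + τ)] with z hz
      rw [← sub_add_cancel z τ, add_self_mem_latticeSet] at hz
      have := h2 _ hz
      rwa [sub_add_cancel] at this)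
  have ht4 : ∀ z₀, RemovableAt f z₀ → RemovableAt f (z₀ + -τ) := fun z₀ hz₀ =>
    hz₀.translate (c := fun z => -Complex.exp (-(3 * Real.pi * Complex.I * τ
      + 6 * Real.pi * Complex.I * z))) (by fun_prop) (by
      filter_upwards [eventually_notMem_latticeSet hτ (z₀ + -τ)] with z hz
      have := h2 _ hz
      rw [sub_neg_eq_add, this, Complex.exp_neg, ellipticFactor]
      field_simp)
  have hm : ∀ m : ℤ, RemovableAt f m := by
    intro m
    induction m using Int.induction_on with
    | zero => simpa using h0
    | succ i ih => have := ht1 _ ih; push_cast at this ⊢; exact this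
    | pred i ih => have := ht2 _ ih; push_cast at this ⊢; simpa [sub_eq_add_neg] using this
  have hmn : ∀ m n : ℤ, RemovableAt f (m + n * τ) := by
    intro m n
    induction n using Int.induction_on with
    | zero => simpa using hm m
    | succ i ih =>
      have := ht3 _ ih; push_cast at this ⊢
      rwa [add_one_mul, ← add_assoc]
    | pred i ih =>
      have := ht4 _ ih; push_cast at this ⊢
      rwa [sub_one_mul, ← add_sub_assoc, sub_eq_add_neg _ τ]
  have hall : ∀ z₀, RemovableAt f z₀ := by
    intro z₀
    by_cases h : z₀ ∈ latticeSet τ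
    · obtain ⟨m, n, rfl⟩ := h; exact hmn m n
    · exact ⟨f, hf z₀ h, EventuallyEq.rfl⟩
  obtain ⟨F, hFd, hFf⟩ := exists_entire_of_removable hall
  have heq : ∀ {G H : ℂ → ℂ}, Continuous G → Continuous H → (∀ z₀, G =ᶠ[𝓝[≠] z₀] H) → ∀ z, G z = H z := by
    intro G H hG hH h z
    have t1 := (hG.tendsto z).mono_left (nhdsWithin_le_nhds (s := {z}ᶜ))
    have t2 := (hH.tendsto z).mono_left (nhdsWithin_le_nhds (s := {z}ᶜ))
    exact tendsto_nhds_unique (t1.congr' (h z)) t2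
  have hFc := hFd.continuous
  have hF0 : ∀ z, F z = 0 := by
    intro z
    refine eq_zero_of_elliptic hτ hFd ?_ ?_ z
    · refine heq (by fun_prop) (by fun_prop) fun z₀ => ?_
      filter_upwards [hFf z₀, (tendsto_add_punctured z₀ 1).eventually (hFf (z₀ + 1)),
        eventually_notMem_latticeSet hτ z₀] with z e1 e2 e3
      rw [← e1, ← e2, h1 z e3]
    · refine heq (by fun_prop) (by unfold ellipticFactor; fun_prop) fun z₀ => ?_
      filter_upwards [hFf z₀, (tendsto_add_punctured z₀ τ).eventually (hFf (z₀ + τ)),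
        eventually_notMem_latticeSet hτ z₀] with z e1 e2 e3
      rw [← e1, ← e2, h2 z e3]
  have t1 := ((hf z hz).continuousAt.tendsto).mono_left (nhdsWithin_le_nhds (s := {z}ᶜ))
  have t2 : Tendsto f (𝓝[≠] z) (𝓝 0) := by
    refine tendsto_const_nhds.congr' ?_
    filter_upwards [hFf z] with w hw
    rw [hw, hF0]
  exact tendsto_nhds_unique t1 t2

end Elliptic

/-! ### The entire extension of `E` -/

section Gauss

lemma exists_gaussC : ∃ g : ℂ → ℂ, g 0 = 0 ∧ ∀ z, HasDerivAt g (2 * Complex.exp (-Real.pi * z ^ 2)) z := by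
  have h : Differentiable ℂ fun z : ℂ => 2 * Complex.exp (-Real.pi * z ^ 2) := by fun_prop
  obtain ⟨g, h0, hg⟩ := h.isExactOn_univ.with_val_at 0 0
  exact ⟨g, h0, fun z => hg z trivial⟩

/-- The entire function extending `E`. -/
noncomputable def gaussC : ℂ → ℂ := exists_gaussC.choose

lemma gaussC_zero : gaussC 0 = 0 := exists_gaussC.choose_spec.1

lemma hasDerivAt_gaussC (z : ℂ) : HasDerivAt gaussC (2 * Complex.exp (-Real.pi * z ^ 2)) z :=
  exists_gaussC.choose_spec.2 z

lemma differentiable_gaussC : Differentiable ℂ gaussC := fun z => (hasDerivAt_gaussC z).differentiableAt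

lemma gaussC_neg (z : ℂ) : gaussC (-z) = -gaussC z := by
  have hd : ∀ z, HasDerivAt (fun z => gaussC (-z) + gaussC z) 0 z := fun z => by
    have h := ((hasDerivAt_gaussC (-z)).scomp z (hasDerivAt_neg z)).add (hasDerivAt_gaussC z)
    simp only [neg_sq, smul_eq_mul, neg_mul, one_mul, neg_add_cancel] at h
    exact h
  have h := is_const_of_deriv_eq_zero (fun z => (hd z).differentiableAt) (fun z => (hd z).deriv) z 0
  simp only [neg_zero, gaussC_zero, add_zero] at h
  exact eq_neg_of_add_eq_zero_left h

lemma gaussC_ofReal (x : ℝ) : gaussC x = gaussE x := by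
  have h : ∫ t in (0 : ℝ)..x, ((2 * Real.exp (-Real.pi * t ^ 2) : ℝ) : ℂ) = gaussC x - gaussC (0 : ℝ) := by
    apply intervalIntegral.integral_eq_sub_of_hasDerivAt (f := fun t : ℝ => gaussC t)
    · intro t _
      have := (hasDerivAt_gaussC t).comp_ofReal
      push_cast
      exact this
    · apply Continuous.intervalIntegrable
      fun_prop
  rw [Complex.ofReal_zero, gaussC_zero, sub_zero] at h
  rw [← h, gaussE, ← intervalIntegral.integral_const_mul, ← intervalIntegral.integral_ofReal]

lemma one_sub_gaussE (a : ℝ) : 1 - gaussE a = 2 * ∫ t in Set.Ioi a, Real.exp (-Real.pi * t ^ 2) := by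
  have hi := integrable_exp_neg_mul_sq Real.pi_pos
  have h := intervalIntegral.integral_interval_add_Ioi (a := 0) (b := a) hi.integrableOn hi.integrableOn
  rw [integral_gaussian_Ioi, div_self Real.pi_ne_zero, Real.sqrt_one] at h
  rw [gaussE]; linarith

lemma one_sub_gaussE_nonneg (a : ℝ) : 0 ≤ 1 - gaussE a := by
  rw [one_sub_gaussE]
  have := MeasureTheory.integral_nonneg (μ := MeasureTheory.volume.restrict (Set.Ioi a))
    (f := fun t => Real.exp (-Real.pi * t ^ 2)) (fun t => (Real.exp_pos _).le)
  positivity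

lemma one_sub_gaussE_le_two (a : ℝ) : 1 - gaussE a ≤ 2 := by
  rw [one_sub_gaussE]
  have hi := integrable_exp_neg_mul_sq Real.pi_pos
  have := MeasureTheory.setIntegral_le_integral (s := Set.Ioi a) hi
    (Eventually.of_forall fun t => (Real.exp_pos _).le)
  rw [integral_gaussian, div_self Real.pi_ne_zero, Real.sqrt_one] at this
  linarith

lemma one_sub_gaussE_le {a : ℝ} (ha : 0 ≤ a) : 1 - gaussE a ≤ 2 * Real.exp (-Real.pi * a ^ 2) := by
  have hi := integrable_exp_neg_mul_sq Real.pi_pos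
  have hi' : MeasureTheory.Integrable fun t : ℝ =>
      Real.exp (-Real.pi * a ^ 2) * Real.exp (-Real.pi * (t - a) ^ 2) :=
    (hi.comp_sub_right a).const_mul _
  have h1 : ∫ t in Set.Ioi a, Real.exp (-Real.pi * t ^ 2)
      ≤ ∫ t in Set.Ioi a, Real.exp (-Real.pi * a ^ 2) * Real.exp (-Real.pi * (t - a) ^ 2) := by
    apply MeasureTheory.setIntegral_mono_on hi.integrableOn hi'.integrableOn measurableSet_Ioi
    intro t ht
    rw [Set.mem_Ioi] at ht
    rw [← Real.exp_add, Real.exp_le_exp]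
    have : 0 ≤ a * (t - a) := mul_nonneg ha (by linarith)
    nlinarith [Real.pi_pos]
  have h2 := MeasureTheory.setIntegral_le_integral (s := Set.Ioi a) hi'
    (Eventually.of_forall fun t => by positivity)
  have h3 : ∫ t : ℝ, Real.exp (-Real.pi * (t - a) ^ 2) = ∫ t : ℝ, Real.exp (-Real.pi * t ^ 2) :=
    MeasureTheory.integral_sub_right_eq_self (fun t => Real.exp (-Real.pi * t ^ 2)) a
  rw [MeasureTheory.integral_const_mul (μ := MeasureTheory.volume), h3, integral_gaussian, div_self Real.pi_ne_zero, Real.sqrt_one] at h2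
  rw [one_sub_gaussE]
  linarith

lemma norm_one_sub_gaussC_ofReal_le {a B : ℝ} (ha : -B ≤ a) (hB : 0 ≤ B) :
    ‖1 - gaussC a‖ ≤ 2 * Real.exp (Real.pi * B ^ 2) * Real.exp (-Real.pi * a ^ 2) := by
  have h : 1 - gaussC a = ((1 - gaussE a : ℝ) : ℂ) := by rw [gaussC_ofReal]; push_cast; rfl
  rw [h, Complex.norm_real, Real.norm_of_nonneg (one_sub_gaussE_nonneg a), mul_assoc, ← Real.exp_add]
  rcases le_total 0 a with h0 | h0
  · refine (one_sub_gaussE_le h0).trans ?_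
    gcongr
    have : 0 ≤ Real.pi * B ^ 2 := by positivity
    linarith
  · refine (one_sub_gaussE_le_two a).trans (le_mul_of_one_le_right two_pos.le ?_)
    rw [Real.one_le_exp_iff]
    have : a ^ 2 ≤ B ^ 2 := by nlinarith
    nlinarith [Real.pi_pos]

/-- The point `W` is reached from its real part along a vertical segment, on which the derivative of
`gaussC` is largest in modulus at the end `W`. The constant `exp(π B²)` pays for real parts between
`-B` and `0`. -/
lemma norm_one_sub_gaussC_le {W : ℂ} {B : ℝ} (hW : -B ≤ W.re) (hB : 0 ≤ B) :
    ‖1 - gaussC W‖ ≤ 2 * Real.exp (Real.pi * B ^ 2) * Real.exp |W.im|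
      * Real.exp (-Real.pi * (W ^ 2).re) := by
  set a := W.re
  set c := W.im
  have hre : (W ^ 2).re = a ^ 2 - c ^ 2 := by simp [pow_two, a, c]
  have h1 : ‖gaussC W - gaussC a‖ ≤ 2 * Real.exp (-Real.pi * (a ^ 2 - c ^ 2)) * |c| := by
    have hd : ∀ t : ℝ, HasDerivAt (fun t : ℝ => gaussC (a + t * (c * Complex.I)))
        (2 * Complex.exp (-Real.pi * (a + t * (c * Complex.I)) ^ 2) * (c * Complex.I)) t := by
      intro t
      have h2 : HasDerivAt (fun t : ℂ => (a : ℂ) + t * (c * Complex.I)) (c * Complex.I) t := by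
        simpa using ((hasDerivAt_id (t : ℂ)).mul_const (c * Complex.I)).const_add (a : ℂ)
      exact ((hasDerivAt_gaussC _).comp (t : ℂ) h2).comp_ofReal
    have := norm_image_sub_le_of_norm_deriv_le_segment_01'
      (fun t _ => (hd t).hasDerivWithinAt) (C := 2 * Real.exp (-Real.pi * (a ^ 2 - c ^ 2)) * |c|) ?_
    · simpa [a, c, Complex.re_add_im] using this
    · intro t ht
      rw [norm_mul, norm_mul, Complex.norm_exp, norm_mul, Complex.norm_I, mul_one, Complex.norm_real,
        Real.norm_eq_abs, Complex.norm_ofNat]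
      gcongr
      have : (-(Real.pi : ℂ) * (a + t * (c * Complex.I)) ^ 2).re = -Real.pi * (a ^ 2 - t ^ 2 * c ^ 2) := by
        simp [pow_two]; ring
      rw [this]
      have : t ^ 2 ≤ 1 := by nlinarith [ht.1, ht.2]
      have : t ^ 2 * c ^ 2 ≤ c ^ 2 := mul_le_of_le_one_left (sq_nonneg c) this
      nlinarith [Real.pi_pos]
  have h2 := norm_one_sub_gaussC_ofReal_le hW hB
  have h3 : ‖1 - gaussC W‖ ≤ ‖1 - gaussC a‖ + ‖gaussC W - gaussC a‖ := by
    rw [show 1 - gaussC W = (1 - gaussC a) - (gaussC W - gaussC a) by ring]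
    exact norm_sub_le _ _
  refine h3.trans ((add_le_add h2 h1).trans ?_)
  rw [hre]
  set e := Real.exp (-Real.pi * (a ^ 2 - c ^ 2))
  have h4 : Real.exp (-Real.pi * a ^ 2) ≤ e :=
    Real.exp_le_exp.2 (by nlinarith [Real.pi_pos, sq_nonneg c])
  have h5 : 1 ≤ Real.exp (Real.pi * B ^ 2) := Real.one_le_exp (by positivity)
  have h6 : 1 + |c| ≤ Real.exp |c| := by linarith [Real.add_one_le_exp |c|]
  have he : 0 < e := Real.exp_pos _
  calc _ ≤ 2 * Real.exp (Real.pi * B ^ 2) * e + 2 * (Real.exp (Real.pi * B ^ 2) * e) * |c| := by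
        gcongr
        exact le_mul_of_one_le_left he.le h5
    _ = 2 * Real.exp (Real.pi * B ^ 2) * (1 + |c|) * e := by ring
    _ ≤ _ := by gcongr

end Gauss

/-! ### The series of error functions -/

lemma summable_exp_quadratic {δ : ℝ} (hδ : 0 < δ) (c : ℝ) :
    Summable fun k : ℤ => Real.exp (-Real.pi * δ * (6 * k + 5) ^ 2 + c * |(6 * k + 5 : ℝ)|) := by
  have h := summable_pow_mul_jacobiTheta₂_term_bound (c / (2 * Real.pi)) hδ 0
  have hinj : Function.Injective fun k : ℤ => 6 * k + 5 := fun a b h => by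
    simp only at h; lia
  refine (h.comp_injective hinj).congr fun k => ?_
  simp only [Function.comp_apply, pow_zero, one_mul]
  push_cast
  congr 1
  have := Real.pi_ne_zero
  field_simp
  ring

/-- The sign of `k + 1/2`. -/
noncomputable def halfSign (k : ℤ) : ℝ := Real.sign ((k : ℝ) + 1 / 2)

lemma halfSign_of_nonneg {k : ℤ} (hk : 0 ≤ k) : halfSign k = 1 :=
  Real.sign_of_pos (by have : (0 : ℝ) ≤ k := by exact_mod_cast hk
                       linarith)

lemma halfSign_of_neg {k : ℤ} (hk : k < 0) : halfSign k = -1 :=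
  Real.sign_of_neg (by have : (k : ℝ) ≤ -1 := by exact_mod_cast Int.le_sub_one_of_lt hk
                       linarith)

/-- The exponential `exp (-π i (6k+5)² τ / 12 - π i (6k+5) z)`. -/
noncomputable def thetaExp (k : ℤ) (τ z : ℂ) : ℂ :=
  Complex.exp (-Real.pi * Complex.I * (6 * k + 5) ^ 2 * τ / 12 - Real.pi * Complex.I * (6 * k + 5) * z)

/-- The summand of `errSum`, as a holomorphic function of `(s, b, τ, z)`. -/
noncomputable def errTerm (k : ℤ) (p : ℂ × ℂ × ℂ × ℂ) : ℂ :=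
  (-1) ^ k * (halfSign k - gaussC ((6 * k + 5) * p.1 + p.2.1)) * thetaExp k p.2.2.1 p.2.2.2

/-- The domain on which the series of error functions converges. -/
def errDomain : Set (ℂ × ℂ × ℂ × ℂ) := {p | 0 < p.1.re ∧ p.2.2.1.im < 12 * (p.1 ^ 2).re}

/-- The series of error functions, as a holomorphic function of `(s, b, τ, z)`. -/
noncomputable def errSum (p : ℂ × ℂ × ℂ × ℂ) : ℂ := ∑' k : ℤ, errTerm k p

lemma isOpen_errDomain : IsOpen errDomain := by
  refine IsOpen.and ?_ ?_ <;> exact isOpen_lt (by fun_prop) (by fun_prop)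

/-- The number `6k + 5` has the sign of `k + 1/2`, so `halfSign k` is the limit of the error
function on the side where its argument lies. For `k < 0`, oddness of `gaussC` reflects to the
positive side. -/
lemma norm_halfSign_sub_gaussC_le (k : ℤ) {s b : ℂ} {S B : ℝ} (hs : 0 < s.re) (hS : ‖s‖ ≤ S)
    (hB : ‖b‖ ≤ B) :
    ‖(halfSign k : ℂ) - gaussC ((6 * k + 5) * s + b)‖ ≤
      2 * Real.exp (Real.pi * B ^ 2) * Real.exp (|(6 * k + 5 : ℝ)| * S + B)
      * Real.exp (-Real.pi * (((6 * k + 5) * s + b) ^ 2).re) := by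
  have hB0 : 0 ≤ B := (norm_nonneg _).trans hB
  have him : |((6 * k + 5) * s + b).im| ≤ |(6 * k + 5 : ℝ)| * S + B := by
    refine (Complex.abs_im_le_norm _).trans ((norm_add_le _ _).trans (add_le_add ?_ hB))
    have : ‖(6 * k + 5 : ℂ)‖ = |(6 * k + 5 : ℝ)| := by
      rw [← Real.norm_eq_abs, ← Complex.norm_real]; push_cast; rfl
    rw [norm_mul, this]
    gcongr
  have hbre := (Complex.abs_re_le_norm b).trans hB
  rw [abs_le] at hbre
  have hre : ((6 * k + 5) * s + b).re = (6 * k + 5) * s.re + b.re := by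
    have : (6 * k + 5 : ℂ) = ((6 * k + 5 : ℝ) : ℂ) := by push_cast; rfl
    rw [this, Complex.add_re, Complex.re_ofReal_mul]
  rcases le_or_gt 0 k with hk | hk
  · rw [halfSign_of_nonneg hk, Complex.ofReal_one]
    refine (norm_one_sub_gaussC_le (B := B) ?_ hB0).trans (by gcongr)
    rw [hre]
    have : (0 : ℝ) ≤ k := by exact_mod_cast hk
    have : 0 ≤ (6 * k + 5) * s.re := by positivity
    linarith
  · rw [halfSign_of_neg hk]
    have e : ((-1 : ℝ) : ℂ) - gaussC ((6 * k + 5) * s + b) = -(1 - gaussC (-((6 * k + 5) * s + b))) := by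
      rw [gaussC_neg]; push_cast; ring
    rw [e, norm_neg]
    refine (norm_one_sub_gaussC_le (B := B) ?_ hB0).trans ?_
    · rw [Complex.neg_re, hre]
      have : (k : ℝ) ≤ -1 := by exact_mod_cast Int.le_sub_one_of_lt hk
      nlinarith
    · rw [neg_sq, Complex.neg_im, abs_neg]
      gcongr

lemma norm_thetaExp (k : ℤ) (τ z : ℂ) : ‖thetaExp k τ z‖ =
    Real.exp (Real.pi * (6 * k + 5) ^ 2 * τ.im / 12 + Real.pi * (6 * k + 5) * z.im) := by
  rw [thetaExp, Complex.norm_exp]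
  congr 1
  have : -Real.pi * Complex.I * (6 * k + 5) ^ 2 * τ / 12 - Real.pi * Complex.I * (6 * k + 5) * z
    = Complex.I * (((-Real.pi * (6 * k + 5) ^ 2 / 12 : ℝ) : ℂ) * τ - ((Real.pi * (6 * k + 5) : ℝ) : ℂ) * z) := by
    push_cast; ring
  rw [this, Complex.I_mul_re, Complex.sub_im, Complex.im_ofReal_mul, Complex.im_ofReal_mul]
  ring

/-- The error function decays like `exp(-π (6k+5)² Re(s²))`, while `thetaExp` grows at most like
`exp(π (6k+5)² Im τ / 12)`. The margin between the two rates is at least `δ`, and all other terms in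
the exponent are at most linear in `|6k + 5|`. -/
lemma norm_errTerm_le (k : ℤ) {p : ℂ × ℂ × ℂ × ℂ} {S B Z δ : ℝ} (hs : 0 < p.1.re) (hS : ‖p.1‖ ≤ S)
    (hB : ‖p.2.1‖ ≤ B) (hZ : ‖p.2.2.2‖ ≤ Z) (hδ : p.2.2.1.im ≤ 12 * (p.1 ^ 2).re - 12 * δ) :
    ‖errTerm k p‖ ≤ 2 * Real.exp (2 * Real.pi * B ^ 2 + B)
      * Real.exp (-Real.pi * δ * (6 * k + 5) ^ 2
        + (S + Real.pi * (Z + 2 * S * B)) * |(6 * k + 5 : ℝ)|) := by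
  obtain ⟨s, b, τ, z⟩ := p
  simp only at hs hS hB hZ hδ
  have hB0 : 0 ≤ B := (norm_nonneg _).trans hB
  have hS0 : 0 ≤ S := (norm_nonneg _).trans hS
  rw [errTerm, norm_mul, norm_mul, norm_zpow, norm_neg, norm_one, one_zpow, one_mul, norm_thetaExp]
  simp only
  refine (mul_le_mul_of_nonneg_right (norm_halfSign_sub_gaussC_le k hs hS hB) (Real.exp_pos _).le).trans ?_
  simp only [mul_assoc (2 : ℝ), ← Real.exp_add]
  refine mul_le_mul_of_nonneg_left (Real.exp_le_exp.2 ?_) two_pos.le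
  set M : ℝ := 6 * k + 5 with hM
  have e1 : (((6 * k + 5) * s + b) ^ 2).re = M ^ 2 * (s ^ 2).re + 2 * M * (s * b).re + (b ^ 2).re := by
    have : ((6 * k + 5) * s + b) ^ 2 = ((M ^ 2 : ℝ) : ℂ) * s ^ 2 + ((2 * M : ℝ) : ℂ) * (s * b) + b ^ 2 := by
      rw [hM]; push_cast; ring
    rw [this, Complex.add_re, Complex.add_re, Complex.re_ofReal_mul, Complex.re_ofReal_mul]
  have e2 : |(s * b).re| ≤ S * B := (Complex.abs_re_le_norm _).trans (by rw [norm_mul]; gcongr)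
  have e3 : |(b ^ 2).re| ≤ B ^ 2 := (Complex.abs_re_le_norm _).trans (by rw [norm_pow]; gcongr)
  have e4 : |z.im| ≤ Z := (Complex.abs_im_le_norm _).trans hZ
  have f1 : M ^ 2 * τ.im ≤ M ^ 2 * (12 * (s ^ 2).re - 12 * δ) := by gcongr
  have f2 : -(M * (s * b).re) ≤ |M| * (S * B) := by
    refine (neg_le_abs _).trans ?_
    rw [abs_mul]; gcongr
  have f3 : M * z.im ≤ |M| * Z := by
    refine (le_abs_self _).trans ?_
    rw [abs_mul]; gcongr
  have f4 : -(b ^ 2).re ≤ B ^ 2 := (neg_le_abs _).trans e3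
  rw [e1]
  have hπ := Real.pi_pos
  nlinarith [mul_le_mul_of_nonneg_left f1 hπ.le, mul_le_mul_of_nonneg_left f2 hπ.le,
    mul_le_mul_of_nonneg_left f3 hπ.le, mul_le_mul_of_nonneg_left f4 hπ.le]

lemma locallyNormallySummable_errTerm : LocallyNormallySummable errTerm errDomain := by
  intro x hx
  obtain ⟨h1, h2⟩ := hx
  set δ := ((x.1 ^ 2).re - x.2.2.1.im / 12) / 2 with hδ
  have hδ0 : 0 < δ := by rw [hδ]; linarith
  set V : Set (ℂ × ℂ × ℂ × ℂ) := {p | 0 < p.1.re ∧ p.2.2.1.im < 12 * (p.1 ^ 2).re - 12 * δ ∧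
    ‖p.1‖ < ‖x.1‖ + 1 ∧ ‖p.2.1‖ < ‖x.2.1‖ + 1 ∧ ‖p.2.2.2‖ < ‖x.2.2.2‖ + 1}
  have hV : IsOpen V := by
    refine IsOpen.and ?_ (IsOpen.and ?_ (IsOpen.and ?_ (IsOpen.and ?_ ?_))) <;>
      exact isOpen_lt (by fun_prop) (by fun_prop)
  have hxV : x ∈ V := ⟨h1, by rw [hδ]; linarith, by linarith, by linarith, by linarith⟩
  obtain ⟨r, hr, hrV⟩ := Metric.isOpen_iff.1 hV x hxV
  refine ⟨r, hr, fun y hy => ⟨(hrV hy).1, (hrV hy).2.1.trans (by linarith)⟩, _,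
    ((summable_exp_quadratic hδ0 ((‖x.1‖ + 1)
      + Real.pi * ((‖x.2.2.2‖ + 1) + 2 * (‖x.1‖ + 1) * (‖x.2.1‖ + 1)))).mul_left
      (2 * Real.exp (2 * Real.pi * (‖x.2.1‖ + 1) ^ 2 + (‖x.2.1‖ + 1)))), fun k y hy => ?_⟩
  obtain ⟨g1, g2, g3, g4, g5⟩ := hrV hy
  exact norm_errTerm_le k g1 g3.le g4.le g5.le g2.le

lemma contDiff_gaussC : ContDiff ℂ ∞ gaussC := differentiable_gaussC.contDiff

lemma contDiff_errTerm (k : ℤ) : ContDiff ℂ ∞ (errTerm k) := by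
  unfold errTerm thetaExp
  have := contDiff_gaussC
  fun_prop

lemma contDiffOn_errSum : ContDiffOn ℂ ∞ errSum errDomain :=
  locallyNormallySummable_errTerm.contDiffOn isOpen_errDomain fun k => (contDiff_errTerm k).contDiffOn

lemma fderiv_errTerm (k : ℤ) (s b τ z e₁ e₂ : ℂ) :
    fderiv ℂ (errTerm k) (s, b, τ, z) (e₁, e₂, 0, 0) =
      (-1) ^ k * (-2 * Complex.exp (-Real.pi * ((6 * k + 5) * s + b) ^ 2) * ((6 * k + 5) * e₁ + e₂))
        * thetaExp k τ z := by
  have hline : HasDerivAt (fun t : ℂ => ((s, b, τ, z) : ℂ × ℂ × ℂ × ℂ) + t • (e₁, e₂, 0, 0))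
      (e₁, e₂, 0, 0) 0 := by
    simpa using ((hasDerivAt_id (0 : ℂ)).smul_const ((e₁, e₂, 0, 0) : ℂ × ℂ × ℂ × ℂ)).const_add
      ((s, b, τ, z) : ℂ × ℂ × ℂ × ℂ)
  have hF : HasFDerivAt (errTerm k) (fderiv ℂ (errTerm k) (s, b, τ, z))
      (((s, b, τ, z) : ℂ × ℂ × ℂ × ℂ) + (0 : ℂ) • (e₁, e₂, 0, 0)) := by
    rw [zero_smul, add_zero]
    exact ((contDiff_errTerm k).differentiable (by simp) _).hasFDerivAt
  have h1 := hF.comp_hasDerivAt 0 hline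
  have h2 : HasDerivAt (errTerm k ∘ fun t : ℂ => ((s, b, τ, z) : ℂ × ℂ × ℂ × ℂ) + t • (e₁, e₂, 0, 0))
      ((-1) ^ k * (-(2 * Complex.exp (-Real.pi * ((6 * k + 5) * s + b) ^ 2) * ((6 * k + 5) * e₁ + e₂)))
        * thetaExp k τ z) 0 := by
    have e : (errTerm k ∘ fun t : ℂ => ((s, b, τ, z) : ℂ × ℂ × ℂ × ℂ) + t • (e₁, e₂, 0, 0))
        = fun t : ℂ => (-1) ^ k * (halfSign k - gaussC ((6 * k + 5) * s + b + t * ((6 * k + 5) * e₁ + e₂)))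
          * thetaExp k τ z := by
      funext t
      simp only [Function.comp_apply, errTerm, Prod.smul_mk, Prod.mk_add_mk, smul_eq_mul,
        mul_zero, add_zero]
      congr 4
      ring
    rw [e]
    apply HasDerivAt.mul_const
    apply HasDerivAt.const_mul
    apply HasDerivAt.const_sub
    have h3 : HasDerivAt (fun t : ℂ => (6 * k + 5) * s + b + t * ((6 * k + 5) * e₁ + e₂))
        ((6 * k + 5) * e₁ + e₂) 0 := by
      simpa using ((hasDerivAt_id (0 : ℂ)).mul_const ((6 * k + 5) * e₁ + e₂)).const_add
        ((6 * k + 5) * s + b)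
    refine HasDerivAt.comp (0 : ℂ) ?_ h3
    rw [zero_mul, add_zero]
    exact hasDerivAt_gaussC ((6 * k + 5) * s + b)
  rw [h1.unique h2]
  ring

lemma hasSum_dirDeriv_errSum {s b τ z : ℂ} (h : (s, b, τ, z) ∈ errDomain) (e₁ e₂ : ℂ) :
    HasSum (fun k : ℤ => (-1) ^ k * (-2 * Complex.exp (-Real.pi * ((6 * k + 5) * s + b) ^ 2)
      * ((6 * k + 5) * e₁ + e₂)) * thetaExp k τ z) (dirDeriv (e₁, e₂, 0, 0) errSum (s, b, τ, z)) := by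
  have := locallyNormallySummable_errTerm.fderiv_apply isOpen_errDomain
    (fun k => ((contDiff_errTerm k).differentiable (by simp)).differentiableOn) h (e₁, e₂, 0, 0)
  exact this.congr_fun fun k => (fderiv_errTerm k s b τ z e₁ e₂).symm

lemma hasSum_errSum {p : ℂ × ℂ × ℂ × ℂ} (h : p ∈ errDomain) : HasSum (fun k => errTerm k p) (errSum p) :=
  (locallyNormallySummable_errTerm.summable h).hasSum

/-! ### The non-holomorphic part as a function of two independent variables -/

section ErrJac

/-- The number `√(v / 6)`. -/
noncomputable def sqrtIm (τ : ℂ) : ℂ := (Real.sqrt (τ.im / 6) : ℝ)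

variable {τ : ℂ}

lemma sqrtIm_sq (hτ : 0 < τ.im) : sqrtIm τ ^ 2 = τ.im / 6 := by
  rw [sqrtIm, ← Complex.ofReal_pow, Real.sq_sqrt (by positivity)]
  push_cast; rfl

lemma sqrtIm_re_pos (hτ : 0 < τ.im) : 0 < (sqrtIm τ).re := by
  rw [sqrtIm, Complex.ofReal_re]
  positivity

lemma sqrtIm_ne_zero (hτ : 0 < τ.im) : sqrtIm τ ≠ 0 := by
  intro h
  have := sqrtIm_re_pos hτ
  rw [h] at this
  simp at this

lemma mem_errDomain (hτ : 0 < τ.im) (b z : ℂ) : (sqrtIm τ, b, τ, z) ∈ errDomain := by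
  refine ⟨sqrtIm_re_pos hτ, ?_⟩
  simp only [sqrtIm_sq hτ]
  have : ((τ.im : ℂ) / 6).re = τ.im / 6 := by simp
  rw [this]
  linarith

/-- The function `ζ⁻¹ q^(-1/6) S(3z + τ; 3τ)`, with `conj z` replaced by an independent
variable `w`. -/
noncomputable def errJac (τ z w : ℂ) : ℂ :=
  errSum (sqrtIm τ, (z - w) / (2 * Complex.I * sqrtIm τ), τ, z)

lemma hasSum_errJac (hτ : 0 < τ.im) (z w : ℂ) :
    HasSum (fun k => errTerm k (sqrtIm τ, (z - w) / (2 * Complex.I * sqrtIm τ), τ, z)) (errJac τ z w) :=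
  hasSum_errSum (mem_errDomain hτ _ _)

lemma contDiff_errJac (hτ : 0 < τ.im) : ContDiff ℂ ∞ fun p : ℂ × ℂ => errJac τ p.1 p.2 := by
  rw [← contDiffOn_univ]
  refine contDiffOn_errSum.comp (f := fun p : ℂ × ℂ =>
    (sqrtIm τ, (p.1 - p.2) / (2 * Complex.I * sqrtIm τ), τ, p.1)) ?_ fun p _ => mem_errDomain hτ _ _
  apply ContDiff.contDiffOn
  fun_prop

/-- For `S(3z + τ; 3τ)` the index `k + 1/2` is shifted by `1/3 + y/v`, and `√(6v) = 6√(v/6)`; this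
produces `(6k + 5) s + y/s` with `s = √(v/6)`. The prefactor `ζ⁻¹ q^(-1/6)` completes the square in
the exponent. -/
lemma errTerm_eq_STerm (hτ : 0 < τ.im) (z : ℂ) (k : ℤ) :
    Complex.exp (-2 * Real.pi * Complex.I * z) * qPow (-1 / 6) τ * STerm (3 * z + τ) (3 * τ) k
      = errTerm k (sqrtIm τ, (z - conj z) / (2 * Complex.I * sqrtIm τ), τ, z) := by
  have h3 : (3 * τ).im = 3 * τ.im := by simp
  have h4 : (3 * z + τ).im = 3 * z.im + τ.im := by simp
  have h1 : Real.sqrt (2 * (3 * τ).im) = 6 * Real.sqrt (τ.im / 6) := by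
    rw [h3, show (2 : ℝ) * (3 * τ.im) = 6 ^ 2 * (τ.im / 6) by ring, Real.sqrt_mul (by norm_num),
      Real.sqrt_sq (by norm_num)]
  have hs : sqrtIm τ ≠ 0 := sqrtIm_ne_zero hτ
  have h2 : ((((k : ℝ) + 1 / 2 + (3 * z + τ).im / (3 * τ).im) * Real.sqrt (2 * (3 * τ).im) : ℝ) : ℂ)
      = (6 * k + 5) * sqrtIm τ + (z - conj z) / (2 * Complex.I * sqrtIm τ) := by
    have hz : z - conj z = 2 * z.im * Complex.I := by
      rw [Complex.sub_conj]; push_cast; ring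
    have hv : (τ.im : ℂ) = 6 * sqrtIm τ ^ 2 := by rw [sqrtIm_sq hτ]; ring
    rw [h1, h3, h4, hz]
    push_cast
    rw [hv, ← sqrtIm]
    have := Complex.I_ne_zero
    field_simp
    ring
  rw [errTerm, STerm, halfSign, thetaExp, qPow, qPow]
  push_cast [← gaussC_ofReal] at h2 ⊢
  rw [h2]
  rw [show ∀ a b c d e f : ℂ, a * b * (c * d * e * f) = d * c * (a * b * e * f) by intros; ring]
  rw [← Complex.exp_add, ← Complex.exp_add, ← Complex.exp_add]
  congr 2
  ring

lemma minusFun_eq (τ : ℍ) (z : ℂ) : minusFun τ z = errJac τ z (conj z)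
    * Complex.exp (-(Real.pi : ℂ) ^ 2 / 2 * EisensteinSeries.E2 τ * z ^ 2) := by
  rw [minusFun, S, ← tsum_mul_left, errJac, errSum]
  congr 1
  exact tsum_congr fun k => errTerm_eq_STerm τ.im_pos z k

/-- Any pair `(z, τ)` has the form `(3z' + τ', 3τ')`, so the convergence already known covers all
arguments. -/
lemma summable_STerm {z τ : ℂ} (hτ : 0 < τ.im) : Summable (STerm z τ) := by
  have h : 0 < (τ / 3).im := by
    rw [show τ / 3 = ((1 / 3 : ℝ) : ℂ) * τ by push_cast; ring, Complex.im_ofReal_mul]; positivity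
  set z' := (z - τ / 3) / 3 with hz'
  have h1 := (hasSum_errJac h z' (conj z')).summable
  rw [funext fun k => (errTerm_eq_STerm h z' k).symm] at h1
  rw [show 3 * z' + τ / 3 = z by rw [hz']; ring, show 3 * (τ / 3) = τ by ring] at h1
  refine (summable_mul_left_iff (mul_ne_zero (Complex.exp_ne_zero _) ?_)).1 h1
  exact Complex.exp_ne_zero _

/-- `minusFun`, with `conj z` replaced by an independent variable. -/
noncomputable def minusJac (τ : ℍ) (p : ℂ × ℂ) : ℂ :=
  errJac τ p.1 p.2 * Complex.exp (-(Real.pi : ℂ) ^ 2 / 2 * EisensteinSeries.E2 τ * p.1 ^ 2)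

lemma contDiff_minusJac (τ : ℍ) : ContDiff ℂ ∞ (minusJac τ) :=
  (contDiff_errJac τ.im_pos).mul (by fun_prop)

lemma minusFun_eq_minusJac (τ : ℍ) : minusFun τ = fun z => minusJac τ (z, conj z) :=
  funext (minusFun_eq τ)

lemma contDiff_minusFun (τ : ℍ) : ContDiff ℝ ∞ (minusFun τ) := by
  rw [minusFun_eq_minusJac]
  refine ((contDiff_minusJac τ).restrict_scalars ℝ).comp (f := fun z : ℂ => (z, conj z)) ?_
  exact contDiff_id.prodMk Complex.conjCLE.contDiff

lemma rMinus_eq (ℓ : ℕ) (τ : ℍ) : rMinus ℓ τ = 1 / ((2 * ℓ - 1).factorial : ℂ)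
    * iteratedDeriv (2 * ℓ - 1) (fun z => errJac τ z 0
      * Complex.exp (-(Real.pi : ℂ) ^ 2 / 2 * EisensteinSeries.E2 τ * z ^ 2)) 0 := by
  rw [rMinus, minusFun_eq_minusJac, dz_iterate_comp_conj_zero (contDiff_minusJac τ)]
  rfl

/-! ### Transformations of the non-holomorphic part -/

lemma thetaExp_add_one (k : ℤ) (τ z : ℂ) : thetaExp k τ (z + 1) = -thetaExp k τ z := by
  have h : Complex.exp (-Real.pi * Complex.I * (6 * k + 5)) = -1 := by
    rw [show -Real.pi * Complex.I * (6 * k + 5) = Real.pi * Complex.I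
      + ((-3 * k - 3 : ℤ) : ℂ) * (2 * Real.pi * Complex.I) by push_cast; ring, Complex.exp_add,
      Complex.exp_pi_mul_I, Complex.exp_int_mul_two_pi_mul_I, mul_one]
  rw [thetaExp, thetaExp, ← neg_one_mul (Complex.exp _), ← h, ← Complex.exp_add]
  congr 1
  ring

/-- Since `(6k + 5)²` is congruent to `1` modulo `24`, all terms acquire the same root of unity. -/
lemma thetaExp_vadd_one (k : ℤ) (τ z : ℂ) : thetaExp k (τ + 1) z =
    Complex.exp (-Real.pi * Complex.I / 12) * thetaExp k τ z := by
  obtain ⟨m, hm⟩ : ∃ m : ℤ, 3 * k ^ 2 + 5 * k = 2 * m := by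
    rcases Int.even_or_odd' k with ⟨m, rfl | rfl⟩
    · exact ⟨6 * m ^ 2 + 5 * m, by ring⟩
    · exact ⟨6 * m ^ 2 + 11 * m + 4, by ring⟩
  have hm' : 3 * (k : ℂ) ^ 2 + 5 * k = 2 * m := by exact_mod_cast hm
  rw [thetaExp, thetaExp, ← Complex.exp_add, Complex.exp_eq_exp_iff_exists_int]
  refine ⟨-m - 1, ?_⟩
  push_cast
  linear_combination (-Real.pi * Complex.I) * hm'

lemma errJac_vadd_one (hτ : 0 < τ.im) (z w : ℂ) :
    errJac (τ + 1) z w = Complex.exp (-Real.pi * Complex.I / 12) * errJac τ z w := by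
  have hs : sqrtIm (τ + 1) = sqrtIm τ := by simp [sqrtIm]
  have h := (hasSum_errJac hτ z w).mul_left (Complex.exp (-Real.pi * Complex.I / 12))
  have h' := hasSum_errJac (τ := τ + 1) (by simpa using hτ) z w
  refine h'.unique (h.congr_fun fun k => ?_)
  rw [errTerm, errTerm, hs]
  simp only [thetaExp_vadd_one]
  ring

lemma errJac_add_one (hτ : 0 < τ.im) (z w : ℂ) : errJac τ (z + 1) (w + 1) = -errJac τ z w := by
  refine (hasSum_errJac hτ (z + 1) (w + 1)).unique ((hasSum_errJac hτ z w).neg.congr_fun fun k => ?_)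
  simp only [errTerm, thetaExp_add_one, add_sub_add_right_eq_sub]
  ring

lemma thetaExp_add_self (k : ℤ) (τ z : ℂ) :
    thetaExp k τ (z + τ) = ellipticFactor τ z * thetaExp (k + 1) τ z := by
  rw [thetaExp, thetaExp, ellipticFactor, ← Complex.exp_add]
  congr 1
  push_cast
  ring

/-- The translation by `(τ, conj τ)` shifts `k` to `k + 1` in the error function and in the
exponential. Only the sign does not follow: its jump between `k = -1` and `k = 0` leaves the term `2
* thetaExp 0 τ z`. -/
lemma errJac_add_self (hτ : 0 < τ.im) (z w : ℂ) : errJac τ (z + τ) (w + conj τ) =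
    -ellipticFactor τ z * (errJac τ z w - 2 * thetaExp 0 τ z) := by
  have hs := sqrtIm_ne_zero hτ
  have h1 : (z + τ - (w + conj τ)) / (2 * Complex.I * sqrtIm τ)
      = (z - w) / (2 * Complex.I * sqrtIm τ) + 6 * sqrtIm τ := by
    have hz : τ - conj τ = 12 * sqrtIm τ ^ 2 * Complex.I := by
      rw [Complex.sub_conj, sqrtIm_sq hτ]; push_cast; ring
    have := Complex.I_ne_zero
    rw [show z + τ - (w + conj τ) = z - w + (τ - conj τ) by ring, hz]
    field_simp
    ring
  set b := (z - w) / (2 * Complex.I * sqrtIm τ) with hb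
  have h2 := hasSum_errJac hτ (z + τ) (w + conj τ)
  rw [h1] at h2
  have h3 : HasSum (fun k : ℤ => errTerm (k + 1) (sqrtIm τ, b, τ, z)) (errJac τ z w) :=
    (Equiv.hasSum_iff (Equiv.addRight (1 : ℤ)) (f := fun k => errTerm k (sqrtIm τ, b, τ, z))).2
      (hasSum_errJac hτ z w)
  have h4 : HasSum (fun k : ℤ => if k = -1 then 2 * thetaExp 0 τ z else 0) (2 * thetaExp 0 τ z) :=
    hasSum_ite_eq (-1 : ℤ) _
  refine h2.unique (((h3.sub h4).mul_left (-ellipticFactor τ z)).congr_fun fun k => ?_)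
  simp only [errTerm, thetaExp_add_self]
  have h5 : (6 * (k : ℂ) + 5) * sqrtIm τ + (b + 6 * sqrtIm τ)
      = (6 * ((k + 1 : ℤ) : ℂ) + 5) * sqrtIm τ + b := by push_cast; ring
  rw [h5, zpow_add_one₀ (by norm_num)]
  by_cases hk : k = -1
  · subst hk
    rw [if_pos rfl, halfSign_of_neg (by norm_num), halfSign_of_nonneg (by norm_num)]
    push_cast
    norm_num
    ring
  · rw [if_neg hk]
    have : halfSign (k + 1) = halfSign k := by
      rcases lt_or_ge k 0 with h | h
      · rw [halfSign_of_neg h, halfSign_of_neg (by lia)]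
      · rw [halfSign_of_nonneg h, halfSign_of_nonneg (by lia)]
    rw [this]
    ring

lemma errJac_neg_add_self (hτ : 0 < τ.im) (z w : ℂ) : errJac τ (-(z + τ)) (-(w + conj τ)) =
    -ellipticFactor τ z * (errJac τ (-z) (-w)
      - 2 * Complex.exp (-Real.pi * Complex.I * τ / 12 - Real.pi * Complex.I * z)) := by
  have h := errJac_add_self hτ (-(z + τ)) (-(w + conj τ))
  rw [show -(z + τ) + τ = -z by ring, show -(w + conj τ) + conj τ = -w by ring] at h
  have h1 : ellipticFactor τ (-(z + τ)) * ellipticFactor τ z = 1 := by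
    rw [ellipticFactor, ellipticFactor, ← Complex.exp_add, Complex.exp_eq_one_iff]
    exact ⟨0, by push_cast; ring⟩
  have h2 : thetaExp 0 τ (-(z + τ)) = ellipticFactor τ z
      * Complex.exp (-Real.pi * Complex.I * τ / 12 - Real.pi * Complex.I * z) := by
    rw [thetaExp, ellipticFactor, ← Complex.exp_add]
    congr 1
    push_cast; ring
  rw [h2] at h
  linear_combination ellipticFactor τ z * h - (errJac τ (-(z + τ)) (-(w + conj τ))
    - 2 * ellipticFactor τ z
      * Complex.exp (-Real.pi * Complex.I * τ / 12 - Real.pi * Complex.I * z)) * h1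

/-! ### The unary theta series and the derivative in the conjugate variable -/

/-- The theta series `∑ (-1)^k exp (π i (6k+5)² σ / 12 + π i (6k+5) w)`. -/
noncomputable def thetaFive (σ w : ℂ) : ℂ := ∑' k : ℤ, (-1) ^ k * thetaExp k (-σ) (-w)

lemma hasSum_thetaFive {σ : ℂ} (hσ : 0 < σ.im) (w : ℂ) :
    HasSum (fun k : ℤ => (-1) ^ k * thetaExp k (-σ) (-w)) (thetaFive σ w) := by
  refine (Summable.of_norm_bounded (summable_exp_quadratic (δ := σ.im / 12) (by positivity)
    (Real.pi * |w.im|)) fun k => ?_).hasSum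
  rw [norm_mul, norm_zpow, norm_neg, norm_one, one_zpow, one_mul, norm_thetaExp, Real.exp_le_exp,
    Complex.neg_im, Complex.neg_im]
  have : -((6 * k + 5 : ℝ) * w.im) ≤ |w.im| * |(6 * k + 5 : ℝ)| := by
    rw [mul_comm |w.im|, ← abs_mul]; exact neg_le_abs _
  nlinarith [mul_le_mul_of_nonneg_left this Real.pi_pos.le]

lemma neg_conj_im (τ : ℂ) : (-conj τ).im = τ.im := by simp

/-- Expanding the square, the term with `s² = v/6` turns `τ` into `conj τ` and the cross term turns
`z` into `w`. This is why the derivative of the error series is antiholomorphic up to a Gaussian. -/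
lemma exp_mul_thetaExp (hτ : 0 < τ.im) (z w : ℂ) (k : ℤ) :
    Complex.exp (-Real.pi * ((6 * k + 5) * sqrtIm τ + (z - w) / (2 * Complex.I * sqrtIm τ)) ^ 2)
      * thetaExp k τ z = Complex.exp (-Real.pi * ((z - w) / (2 * Complex.I * sqrtIm τ)) ^ 2)
        * thetaExp k (-(-conj τ)) (-(-w)) := by
  have hs := sqrtIm_ne_zero hτ
  have h1 : sqrtIm τ * ((z - w) / (2 * Complex.I * sqrtIm τ)) = -Complex.I * (z - w) / 2 := by
    have := Complex.I_ne_zero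
    field_simp
    rw [Complex.I_sq]; ring
  have h2 : conj τ = τ - 12 * sqrtIm τ ^ 2 * Complex.I := by
    have h := Complex.sub_conj τ
    push_cast at h
    rw [sqrtIm_sq hτ]
    linear_combination -h
  set b := (z - w) / (2 * Complex.I * sqrtIm τ)
  rw [thetaExp, thetaExp, ← Complex.exp_add, ← Complex.exp_add, neg_neg, neg_neg, h2]
  congr 1
  linear_combination (-2 * Real.pi * (6 * k + 5)) * h1
    - Real.pi * (6 * k + 5) ^ 2 * sqrtIm τ ^ 2 * Complex.I_sq

/-- The variable `w` enters only through the second slot of `errSum`, where each error function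
differentiates to a Gaussian; after the common factor is removed, a theta series in `(-conj τ, -w)`
remains. -/
lemma hasDerivAt_errJac (hτ : 0 < τ.im) (z w : ℂ) :
    HasDerivAt (fun w => errJac τ z w) (-(Complex.I / sqrtIm τ)
      * Complex.exp (-Real.pi * ((z - w) / (2 * Complex.I * sqrtIm τ)) ^ 2)
        * thetaFive (-conj τ) (-w)) w := by
  have hI := Complex.I_ne_zero
  have hs := sqrtIm_ne_zero hτ
  set e₂ := -1 / (2 * Complex.I * sqrtIm τ) with he
  have h1 : HasDerivAt (fun w => (sqrtIm τ, (z - w) / (2 * Complex.I * sqrtIm τ), τ, z))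
      ((0, e₂, 0, 0) : ℂ × ℂ × ℂ × ℂ) w := by
    refine (hasDerivAt_const _ _).prodMk (HasDerivAt.prodMk ?_ ((hasDerivAt_const _ _).prodMk
      (hasDerivAt_const _ _)))
    exact ((hasDerivAt_id w).const_sub z).div_const _
  have h2 := ((contDiffOn_errSum.contDiffAt (isOpen_errDomain.mem_nhds
    (mem_errDomain hτ ((z - w) / (2 * Complex.I * sqrtIm τ)) z))).differentiableAt
      (by simp)).hasFDerivAt.comp_hasDerivAt w h1
  have h3 := hasSum_dirDeriv_errSum (mem_errDomain hτ ((z - w) / (2 * Complex.I * sqrtIm τ)) z) 0 e₂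
  have h4 := (hasSum_thetaFive (σ := -conj τ) (by rwa [neg_conj_im]) (-w)).mul_left (-2 * e₂
    * Complex.exp (-Real.pi * ((z - w) / (2 * Complex.I * sqrtIm τ)) ^ 2))
  have h5 : dirDeriv (0, e₂, 0, 0) errSum (sqrtIm τ, (z - w) / (2 * Complex.I * sqrtIm τ), τ, z)
      = -(Complex.I / sqrtIm τ)
      * Complex.exp (-Real.pi * ((z - w) / (2 * Complex.I * sqrtIm τ)) ^ 2)
        * thetaFive (-conj τ) (-w) := by
    rw [h3.unique (h4.congr_fun fun k => ?_)]
    · rw [he]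
      field_simp
      rw [Complex.I_sq]; ring
    · have := exp_mul_thetaExp hτ z w k
      linear_combination (-2 * (-1) ^ k * e₂) * this
  rw [← h5]
  exact h2

end ErrJac

/-! ### The theta function of character `12` and the eta function -/

section Theta

/-- `exp (π i M² σ / 12 + π i M w)`. -/
noncomputable def gaussTerm (σ w : ℂ) (M : ℤ) : ℂ :=
  Complex.exp (Real.pi * Complex.I * M ^ 2 * σ / 12 + Real.pi * Complex.I * M * w)

/-- The partial theta series over a residue class modulo `12`. -/
noncomputable def residueTheta (σ w : ℂ) (r : ℤ) : ℂ := ∑' n : ℤ, gaussTerm σ w (12 * n + r)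

variable {σ : ℂ}

lemma gaussTerm_eq_jacobiTheta₂_term (σ w : ℂ) (j : ℂ) (M : ℤ) :
    jacobiTheta₂_term M (w / 2 + j / 12) (σ / 12)
      = Complex.exp (Real.pi * Complex.I / 6 * j) ^ M * gaussTerm σ w M := by
  rw [jacobiTheta₂_term, gaussTerm, ← Complex.exp_int_mul, ← Complex.exp_add]
  congr 1
  ring

lemma div_twelve_im_pos (hσ : 0 < σ.im) : 0 < (σ / 12).im := by
  rw [show σ / 12 = ((1 / 12 : ℝ) : ℂ) * σ by push_cast; ring, Complex.im_ofReal_mul]; positivity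

lemma summable_gaussTerm (hσ : 0 < σ.im) (w : ℂ) : Summable (gaussTerm σ w) := by
  refine (hasSum_jacobiTheta₂_term (w / 2 + 0 / 12) (div_twelve_im_pos hσ)).summable.congr fun M => ?_
  rw [gaussTerm_eq_jacobiTheta₂_term]
  simp

lemma hasSum_residueTheta (hσ : 0 < σ.im) (w : ℂ) (r : ℤ) :
    HasSum (fun n : ℤ => gaussTerm σ w (12 * n + r)) (residueTheta σ w r) := by
  have hinj : Function.Injective fun n : ℤ => 12 * n + r := fun a b h => by
    simp only at h; lia
  exact ((summable_gaussTerm hσ w).comp_injective hinj).hasSum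

lemma residueTheta_neg (w : ℂ) (r : ℤ) : residueTheta σ (-w) r = residueTheta σ w (-r) := by
  rw [residueTheta, residueTheta, ← (Equiv.neg ℤ).tsum_eq]
  refine tsum_congr fun n => ?_
  simp only [Equiv.neg_apply, gaussTerm]
  congr 1
  push_cast
  ring

lemma residueTheta_add_twelve (w : ℂ) (r : ℤ) : residueTheta σ w (r + 12) = residueTheta σ w r := by
  rw [residueTheta, residueTheta, ← (Equiv.addRight (1 : ℤ)).tsum_eq fun n => gaussTerm σ w (12 * n + r)]
  refine tsum_congr fun n => ?_
  rw [Equiv.coe_addRight]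
  congr 1
  ring

/-- A translation by `j/12` multiplies each term by a twelfth root of unity that depends only on the
residue of its index. The translated theta values are thus the discrete Fourier transform of the
residue classes. -/
lemma jacobiTheta₂_eq_sum_residueTheta (hσ : 0 < σ.im) (w : ℂ) {ε : ℂ} {j : ℕ}
    (hε : Complex.exp (Real.pi * Complex.I / 6) = ε) (h12 : ε ^ 12 = 1) :
    jacobiTheta₂ (w / 2 + j / 12) (σ / 12)
      = ∑ r : Fin 12, ε ^ (j * (r : ℕ)) * residueTheta σ w (r : ℕ) := by
  have h := hasSum_jacobiTheta₂_term (w / 2 + (j : ℂ) / 12) (div_twelve_im_pos hσ)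
  have h1 := ((Equiv.prodComm _ _).trans (Int.divModEquiv 12).symm).hasSum_iff.2 h
  have h2 := h1.prod_fiberwise (g := fun r : Fin 12 => ε ^ (j * (r : ℕ)) * residueTheta σ w (r : ℕ))
    fun r => by
      refine ((hasSum_residueTheta hσ w (r : ℕ)).mul_left (ε ^ (j * (r : ℕ)))).congr_fun fun n => ?_
      have e : ((Equiv.prodComm _ _).trans (Int.divModEquiv 12).symm) (r, n) = 12 * n + ((r : ℕ) : ℤ) := by
        simp [mul_comm]
      rw [Function.comp_apply, e, gaussTerm_eq_jacobiTheta₂_term, mul_comm _ (j : ℂ),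
        Complex.exp_nat_mul, hε]
      congr 1
      have h0 : ε ≠ 0 := by rw [← hε]; exact Complex.exp_ne_zero _
      rw [zpow_add₀ (pow_ne_zero _ h0), zpow_mul, zpow_natCast, ← pow_mul]
      have : (ε ^ j) ^ (12 : ℤ) = 1 := by
        rw [show (12 : ℤ) = ((12 : ℕ) : ℤ) by norm_num, zpow_natCast, ← pow_mul, mul_comm, pow_mul, h12,
          one_pow]
      rw [this, one_zpow, one_mul]
  exact h2.unique (hasSum_fintype _)

lemma neg_one_div_im_pos (hσ : 0 < σ.im) : 0 < (-1 / σ).im := by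
  have h0 : σ ≠ 0 := by rintro rfl; simp at hσ
  have : 0 < Complex.normSq σ := Complex.normSq_pos.2 h0
  rw [neg_div, one_div, Complex.neg_im, Complex.inv_im]
  have : 0 < σ.im / Complex.normSq σ := by positivity
  rw [neg_div, neg_neg]; exact this

/-- After inversion the translation by `j/12` becomes a shift of the summation index, which selects
the class of `-j` modulo `12`. -/
lemma jacobiTheta₂_eq_residueTheta_inv (hσ : 0 < σ.im) (w : ℂ) (j : ℕ) :
    Complex.exp (-Real.pi * Complex.I * (w / 2 + j / 12) ^ 2 / (σ / 12))
      * jacobiTheta₂ ((w / 2 + j / 12) / (σ / 12)) (-1 / (σ / 12))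
      = Complex.exp (-3 * Real.pi * Complex.I * w ^ 2 / σ) * residueTheta (-1 / σ) (w / σ) (-j) := by
  have h0 : σ ≠ 0 := by rintro rfl; simp at hσ
  have h1 := (hasSum_jacobiTheta₂_term ((w / 2 + (j : ℂ) / 12) / (σ / 12))
    (neg_one_div_im_pos (div_twelve_im_pos hσ))).mul_left
      (Complex.exp (-Real.pi * Complex.I * (w / 2 + j / 12) ^ 2 / (σ / 12)))
  have h2 := (hasSum_residueTheta (neg_one_div_im_pos hσ) (w / σ) (-j)).mul_left
    (Complex.exp (-3 * Real.pi * Complex.I * w ^ 2 / σ))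
  refine h1.unique (h2.congr_fun fun n => ?_)
  rw [jacobiTheta₂_term, gaussTerm, ← Complex.exp_add, ← Complex.exp_add]
  congr 1
  push_cast
  field_simp
  ring

/-- The factor of automorphy of weight one half for `σ ↦ -1/σ`, equal to `(-iσ)^(1/2)`. -/
noncomputable def invFactor (σ : ℂ) : ℂ :=
  2 * (Real.sqrt 3 : ℝ) * (-Complex.I * (σ / 12)) ^ (1 / 2 : ℂ)

/-- The even theta function `∑ χ(M) exp (π i M² σ / 12 + π i M w)`, with `-χ` the character
of conductor `12`. -/
noncomputable def thetaEven (σ w : ℂ) : ℂ := thetaFive σ w + thetaFive σ (-w)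

lemma thetaEven_neg (σ w : ℂ) : thetaEven σ (-w) = thetaEven σ w := by
  rw [thetaEven, thetaEven, neg_neg, add_comm]

lemma thetaFive_eq_sub (hσ : 0 < σ.im) (w : ℂ) :
    thetaFive σ w = residueTheta σ w 5 - residueTheta σ w 11 := by
  have h := (Int.divModEquiv 2).symm.hasSum_iff.2 (hasSum_thetaFive hσ w)
  have h1 := ((Equiv.prodComm _ _).hasSum_iff.2 h).prod_fiberwise
    (g := ![residueTheta σ w 5, -residueTheta σ w 11]) fun r => by
      fin_cases r
      · refine (hasSum_residueTheta hσ w 5).congr_fun fun n => ?_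
        simp only [Function.comp_apply, Equiv.prodComm_apply, Prod.swap_prod_mk,
          Int.divModEquiv_symm_apply, thetaExp, gaussTerm]
        have : (-1 : ℂ) ^ (n * 2) = 1 := Even.neg_one_zpow (by simp)
        push_cast
        simp only [add_zero, this, one_mul]
        congr 1
        ring
      · refine (hasSum_residueTheta hσ w 11).neg.congr_fun fun n => ?_
        simp only [Function.comp_apply, Equiv.prodComm_apply, Prod.swap_prod_mk,
          Int.divModEquiv_symm_apply, thetaExp, gaussTerm]
        have : (-1 : ℂ) ^ (n * 2 + 1) = -1 := Odd.neg_one_zpow ⟨n, by ring⟩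
        push_cast
        simp only [this, neg_one_mul]
        congr 2
        ring
  rw [h1.unique (hasSum_fintype _)]
  simp [sub_eq_add_neg]

lemma thetaEven_eq_residueTheta (hσ : 0 < σ.im) (w : ℂ) : thetaEven σ w =
    residueTheta σ w 5 + residueTheta σ w 7 - residueTheta σ w 1 - residueTheta σ w 11 := by
  rw [thetaEven, thetaFive_eq_sub hσ, thetaFive_eq_sub hσ, residueTheta_neg, residueTheta_neg,
    ← residueTheta_add_twelve w (-5), ← residueTheta_add_twelve w (-11)]
  norm_num
  ring

lemma exp_pi_I_div_six : Complex.exp (Real.pi * Complex.I / 6) = ((Real.sqrt 3 : ℝ) + Complex.I) / 2 := by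
  rw [show (Real.pi : ℂ) * Complex.I / 6 = ((Real.pi / 6 : ℝ) : ℂ) * Complex.I by push_cast; ring,
    Complex.exp_mul_I, ← Complex.ofReal_cos, ← Complex.ofReal_sin, Real.cos_pi_div_six,
    Real.sin_pi_div_six]
  push_cast
  ring

/-- Poisson summation for `j = 1, 5, 7, 11`, combined with the even primitive character modulo `12`.
The finite Fourier transform reproduces the character up to its Gauss sum `2√3`, so `thetaEven` is
carried to itself. -/
theorem thetaEven_inv (hσ : 0 < σ.im) (w : ℂ) : thetaEven (-1 / σ) (w / σ)
    = invFactor σ * Complex.exp (3 * Real.pi * Complex.I * w ^ 2 / σ) * thetaEven σ w := by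
  set ε : ℂ := ((Real.sqrt 3 : ℝ) + Complex.I) / 2 with hεd
  have hε := exp_pi_I_div_six
  rw [← hεd] at hε
  have h3 : ((Real.sqrt 3 : ℝ) : ℂ) ^ 2 = 3 := by
    rw [← Complex.ofReal_pow, Real.sq_sqrt (by norm_num)]; norm_num
  -- The twelfth cyclotomic polynomial, with which all powers of `ε` are reduced below.
  have h4 : ε ^ 4 = ε ^ 2 - 1 := by
    have h5 : ε ^ 2 = 1 / 2 + (Real.sqrt 3 : ℝ) * Complex.I / 2 := by
      rw [hεd]; linear_combination (1 / 4) * h3 + (1 / 4) * Complex.I_sq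
    linear_combination (ε ^ 2 + 1 / 2 + (Real.sqrt 3 : ℝ) * Complex.I / 2 - 1) * h5
      + (1 / 4) * Complex.I ^ 2 * h3 + (3 / 4) * Complex.I_sq
  have h6 : ε ^ 6 = -1 := by linear_combination (ε ^ 2 + 1) * h4
  have h12 : ε ^ 12 = 1 := by linear_combination (ε ^ 6 - 1) * h6
  -- The Gauss sum `ε - ε⁵ - ε⁷ + ε¹¹` in reduced form.
  have hg : 4 * ε - 2 * ε ^ 3 = 2 * (Real.sqrt 3 : ℝ) := by
    have h5 : ε ^ 2 = 1 / 2 + (Real.sqrt 3 : ℝ) * Complex.I / 2 := by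
      rw [hεd]; linear_combination (1 / 4) * h3 + (1 / 4) * Complex.I_sq
    have : ε ^ 3 = Complex.I := by
      rw [pow_succ, h5, hεd]; linear_combination (Complex.I / 4) * h3 + ((Real.sqrt 3 : ℝ) / 4) * Complex.I_sq
    rw [this, hεd]; ring
  have key : ∀ j : ℕ, ∑ r : Fin 12, ε ^ (j * (r : ℕ)) * residueTheta σ w (r : ℕ)
      = 1 / (-Complex.I * (σ / 12)) ^ (1 / 2 : ℂ) * (Complex.exp (-3 * Real.pi * Complex.I * w ^ 2 / σ)
        * residueTheta (-1 / σ) (w / σ) (-j + 12)) := by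
    intro j
    rw [← jacobiTheta₂_eq_sum_residueTheta hσ w hε h12, jacobiTheta₂_functional_equation, mul_assoc,
      jacobiTheta₂_eq_residueTheta_inv hσ, residueTheta_add_twelve]
  have k1 := key 1
  have k5 := key 5
  have k7 := key 7
  have k11 := key 11
  have hmod : ∀ m : ℕ, ε ^ m = ε ^ (m % 12) := fun m => pow_eq_pow_mod m h12
  rw [Finset.sum_congr rfl fun r _ => by rw [hmod (_ * _)]] at k1 k5 k7 k11
  simp only [Fin.sum_univ_succ, Fin.sum_univ_zero, Fin.val_succ, Fin.val_zero] at k1 k5 k7 k11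
  norm_num at k1 k5 k7 k11
  have hc : (-Complex.I * (σ / 12)) ^ (1 / 2 : ℂ) ≠ 0 := by
    have h0 : σ ≠ 0 := by rintro rfl; simp at hσ
    rw [Ne, Complex.cpow_eq_zero_iff]
    simp [h0]
  have hexp : Complex.exp (3 * Real.pi * Complex.I * w ^ 2 / σ)
      * Complex.exp (-3 * Real.pi * Complex.I * w ^ 2 / σ) = 1 := by
    rw [← Complex.exp_add, Complex.exp_eq_one_iff]; exact ⟨0, by push_cast; ring⟩
  rw [thetaEven_eq_residueTheta hσ, thetaEven_eq_residueTheta (neg_one_div_im_pos hσ), invFactor, ← hg]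
  have e5 : ε ^ 5 = ε ^ 3 - ε := by linear_combination ε * h4
  have e7 : ε ^ 7 = -ε := by linear_combination ε * h6
  have e9 : ε ^ 9 = -ε ^ 3 := by linear_combination ε ^ 3 * h6
  have e11 : ε ^ 11 = ε - ε ^ 3 := by linear_combination ε ^ 5 * h6 - ε * h4
  rw [e5, e7, e9, e11] at k1 k5 k7 k11
  rw [neg_mul] at hc ⊢
  rw [show -3 * Real.pi * Complex.I * w ^ 2 / σ = -(3 * Real.pi * Complex.I * w ^ 2) / σ by ring] at hexp
  have hP := mul_inv_cancel₀ hc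
  set P := (-(Complex.I * (σ / 12))) ^ (1 / 2 : ℂ)
  set E := Complex.exp (3 * Real.pi * Complex.I * w ^ 2 / σ)
  set E' := Complex.exp (-(3 * Real.pi * Complex.I * w ^ 2) / σ)
  set T := residueTheta (-1 / σ) (w / σ) 5 + residueTheta (-1 / σ) (w / σ) 7
    - residueTheta (-1 / σ) (w / σ) 1 - residueTheta (-1 / σ) (w / σ) 11 with hT
  have hS : (4 * ε - 2 * ε ^ 3) * (residueTheta σ w 5 + residueTheta σ w 7 - residueTheta σ w 1
      - residueTheta σ w 11) = P⁻¹ * (E' * T) := by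
    rw [hT]
    linear_combination k5 + k7 - k1 - k11
  linear_combination (-P * E) * hS - E * E' * T * hP - T * hexp

/-! ### The automorphy factor of weight one half and the eta function -/

lemma neg_I_mul_div_re_pos (hσ : 0 < σ.im) : 0 < (-Complex.I * (σ / 12)).re := by
  have := div_twelve_im_pos hσ
  simpa using this

lemma invFactor_sq (hσ : 0 < σ.im) : invFactor σ ^ 2 = -Complex.I * σ := by
  have h0 : σ ≠ 0 := by rintro rfl; simp at hσ
  have h3 : ((Real.sqrt 3 : ℝ) : ℂ) ^ 2 = 3 := by
    rw [← Complex.ofReal_pow, Real.sq_sqrt (by norm_num)]; norm_num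
  rw [invFactor, mul_pow, mul_pow, h3, ← Complex.cpow_nat_mul]
  norm_num
  ring

lemma invFactor_neg_conj (hσ : 0 < σ.im) : invFactor (-conj σ) = conj (invFactor σ) := by
  have h1 : -Complex.I * (-conj σ / 12) = conj (-Complex.I * (σ / 12)) := by
    simp [Complex.conj_ofNat]; ring
  rw [invFactor, invFactor, map_mul, map_mul, Complex.conj_ofReal, h1, Complex.conj_cpow _ _
    (Complex.slitPlane_arg_ne_pi (Or.inl (neg_I_mul_div_re_pos hσ)))]
  simp [Complex.conj_ofNat]

/-- In `oddJac_inv_sub_const` the factor of `η` at `τ` meets that of the theta series at `-conj τ`.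
Their product is cancelled by the powers of `τ`, `conj τ` and `|τ|` that come from the rest. -/
lemma invFactor_mul_neg_conj (hσ : 0 < σ.im) : invFactor σ * invFactor (-conj σ) = ‖σ‖ := by
  rw [invFactor_neg_conj hσ, Complex.mul_conj, Complex.normSq_eq_norm_sq, ← norm_pow, invFactor_sq hσ]
  simp

lemma norm_exp_two_pi_I_lt_one (hσ : 0 < σ.im) : ‖Complex.exp (2 * Real.pi * Complex.I * σ)‖ < 1 := by
  rw [Complex.norm_exp, Real.exp_lt_one_iff]
  have : (2 * Real.pi * Complex.I * σ).re = -(2 * Real.pi * σ.im) := by simp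
  rw [this]
  have := Real.pi_pos
  have : 0 < 2 * Real.pi * σ.im := by positivity
  linarith

lemma eta_eq_partialTheta (hσ : 0 < σ.im) : ModularForm.eta σ =
    Complex.exp (Real.pi * Complex.I * σ / 12) * (1 - partialTheta 0 (Complex.exp (2 * Real.pi * Complex.I * σ))
      - partialTheta 1 (Complex.exp (2 * Real.pi * Complex.I * σ))) := by
  rw [ModularForm.eta, ← tprod_one_sub_pow_eq (norm_exp_two_pi_I_lt_one hσ)]
  simp_rw [ModularForm.eta_q_eq_pow]
  rw [Function.Periodic.qParam]
  congr 2
  push_cast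
  ring

/-- Since `(6k + 5)² = 24 pent k + 1`, the indices `k ≥ 0` give one family of pentagonal numbers.
The index `k = -1` gives the constant `-1`, and `k ≤ -2` the other family; the pentagonal number
theorem identifies the sum. -/
theorem thetaFive_zero (hσ : 0 < σ.im) : thetaFive σ 0 = -ModularForm.eta σ := by
  rw [eta_eq_partialTheta hσ]
  set q := Complex.exp (2 * Real.pi * Complex.I * σ) with hq
  have hq1 : ‖q‖ < 1 := norm_exp_two_pi_I_lt_one hσ
  have hpow : ∀ n : ℕ, q ^ n = Complex.exp (2 * Real.pi * Complex.I * n * σ) := fun n => by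
    rw [hq, ← Complex.exp_nat_mul]; congr 1; ring
  have hpent : ∀ j : ℕ, 2 * (pent j : ℂ) = (j + 1) * (3 * j + 2) := fun j => by
    exact_mod_cast two_mul_pent j
  have h1 : HasSum (fun n : ℕ => (-1 : ℂ) ^ (n : ℤ) * thetaExp n (-σ) (-0))
      (Complex.exp (Real.pi * Complex.I * σ / 12) * partialTheta 0 q) := by
    refine ((summable_partialTheta 0 hq1).hasSum.mul_left
      (Complex.exp (Real.pi * Complex.I * σ / 12))).congr_fun fun n => ?_
    rw [thetaExp, zpow_natCast, mul_left_comm, hpow, ← Complex.exp_add]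
    congr 2
    push_cast
    linear_combination (-Real.pi * Complex.I * σ) * hpent n
  have h2 : HasSum (fun n : ℕ => (-1 : ℂ) ^ (-((n : ℤ) + 1)) * thetaExp (-(n + 1)) (-σ) (-0))
      (Complex.exp (Real.pi * Complex.I * σ / 12) * (partialTheta 1 q - 1)) := by
    rw [← hasSum_nat_add_iff' 1]
    have e0 : Complex.exp (Real.pi * Complex.I * σ / 12) * (partialTheta 1 q - 1)
        - ∑ i ∈ Finset.range 1, (-1 : ℂ) ^ (-((i : ℤ) + 1)) * thetaExp (-(i + 1)) (-σ) (-0)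
        = Complex.exp (Real.pi * Complex.I * σ / 12) * partialTheta 1 q := by
      rw [Finset.sum_range_one, thetaExp]
      have : -Real.pi * Complex.I * (6 * ((-(((0 : ℕ) : ℤ) + 1) : ℤ) : ℂ) + 5) ^ 2 * -σ / 12
        - Real.pi * Complex.I * (6 * ((-(((0 : ℕ) : ℤ) + 1) : ℤ) : ℂ) + 5) * -0
        = Real.pi * Complex.I * σ / 12 := by push_cast; ring
      rw [this]
      norm_num
      ring
    rw [e0]
    refine ((summable_partialTheta 1 hq1).hasSum.mul_left
      (Complex.exp (Real.pi * Complex.I * σ / 12))).congr_fun fun n => ?_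
    have e1 : (-1 : ℂ) ^ (-(((n + 1 : ℕ) : ℤ) + 1)) = (-1) ^ n := by
      rw [zpow_neg, ← inv_zpow, show (-1 : ℂ)⁻¹ = -1 by norm_num, ← Nat.cast_succ, zpow_natCast, Nat.succ_eq_add_one]
      ring
    rw [thetaExp, e1, mul_left_comm, hpow, ← Complex.exp_add]
    congr 2
    push_cast
    linear_combination (-Real.pi * Complex.I * σ) * hpent n
  have h3 := hasSum_thetaFive hσ 0
  rw [h3.unique (HasSum.of_nat_of_neg_add_one h1 h2)]
  ring

lemma thetaEven_zero (hσ : 0 < σ.im) : thetaEven σ 0 = -2 * ModularForm.eta σ := by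
  rw [thetaEven, neg_zero, thetaFive_zero hσ]; ring

theorem eta_inv (hσ : 0 < σ.im) : ModularForm.eta (-1 / σ) = invFactor σ * ModularForm.eta σ := by
  have h := thetaEven_inv hσ 0
  rw [zero_div, thetaEven_zero hσ, thetaEven_zero (neg_one_div_im_pos hσ)] at h
  norm_num at h
  linear_combination h / 2

lemma eta_vadd_one (hσ : 0 < σ.im) : ModularForm.eta (σ + 1)
    = Complex.exp (Real.pi * Complex.I / 12) * ModularForm.eta σ := by
  have h1 : Complex.exp (2 * Real.pi * Complex.I * (σ + 1)) = Complex.exp (2 * Real.pi * Complex.I * σ) := by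
    rw [mul_add, mul_one, Complex.exp_add, Complex.exp_two_pi_mul_I, mul_one]
  rw [eta_eq_partialTheta hσ, eta_eq_partialTheta (by simpa using hσ), h1, ← mul_assoc, ← Complex.exp_add]
  congr 2
  ring

end Theta

/-! ### The Appell function -/

section Appell

variable {τ : ℂ}

/-- The summand of the Appell function. -/
noncomputable def appellTerm (τ z : ℂ) (n : ℤ) : ℂ :=
  (-1) ^ n * Complex.exp (Real.pi * Complex.I * (n * (3 * n + 1)) * τ)
    / (1 - Complex.exp (2 * Real.pi * Complex.I * (z + n * τ)))

/-- The Appell function `-ζ^(1/2) ∑ (-1)^n q^(n(3n+1)/2) / (1 - ζ q^n)`. -/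
noncomputable def appell (τ z : ℂ) : ℂ :=
  -Complex.exp (Real.pi * Complex.I * z) * ∑' n : ℤ, appellTerm τ z n

lemma norm_exp_two_pi_I_mul (x : ℂ) : ‖Complex.exp (2 * Real.pi * Complex.I * x)‖
    = Real.exp (-(2 * Real.pi * x.im)) := by
  rw [Complex.norm_exp]; simp

lemma one_sub_exp_ne_zero {z : ℂ} (hz : z ∉ latticeSet τ) (n : ℤ) :
    1 - Complex.exp (2 * Real.pi * Complex.I * (z + n * τ)) ≠ 0 := by
  intro h
  obtain ⟨m, hm⟩ := Complex.exp_eq_one_iff.1 (sub_eq_zero.1 h).symm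
  have h1 : z + n * τ = m := by
    have := Complex.two_pi_I_ne_zero
    apply mul_left_cancel₀ this
    rw [hm]; ring
  exact hz ⟨m, -n, by push_cast; linear_combination h1⟩

lemma summable_exp_three (hτ : 0 < τ.im) (c : ℂ) :
    Summable fun n : ℤ => Complex.exp (Real.pi * Complex.I * (3 * n ^ 2 + c * n) * τ) := by
  have h3 : 0 < (3 * τ).im := by simpa using hτ
  refine (hasSum_jacobiTheta₂_term (c * τ / 2) h3).summable.congr fun n => ?_
  rw [jacobiTheta₂_term]
  congr 1
  ring

lemma summable_norm_appellNum (hτ : 0 < τ.im) :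
    Summable fun n : ℤ => ‖Complex.exp (Real.pi * Complex.I * (n * (3 * n + 1)) * τ)‖ := by
  refine ((summable_exp_three hτ 1).congr fun n => ?_).norm
  congr 1
  ring

/-- Near any point, all but finitely many of the denominators are bounded from below. -/
lemma exists_finset_half_le (hτ : 0 < τ.im) (R : ℝ) : ∃ F : Finset ℤ, 0 ∈ F ∧ ∀ n ∉ F, ∀ z : ℂ, ‖z‖ < R →
    1 / 2 ≤ ‖1 - Complex.exp (2 * Real.pi * Complex.I * (z + n * τ))‖ := by
  obtain ⟨N, hN⟩ := exists_nat_gt ((R + 1) / τ.im)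
  rw [div_lt_iff₀ hτ] at hN
  refine ⟨Finset.Icc (-(N : ℤ)) N, by simp, fun n hn z hz => ?_⟩
  have him := abs_le.1 ((Complex.abs_im_le_norm z).trans hz.le)
  have h3 : (z + n * τ).im = z.im + n * τ.im := by simp
  have hπ := Real.pi_gt_three
  rw [Finset.mem_Icc, not_and_or, not_le, not_le] at hn
  rcases hn with h | h
  · have h1 : (n : ℝ) ≤ -N := by exact_mod_cast h.le
    have h2 : 2 ≤ ‖Complex.exp (2 * Real.pi * Complex.I * (z + n * τ))‖ := by
      rw [norm_exp_two_pi_I_mul, h3]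
      have : 1 ≤ -(2 * Real.pi * (z.im + n * τ.im)) := by
        have : 1 ≤ -(z.im + n * τ.im) := by nlinarith
        nlinarith
      linarith [Real.add_one_le_exp (-(2 * Real.pi * (z.im + n * τ.im)))]
    have h4 := norm_sub_norm_le (Complex.exp (2 * Real.pi * Complex.I * (z + n * τ))) 1
    rw [norm_one, norm_sub_rev] at h4
    linarith
  · have h1 : (N : ℝ) ≤ n := by exact_mod_cast h.le
    have h2 : ‖Complex.exp (2 * Real.pi * Complex.I * (z + n * τ))‖ ≤ 1 / 2 := by
      rw [norm_exp_two_pi_I_mul, h3, Real.exp_neg, one_div]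
      apply inv_anti₀ two_pos
      have : 1 ≤ 2 * Real.pi * (z.im + n * τ.im) := by
        have : 1 ≤ z.im + n * τ.im := by nlinarith
        nlinarith
      linarith [Real.add_one_le_exp (2 * Real.pi * (z.im + n * τ.im))]
    have h4 := norm_sub_norm_le 1 (Complex.exp (2 * Real.pi * Complex.I * (z + n * τ)))
    rw [norm_one] at h4
    linarith

lemma norm_appellTerm_le {z : ℂ} {n : ℤ}
    (h : 1 / 2 ≤ ‖1 - Complex.exp (2 * Real.pi * Complex.I * (z + n * τ))‖) :
    ‖appellTerm τ z n‖ ≤ 2 * ‖Complex.exp (Real.pi * Complex.I * (n * (3 * n + 1)) * τ)‖ := by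
  rw [appellTerm, norm_div, norm_mul, norm_zpow, norm_neg, norm_one, one_zpow, one_mul, div_le_iff₀
    (by linarith)]
  nlinarith [norm_nonneg (Complex.exp (Real.pi * Complex.I * (n * (3 * n + 1)) * τ))]

/-- Near any point all but finitely many denominators are bounded below, so the tail is analytic and
every possible pole sits in a finite sum. The index `0` is kept in that sum because it carries the
pole at the origin. -/
lemma exists_appell_decomposition (hτ : 0 < τ.im) (z₀ : ℂ) : ∃ (F : Finset ℤ) (g : ℂ → ℂ),
    0 ∈ F ∧ AnalyticAt ℂ g z₀ ∧ ∀ᶠ z in 𝓝 z₀, HasSum (appellTerm τ z) (∑ n ∈ F, appellTerm τ z n + g z) := by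
  obtain ⟨F, h0F, hF⟩ := exists_finset_half_le hτ (‖z₀‖ + 1)
  have hB : ∀ z ∈ Metric.ball z₀ 1, ‖z‖ < ‖z₀‖ + 1 := fun z hz => by
    rw [Metric.mem_ball, dist_eq_norm] at hz
    have := norm_add_le (z - z₀) z₀
    rw [sub_add_cancel] at this
    linarith
  set f : ℤ → ℂ → ℂ := fun n z => if n ∈ F then 0 else appellTerm τ z n with hf
  have hfb : ∀ n, ∀ z ∈ Metric.ball z₀ 1, ‖f n z‖
      ≤ 2 * ‖Complex.exp (Real.pi * Complex.I * (n * (3 * n + 1)) * τ)‖ := by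
    intro n z hz
    simp only [hf]
    split_ifs with h
    · rw [norm_zero]; positivity
    · exact norm_appellTerm_le (hF n h z (hB z hz))
  have hdiff : ∀ n, DifferentiableOn ℂ (f n) (Metric.ball z₀ 1) := by
    intro n z hz
    simp only [hf]
    split_ifs with h
    · exact differentiableWithinAt_const 0
    · apply DifferentiableAt.differentiableWithinAt
      unfold appellTerm
      refine DifferentiableAt.div (by fun_prop) (by fun_prop) fun h0 => ?_
      have := hF n h z (hB z hz)
      rw [h0, norm_zero] at this
      norm_num at this
  have hsum := (summable_norm_appellNum hτ).mul_left 2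
  have hg := Complex.differentiableOn_tsum_of_summable_norm hsum hdiff Metric.isOpen_ball hfb
  refine ⟨F, fun z => ∑' n, f n z, h0F, hg.analyticAt (Metric.ball_mem_nhds z₀ one_pos), ?_⟩
  filter_upwards [Metric.ball_mem_nhds z₀ one_pos] with z hz
  have h1 : HasSum (fun n => f n z) (∑' n, f n z) :=
    (Summable.of_norm_bounded hsum fun n => hfb n z hz).hasSum
  have h2 : HasSum (fun n => if n ∈ F then appellTerm τ z n else 0) (∑ n ∈ F, appellTerm τ z n) := by
    have : ∑ n ∈ F, appellTerm τ z n = ∑ n ∈ F, if n ∈ F then appellTerm τ z n else 0 :=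
      Finset.sum_congr rfl fun n hn => (if_pos hn).symm
    rw [this]
    exact hasSum_sum_of_ne_finset_zero fun n hn => if_neg hn
  refine (h2.add h1).congr_fun fun n => ?_
  simp only [hf]
  split_ifs <;> simp

lemma summable_appellTerm (hτ : 0 < τ.im) (z : ℂ) : Summable (appellTerm τ z) := by
  obtain ⟨F, g, -, -, h⟩ := exists_appell_decomposition hτ z
  exact h.self_of_nhds.summable

lemma analyticAt_appellTerm {z : ℂ} {n : ℤ}
    (hz : 1 - Complex.exp (2 * Real.pi * Complex.I * (z + n * τ)) ≠ 0) :
    AnalyticAt ℂ (fun z => appellTerm τ z n) z := by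
  unfold appellTerm
  exact AnalyticAt.fun_div (by fun_prop) (by fun_prop) hz

lemma analyticAt_appell (hτ : 0 < τ.im) {z : ℂ} (hz : z ∉ latticeSet τ) :
    AnalyticAt ℂ (appell τ) z := by
  obtain ⟨F, g, -, hg, h⟩ := exists_appell_decomposition hτ z
  have h1 : AnalyticAt ℂ (fun z => ∑' n, appellTerm τ z n) z := by
    refine AnalyticAt.congr (f := fun z => ∑ n ∈ F, appellTerm τ z n + g z) ?_ ?_
    · exact (Finset.analyticAt_fun_sum F fun n _ => analyticAt_appellTerm (one_sub_exp_ne_zero hz n)).fun_add hg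
    · filter_upwards [h] with z hz using hz.tsum_eq.symm
  exact AnalyticAt.fun_mul (by fun_prop) h1

lemma appell_add_one (z : ℂ) : appell τ (z + 1) = -appell τ z := by
  have h1 : ∀ n, appellTerm τ (z + 1) n = appellTerm τ z n := fun n => by
    rw [appellTerm, appellTerm, show 2 * Real.pi * Complex.I * (z + 1 + n * τ)
      = 2 * Real.pi * Complex.I * (z + n * τ) + 2 * Real.pi * Complex.I by ring, Complex.exp_add,
      Complex.exp_two_pi_mul_I, mul_one]
  rw [appell, appell, mul_add, Complex.exp_add, mul_one, Complex.exp_pi_mul_I]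
  simp_rw [h1]
  ring

lemma hasSum_pentagonal (hτ : 0 < τ.im) :
    HasSum (fun m : ℤ => (-1 : ℂ) ^ m * Complex.exp (Real.pi * Complex.I * (3 * m ^ 2 - m) * τ))
      (Complex.exp (-Real.pi * Complex.I * τ / 12) * ModularForm.eta τ) := by
  have h := (hasSum_thetaFive hτ 0).mul_left (-Complex.exp (-Real.pi * Complex.I * τ / 12))
  rw [thetaFive_zero hτ, neg_mul_neg, ← (Equiv.subRight (1 : ℤ)).hasSum_iff] at h
  refine h.congr_fun fun m => ?_
  simp only [Function.comp_apply, Equiv.subRight_apply, thetaExp]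
  rw [zpow_sub_one₀ (by norm_num), mul_left_comm, neg_mul, ← Complex.exp_add]
  have : Real.pi * Complex.I * (3 * m ^ 2 - m) * τ = -Real.pi * Complex.I * τ / 12 +
    (-Real.pi * Complex.I * (6 * ((m - 1 : ℤ) : ℂ) + 5) ^ 2 * -τ / 12
      - Real.pi * Complex.I * (6 * ((m - 1 : ℤ) : ℂ) + 5) * -0) := by push_cast; ring
  rw [this]
  norm_num

/-- The reflection `m ↦ 1 - m` fixes the exponent and reverses the sign, so the sum equals its own
negative. -/
lemma hasSum_pentagonal_three (hτ : 0 < τ.im) :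
    HasSum (fun m : ℤ => (-1 : ℂ) ^ m * Complex.exp (Real.pi * Complex.I * (3 * m ^ 2 - 3 * m) * τ)) 0 := by
  have hs : Summable fun m : ℤ => (-1 : ℂ) ^ m * Complex.exp (Real.pi * Complex.I * (3 * m ^ 2 - 3 * m) * τ) := by
    rw [← summable_norm_iff]
    refine (summable_exp_three hτ (-3)).norm.congr fun m => ?_
    rw [norm_mul, norm_zpow, norm_neg, norm_one, one_zpow, one_mul]
    congr 2
    ring
  have h1 := hs.hasSum
  have h2 := (Equiv.subLeft (1 : ℤ)).hasSum_iff.2 h1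
  have h3 : HasSum (fun m : ℤ => (-1 : ℂ) ^ m * Complex.exp (Real.pi * Complex.I * (3 * m ^ 2 - 3 * m) * τ))
      (-∑' m : ℤ, (-1 : ℂ) ^ m * Complex.exp (Real.pi * Complex.I * (3 * m ^ 2 - 3 * m) * τ)) := by
    refine h2.neg.congr_fun fun m => ?_
    simp only [Function.comp_apply, Equiv.subLeft_apply]
    rw [zpow_sub₀ (by norm_num), zpow_one, div_eq_mul_inv, ← zpow_neg, ← inv_zpow' (-1 : ℂ) m]
    have : Real.pi * Complex.I * (3 * ((1 - m : ℤ) : ℂ) ^ 2 - 3 * ((1 - m : ℤ) : ℂ)) * τ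
      = Real.pi * Complex.I * (3 * m ^ 2 - 3 * m) * τ := by push_cast; ring
    rw [this]
    norm_num
  have h4 := h1.unique h3
  rw [self_eq_neg] at h4
  rwa [h4] at h1

lemma hasSum_pentagonal_five (hτ : 0 < τ.im) :
    HasSum (fun m : ℤ => (-1 : ℂ) ^ m * Complex.exp (Real.pi * Complex.I * (3 * m ^ 2 - 5 * m) * τ))
      (-(Complex.exp (-2 * Real.pi * Complex.I * τ)
        * (Complex.exp (-Real.pi * Complex.I * τ / 12) * ModularForm.eta τ))) := by
  have h := ((Equiv.subLeft (1 : ℤ)).hasSum_iff.2 (hasSum_pentagonal hτ)).mul_left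
    (Complex.exp (-2 * Real.pi * Complex.I * τ))
  refine h.neg.congr_fun fun m => ?_
  simp only [Function.comp_apply, Equiv.subLeft_apply]
  rw [zpow_sub₀ (by norm_num), zpow_one, div_eq_mul_inv, ← zpow_neg, ← inv_zpow' (-1 : ℂ) m,
    mul_left_comm, ← Complex.exp_add]
  have : Real.pi * Complex.I * (3 * m ^ 2 - 5 * m) * τ = -2 * Real.pi * Complex.I * τ
      + Real.pi * Complex.I * (3 * ((1 - m : ℤ) : ℂ) ^ 2 - ((1 - m : ℤ) : ℂ)) * τ := by push_cast; ring
  rw [this]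
  norm_num

/-- After reindexing by `n + 1`, the numerator is multiplied by `X⁻³` up to a common factor, where
`X = ζ q^(n+1)`. From `X⁻³/(1-X) = 1/(1-X) + X⁻¹ + X⁻² + X⁻³` three theta series are left over; the
middle one vanishes and the others are elementary multiples of `η`. -/
lemma appell_add_self (hτ : 0 < τ.im) {z : ℂ} (hz : z ∉ latticeSet τ) :
    appell τ (z + τ) = -ellipticFactor τ z * (appell τ z
      - Complex.exp (-Real.pi * Complex.I * τ / 12) * ModularForm.eta τ
        * (Complex.exp (-Real.pi * Complex.I * z)
          - Complex.exp (-2 * Real.pi * Complex.I * τ - 5 * Real.pi * Complex.I * z))) := by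
  set P := Complex.exp (-Real.pi * Complex.I * τ / 12) * ModularForm.eta τ
  set ζ := Complex.exp (2 * Real.pi * Complex.I * z) with hζ
  have hζ0 : ζ ≠ 0 := Complex.exp_ne_zero _
  have h1 := (summable_appellTerm hτ (z + τ)).hasSum
  have h2 := (((summable_appellTerm hτ z).hasSum.add ((hasSum_pentagonal hτ).mul_left ζ⁻¹)).add
    ((hasSum_pentagonal_three hτ).mul_left (ζ⁻¹ ^ 2))).add
    ((hasSum_pentagonal_five hτ).mul_left (ζ⁻¹ ^ 3))
  have h3 := (Equiv.addRight (1 : ℤ)).hasSum_iff.2 (h2.mul_left (-(Complex.exp (2 * Real.pi * Complex.I * τ) * ζ ^ 3)))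
  have h4 := h1.unique (h3.congr_fun fun n => ?_)
  · rw [appell, appell, h4, ellipticFactor]
    set T := ∑' n, appellTerm τ z n
    have e1 : Complex.exp (3 * Real.pi * Complex.I * τ + 6 * Real.pi * Complex.I * z)
        = Complex.exp (Real.pi * Complex.I * τ) * Complex.exp (2 * Real.pi * Complex.I * τ) * ζ ^ 3 := by
      rw [hζ, ← Complex.exp_nat_mul, ← Complex.exp_add, ← Complex.exp_add]; congr 1; push_cast; ring
    have e2 : Complex.exp (Real.pi * Complex.I * (z + τ))
        = Complex.exp (Real.pi * Complex.I * z) * Complex.exp (Real.pi * Complex.I * τ) := by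
      rw [← Complex.exp_add]; congr 1; ring
    have e3 : Complex.exp (-Real.pi * Complex.I * z) = Complex.exp (Real.pi * Complex.I * z) * ζ⁻¹ := by
      rw [hζ, ← Complex.exp_neg, ← Complex.exp_add]; congr 1; ring
    have e4 : Complex.exp (-2 * Real.pi * Complex.I * τ - 5 * Real.pi * Complex.I * z)
        = Complex.exp (Real.pi * Complex.I * z) * Complex.exp (-2 * Real.pi * Complex.I * τ) * ζ⁻¹ ^ 3 := by
      rw [hζ, ← Complex.exp_neg, ← Complex.exp_nat_mul, ← Complex.exp_add, ← Complex.exp_add]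
      congr 1; push_cast; ring
    rw [e1, e2, e3, e4]
    ring
  · simp only [Function.comp_apply, Equiv.coe_addRight, appellTerm]
    have hd := one_sub_exp_ne_zero hz (n + 1)
    have e0 : Complex.exp (2 * Real.pi * Complex.I * (z + τ + n * τ))
        = Complex.exp (2 * Real.pi * Complex.I * (z + ((n + 1 : ℤ) : ℂ) * τ)) := by
      congr 1; push_cast; ring
    rw [e0]
    set X := Complex.exp (2 * Real.pi * Complex.I * (z + ((n + 1 : ℤ) : ℂ) * τ)) with hX
    have hX0 : X ≠ 0 := Complex.exp_ne_zero _
    set B := Complex.exp (Real.pi * Complex.I * (((n + 1 : ℤ) : ℂ) * (3 * ((n + 1 : ℤ) : ℂ) + 1)) * τ) with hB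
    have f1 : ζ⁻¹ * Complex.exp (Real.pi * Complex.I * (3 * ((n + 1 : ℤ) : ℂ) ^ 2 - ((n + 1 : ℤ) : ℂ)) * τ)
        = B * X⁻¹ := by
      rw [hζ, hB, hX, ← Complex.exp_neg, ← Complex.exp_neg, ← Complex.exp_add, ← Complex.exp_add]
      congr 1; push_cast; ring
    have f2 : ζ⁻¹ ^ 2 * Complex.exp (Real.pi * Complex.I * (3 * ((n + 1 : ℤ) : ℂ) ^ 2 - 3 * ((n + 1 : ℤ) : ℂ)) * τ)
        = B * X⁻¹ ^ 2 := by
      rw [hζ, hB, hX, ← Complex.exp_neg, ← Complex.exp_neg, ← Complex.exp_nat_mul, ← Complex.exp_nat_mul,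
        ← Complex.exp_add, ← Complex.exp_add]
      congr 1; push_cast; ring
    have f3 : ζ⁻¹ ^ 3 * Complex.exp (Real.pi * Complex.I * (3 * ((n + 1 : ℤ) : ℂ) ^ 2 - 5 * ((n + 1 : ℤ) : ℂ)) * τ)
        = B * X⁻¹ ^ 3 := by
      rw [hζ, hB, hX, ← Complex.exp_neg, ← Complex.exp_neg, ← Complex.exp_nat_mul, ← Complex.exp_nat_mul,
        ← Complex.exp_add, ← Complex.exp_add]
      congr 1; push_cast; ring
    have f4 : Complex.exp (Real.pi * Complex.I * (n * (3 * n + 1)) * τ)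
        = Complex.exp (2 * Real.pi * Complex.I * τ) * ζ ^ 3 * (B * X⁻¹ ^ 3) := by
      rw [hζ, hB, hX, ← Complex.exp_neg, ← Complex.exp_nat_mul, ← Complex.exp_nat_mul,
        ← Complex.exp_add, ← Complex.exp_add, ← Complex.exp_add]
      congr 1; push_cast; ring
    rw [mul_left_comm ζ⁻¹, mul_left_comm (ζ⁻¹ ^ 2), mul_left_comm (ζ⁻¹ ^ 3), f1, f2, f3, f4,
      zpow_add_one₀ (by norm_num)]
    field_simp
    ring

end Appell

/-! ### Removable singularities -/

section Removable

variable {f g : ℂ → ℂ} {z₀ : ℂ}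

lemma removableAt_of_analyticAt (h : AnalyticAt ℂ f z₀) : RemovableAt f z₀ := ⟨f, h, EventuallyEq.rfl⟩

lemma RemovableAt.add (hf : RemovableAt f z₀) (hg : RemovableAt g z₀) :
    RemovableAt (fun z => f z + g z) z₀ := by
  obtain ⟨F, hF, h1⟩ := hf
  obtain ⟨G, hG, h2⟩ := hg
  exact ⟨fun z => F z + G z, hF.fun_add hG, h1.fun_add h2⟩

lemma RemovableAt.mul (hf : RemovableAt f z₀) (hg : RemovableAt g z₀) :
    RemovableAt (fun z => f z * g z) z₀ := by
  obtain ⟨F, hF, h1⟩ := hf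
  obtain ⟨G, hG, h2⟩ := hg
  exact ⟨fun z => F z * G z, hF.fun_mul hG, h1.fun_mul h2⟩

lemma RemovableAt.sub (hf : RemovableAt f z₀) (hg : RemovableAt g z₀) :
    RemovableAt (fun z => f z - g z) z₀ := by
  obtain ⟨F, hF, h1⟩ := hf
  obtain ⟨G, hG, h2⟩ := hg
  exact ⟨fun z => F z - G z, hF.fun_sub hG, h1.fun_sub h2⟩

lemma RemovableAt.congr (hf : RemovableAt f z₀) (h : f =ᶠ[𝓝[≠] z₀] g) : RemovableAt g z₀ := by
  obtain ⟨F, hF, h1⟩ := hf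
  exact ⟨F, hF, h.symm.trans h1⟩

lemma analyticAt_dslope (hf : AnalyticAt ℂ f z₀) : AnalyticAt ℂ (dslope f z₀) z₀ := by
  obtain ⟨p, hp⟩ := hf
  exact ⟨_, hp.has_fpower_series_dslope_fslope⟩

lemma removableAt_sub_div (hf : AnalyticAt ℂ f 0) : RemovableAt (fun z => (f z - f 0) / z) 0 := by
  refine ⟨dslope f 0, analyticAt_dslope hf, ?_⟩
  filter_upwards [self_mem_nhdsWithin] with z hz
  rw [dslope_of_ne _ hz, slope_def_field, sub_zero]

/-- The principal part of a quotient with a simple pole at the origin. -/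
lemma removableAt_div_sub (hf : AnalyticAt ℂ f 0) (hg : AnalyticAt ℂ g 0) (hg0 : g 0 = 0)
    (hg' : deriv g 0 ≠ 0) : RemovableAt (fun z => f z / g z - f 0 / deriv g 0 / z) 0 := by
  have h1 : dslope g 0 0 = deriv g 0 := dslope_same g 0
  have h2 : AnalyticAt ℂ (fun z => f z / dslope g 0 z) 0 :=
    hf.fun_div (analyticAt_dslope hg) (by rwa [h1])
  refine (removableAt_sub_div h2).congr ?_
  filter_upwards [self_mem_nhdsWithin] with z hz
  rw [dslope_of_ne _ hz, slope_def_field, sub_zero, hg0, sub_zero, h1, sub_div, div_div,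
    div_mul_cancel₀ _ hz]

end Removable

/-! ### The completed Appell function and its modular behaviour -/

section Completed

variable {τ : ℂ}

lemma int_mul_notMem_latticeSet (hτ : 0 < τ.im) {n : ℤ} (hn : n ≠ 0) :
    1 - Complex.exp (2 * Real.pi * Complex.I * (0 + n * τ)) ≠ 0 := by
  intro h
  obtain ⟨m, hm⟩ := Complex.exp_eq_one_iff.1 (sub_eq_zero.1 h).symm
  have h1 : n * τ = m := by
    apply mul_left_cancel₀ Complex.two_pi_I_ne_zero
    linear_combination hm
  have h2 := congrArg Complex.im h1
  simp [hn, hτ.ne'] at h2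

/-- The principal part of the Appell function at the origin. -/
lemma removableAt_appell (hτ : 0 < τ.im) :
    RemovableAt (fun z => appell τ z - 1 / (2 * Real.pi * Complex.I) / z) 0 := by
  obtain ⟨F, g, h0, hg, h⟩ := exists_appell_decomposition hτ 0
  have h1 : RemovableAt (fun z => -Complex.exp (Real.pi * Complex.I * z) * appellTerm τ z 0
      - 1 / (2 * Real.pi * Complex.I) / z) 0 := by
    have hd : HasDerivAt (fun z : ℂ => 1 - Complex.exp (2 * Real.pi * Complex.I * z))
        (-(2 * Real.pi * Complex.I)) 0 := by
      simpa using ((((hasDerivAt_id (0 : ℂ)).const_mul (2 * Real.pi * Complex.I)).cexp).const_sub 1)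
    have := removableAt_div_sub (f := fun z => -Complex.exp (Real.pi * Complex.I * z))
      (g := fun z : ℂ => 1 - Complex.exp (2 * Real.pi * Complex.I * z)) (by fun_prop) (by fun_prop)
      (by simp) (by rw [hd.deriv]; exact neg_ne_zero.2 Complex.two_pi_I_ne_zero)
    rw [hd.deriv] at this
    refine this.congr (Eventually.of_forall fun z => ?_)
    simp [appellTerm]
    ring
  have h2 : AnalyticAt ℂ (fun z => -Complex.exp (Real.pi * Complex.I * z)
      * (∑ n ∈ F.erase 0, appellTerm τ z n + g z)) 0 := by
    refine AnalyticAt.fun_mul (by fun_prop) (AnalyticAt.fun_add ?_ hg)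
    exact Finset.analyticAt_fun_sum _ fun n hn =>
      analyticAt_appellTerm (int_mul_notMem_latticeSet hτ (Finset.ne_of_mem_erase hn))
  refine (h1.add (removableAt_of_analyticAt h2)).congr ?_
  filter_upwards [h.filter_mono nhdsWithin_le_nhds] with z hz
  rw [appell, hz.tsum_eq, ← Finset.add_sum_erase F _ h0]
  ring

/-- The odd part of `errJac`. -/
noncomputable def oddJac (τ z w : ℂ) : ℂ := (errJac τ z w - errJac τ (-z) (-w)) / 2

lemma differentiable_errJac (hτ : 0 < τ.im) : Differentiable ℂ fun z => errJac τ z 0 :=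
  ((contDiff_errJac hτ).differentiable (by simp)).comp (f := fun z : ℂ => (z, (0 : ℂ))) (by fun_prop)

lemma analyticAt_oddJac (hτ : 0 < τ.im) (z : ℂ) : AnalyticAt ℂ (fun z => oddJac τ z 0) z := by
  have h := differentiable_errJac hτ
  have h1 : Differentiable ℂ fun z => oddJac τ z 0 := by
    simp only [oddJac, neg_zero]
    exact (h.fun_sub (h.comp differentiable_neg)).div_const 2
  exact h1.analyticAt z

/-- The completed Appell function, as a function of two independent variables. -/
noncomputable def appellHat (τ z w : ℂ) : ℂ := appell τ z + ModularForm.eta τ * oddJac τ z w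

lemma appellHat_add_one (hτ : 0 < τ.im) (z w : ℂ) : appellHat τ (z + 1) (w + 1) = -appellHat τ z w := by
  have h := errJac_add_one hτ (-(z + 1)) (-(w + 1))
  rw [show -(z + 1) + 1 = -z by ring, show -(w + 1) + 1 = -w by ring] at h
  rw [appellHat, appellHat, oddJac, oddJac, appell_add_one, errJac_add_one hτ, h]
  ring

/-- The two exponentials in the defect of `appell` are those produced by `errJac` at `(z, w)` and at
`(-z, -w)`, so `η` times the odd part cancels both. -/
lemma appellHat_add_self (hτ : 0 < τ.im) {z : ℂ} (hz : z ∉ latticeSet τ) (w : ℂ) :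
    appellHat τ (z + τ) (w + conj τ) = -ellipticFactor τ z * appellHat τ z w := by
  have e1 : thetaExp 0 τ z = Complex.exp (-Real.pi * Complex.I * τ / 12)
      * Complex.exp (-2 * Real.pi * Complex.I * τ - 5 * Real.pi * Complex.I * z) := by
    rw [thetaExp, ← Complex.exp_add]
    congr 1
    push_cast; ring
  have e2 : Complex.exp (-Real.pi * Complex.I * τ / 12 - Real.pi * Complex.I * z)
      = Complex.exp (-Real.pi * Complex.I * τ / 12) * Complex.exp (-Real.pi * Complex.I * z) := by
    rw [← Complex.exp_add]; congr 1; ring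
  rw [appellHat, appellHat, oddJac, oddJac, appell_add_self hτ hz, errJac_add_self hτ,
    errJac_neg_add_self hτ, e1, e2]
  ring

lemma hasDerivAt_oddJac (hτ : 0 < τ.im) (z w : ℂ) :
    HasDerivAt (fun w => oddJac τ z w) (-(Complex.I / (2 * sqrtIm τ))
      * Complex.exp (-Real.pi * ((z - w) / (2 * Complex.I * sqrtIm τ)) ^ 2)
        * thetaEven (-conj τ) w) w := by
  have h1 := hasDerivAt_errJac hτ z w
  have h2 := (hasDerivAt_errJac hτ (-z) (-w)).scomp w (hasDerivAt_neg w)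
  have h3 := (h1.sub h2).div_const 2
  have e : (-z - -w) / (2 * Complex.I * sqrtIm τ) = -((z - w) / (2 * Complex.I * sqrtIm τ)) := by ring
  rw [e, neg_sq] at h3
  refine h3.congr_deriv ?_
  rw [thetaEven, neg_neg]
  simp only [smul_eq_mul]
  have := sqrtIm_ne_zero hτ
  field_simp
  ring

lemma sqrtIm_inv (hτ : 0 < τ.im) : sqrtIm (-1 / τ) = sqrtIm τ / ‖τ‖ := by
  have h0 : τ ≠ 0 := by rintro rfl; simp at hτ
  have hn : 0 < ‖τ‖ := norm_pos_iff.2 h0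
  have h1 : (-1 / τ).im = τ.im / ‖τ‖ ^ 2 := by
    rw [neg_div, one_div, Complex.neg_im, Complex.inv_im, Complex.normSq_eq_norm_sq]
    ring
  rw [sqrtIm, sqrtIm, h1, ← Complex.ofReal_div]
  congr 1
  rw [div_right_comm, Real.sqrt_div' _ (by positivity), Real.sqrt_sq hn.le]

lemma conj_neg_one_div (τ : ℂ) : conj (-1 / τ) = -1 / conj τ := by simp

/-- The difference of the two sides of the transformation law, for the non-holomorphic part. -/
lemma oddJac_inv_sub_const (hτ : 0 < τ.im) (z w : ℂ) :
    ModularForm.eta (-1 / τ) * Complex.exp (3 * Real.pi * Complex.I * z ^ 2 / τ) / τ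
        * oddJac (-1 / τ) (z / τ) (w / conj τ) - ModularForm.eta τ * oddJac τ z w
      = ModularForm.eta (-1 / τ) * Complex.exp (3 * Real.pi * Complex.I * z ^ 2 / τ) / τ
        * oddJac (-1 / τ) (z / τ) 0 - ModularForm.eta τ * oddJac τ z 0 := by
  have h0 : τ ≠ 0 := by rintro rfl; simp at hτ
  have hc0 : conj τ ≠ 0 := by simpa using h0
  have hn : (‖τ‖ : ℂ) ≠ 0 := by simpa using h0
  have hs := sqrtIm_ne_zero hτ
  have hτ' := neg_one_div_im_pos hτ
  have hI := Complex.I_ne_zero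
  have hcI : conj τ = τ - 12 * sqrtIm τ ^ 2 * Complex.I := by
    have h := Complex.sub_conj τ
    push_cast at h
    rw [sqrtIm_sq hτ]
    linear_combination -h
  have hnn : (‖τ‖ : ℂ) ^ 2 = τ * conj τ := by
    rw [Complex.mul_conj, Complex.normSq_eq_norm_sq]; push_cast; rfl
  -- Differentiation in `w` leaves on each side a Gaussian times `thetaEven`, evaluated at points
  -- related by inversion; by `thetaEven_inv` and `eta_inv` the two contributions cancel.
  have hd : ∀ w, HasDerivAt (fun w => ModularForm.eta (-1 / τ)
      * Complex.exp (3 * Real.pi * Complex.I * z ^ 2 / τ) / τ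
        * oddJac (-1 / τ) (z / τ) (w / conj τ) - ModularForm.eta τ * oddJac τ z w) 0 w := by
    intro w
    have h1 := ((hasDerivAt_oddJac hτ' (z / τ) (w / conj τ)).scomp w
      ((hasDerivAt_id w).div_const (conj τ))).const_mul (ModularForm.eta (-1 / τ)
        * Complex.exp (3 * Real.pi * Complex.I * z ^ 2 / τ) / τ)
    have h2 := (hasDerivAt_oddJac hτ z w).const_mul (ModularForm.eta τ)
    refine (h1.sub h2).congr_deriv ?_
    have e1 : thetaEven (-conj (-1 / τ)) (w / conj τ) = invFactor (-conj τ)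
        * Complex.exp (3 * Real.pi * Complex.I * w ^ 2 / -conj τ) * thetaEven (-conj τ) w := by
      rw [← thetaEven_inv (by rwa [neg_conj_im]), conj_neg_one_div, ← thetaEven_neg]
      congr 1
      · rw [neg_div, neg_div_neg_eq]; ring
      · rw [div_neg]
    have e2 : Complex.exp (3 * Real.pi * Complex.I * z ^ 2 / τ)
        * (Complex.exp (-Real.pi * ((z / τ - w / conj τ) / (2 * Complex.I * sqrtIm (-1 / τ))) ^ 2)
          * Complex.exp (3 * Real.pi * Complex.I * w ^ 2 / -conj τ))
        = Complex.exp (-Real.pi * ((z - w) / (2 * Complex.I * sqrtIm τ)) ^ 2) := by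
      rw [← Complex.exp_add, ← Complex.exp_add, sqrtIm_inv hτ]
      congr 1
      have : (z / τ - w / conj τ) / (2 * Complex.I * (sqrtIm τ / ‖τ‖))
        = ‖τ‖ * (z / τ - w / conj τ) / (2 * Complex.I * sqrtIm τ) := by
        field_simp
      rw [this, div_pow, mul_pow, hnn, div_pow, mul_pow, mul_pow, Complex.I_sq]
      field_simp
      rw [hcI]
      ring
    have key : invFactor τ * invFactor (-conj τ) * ‖τ‖ / (τ * conj τ) = 1 := by
      rw [invFactor_mul_neg_conj hτ, ← pow_two, hnn, div_self (mul_ne_zero h0 hc0)]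
    have e4 : Complex.I / (2 * (sqrtIm τ / ‖τ‖)) = Complex.I * ‖τ‖ / (2 * sqrtIm τ) := by field_simp
    rw [e1, eta_inv hτ, smul_eq_mul, ← e2, sqrtIm_inv hτ, e4]
    linear_combination (-Complex.I / (2 * sqrtIm τ) * ModularForm.eta τ
      * Complex.exp (3 * Real.pi * Complex.I * z ^ 2 / τ)
      * Complex.exp (-Real.pi * ((z / τ - w / conj τ) / (2 * Complex.I * (sqrtIm τ / ‖τ‖))) ^ 2)
      * Complex.exp (3 * Real.pi * Complex.I * w ^ 2 / -conj τ) * thetaEven (-conj τ) w) * key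
  have h := is_const_of_deriv_eq_zero (fun w => (hd w).differentiableAt) (fun w => (hd w).deriv) w 0
  simpa using h

lemma div_mem_latticeSet_inv {z : ℂ} (h0 : τ ≠ 0) : z / τ ∈ latticeSet (-1 / τ) ↔ z ∈ latticeSet τ := by
  constructor
  · rintro ⟨m, n, h⟩
    refine ⟨-n, m, ?_⟩
    field_simp at h
    push_cast
    linear_combination h
  · rintro ⟨m, n, h⟩
    refine ⟨n, -m, ?_⟩
    rw [h]
    field_simp
    push_cast
    ring

/-- The transformation law of the completed Appell function under inversion. -/
theorem appellHat_inv (hτ : 0 < τ.im) {z : ℂ} (hz : z ∉ latticeSet τ) :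
    Complex.exp (3 * Real.pi * Complex.I * z ^ 2 / τ) / τ * appellHat (-1 / τ) (z / τ) 0
      = appellHat τ z 0 := by
  have h0 : τ ≠ 0 := by rintro rfl; simp at hτ
  have hc0 : conj τ ≠ 0 := by simpa using h0
  have hτ' := neg_one_div_im_pos hτ
  have hlat : ∀ z, z ∉ latticeSet τ → z / τ ∉ latticeSet (-1 / τ) := fun z hz => by
    rwa [div_mem_latticeSet_inv h0]
  set d : ℂ → ℂ := fun z => Complex.exp (3 * Real.pi * Complex.I * z ^ 2 / τ) / τ
    * appellHat (-1 / τ) (z / τ) 0 - appellHat τ z 0 with hd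
  -- Being independent of `w`, the defect may be evaluated at any convenient `w`. This lets the
  -- two-variable translations `(1, 1)` and `(τ, conj τ)` act on a function of `z` alone.
  have hdw : ∀ z w, d z = Complex.exp (3 * Real.pi * Complex.I * z ^ 2 / τ) / τ
    * appellHat (-1 / τ) (z / τ) (w / conj τ) - appellHat τ z w := by
    intro z w
    have := oddJac_inv_sub_const hτ z w
    simp only [hd, appellHat]
    linear_combination -this
  suffices h : d z = 0 from sub_eq_zero.1 h
  refine eq_zero_of_elliptic_of_removable hτ ?_ ?_ ?_ ?_ hz
  · intro z hz
    have h1 : AnalyticAt ℂ (fun z => appell (-1 / τ) (z / τ)) z :=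
      AnalyticAt.fun_comp (g := appell (-1 / τ)) (analyticAt_appell hτ' (hlat z hz)) (by fun_prop)
    have h2 : AnalyticAt ℂ (fun z => oddJac (-1 / τ) (z / τ) 0) z :=
      AnalyticAt.fun_comp (g := fun z => oddJac (-1 / τ) z 0) (analyticAt_oddJac hτ' _) (by fun_prop)
    have h3 := analyticAt_appell hτ hz
    have h4 := analyticAt_oddJac hτ z
    simp only [hd, appellHat]
    fun_prop (disch := exact h0)
  -- The factor `1/τ` compensates the argument `z/τ`, so both principal parts are `1/(2πiz)`; what
  -- is left of them is the removable quotient `(exp(3πiz²/τ) - 1)/z`.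
  · have h1 := removableAt_appell hτ
    obtain ⟨g, hg, hgf⟩ := removableAt_appell hτ'
    have ht : Tendsto (fun z : ℂ => z / τ) (𝓝[≠] 0) (𝓝[≠] 0) := by
      apply tendsto_nhdsWithin_of_tendsto_nhds_of_eventually_within
      · have : Continuous fun z : ℂ => z / τ := by fun_prop
        exact (this.tendsto' _ _ (zero_div τ)).mono_left nhdsWithin_le_nhds
      · filter_upwards [self_mem_nhdsWithin] with z hz
        exact div_ne_zero hz h0
    have h2 : AnalyticAt ℂ (fun z => Complex.exp (3 * Real.pi * Complex.I * z ^ 2 / τ) / τ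
        * (g (z / τ) + ModularForm.eta (-1 / τ) * oddJac (-1 / τ) (z / τ) 0)
        - ModularForm.eta τ * oddJac τ z 0) 0 := by
      have h3 : AnalyticAt ℂ (fun z => g (z / τ)) 0 :=
        AnalyticAt.fun_comp (g := g) (by rwa [zero_div]) (by fun_prop)
      have h4 : AnalyticAt ℂ (fun z => oddJac (-1 / τ) (z / τ) 0) 0 :=
        AnalyticAt.fun_comp (g := fun z => oddJac (-1 / τ) z 0) (analyticAt_oddJac hτ' _) (by fun_prop)
      have h5 : AnalyticAt ℂ (fun z => Complex.exp (3 * Real.pi * Complex.I * z ^ 2 / τ) / τ) 0 := by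
        fun_prop (disch := exact h0)
      exact (h5.fun_mul (h3.fun_add (analyticAt_const.fun_mul h4))).fun_sub
        (analyticAt_const.fun_mul (analyticAt_oddJac hτ 0))
    have h3 : RemovableAt (fun z => 1 / (2 * Real.pi * Complex.I)
        * ((Complex.exp (3 * Real.pi * Complex.I * z ^ 2 / τ)
          - Complex.exp (3 * Real.pi * Complex.I * 0 ^ 2 / τ)) / z)) 0 :=
      (removableAt_of_analyticAt (f := fun _ => 1 / (2 * Real.pi * Complex.I)) analyticAt_const).mul
        (removableAt_sub_div (f := fun z => Complex.exp (3 * Real.pi * Complex.I * z ^ 2 / τ))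
          (by fun_prop (disch := exact h0)))
    refine (((removableAt_of_analyticAt h2).add h3).sub h1).congr ?_
    filter_upwards [ht.eventually hgf, self_mem_nhdsWithin] with z hz hz0
    have hz0' : z ≠ 0 := hz0
    simp only [hd, appellHat]
    rw [← hz]
    have := Complex.I_ne_zero
    have := Complex.ofReal_ne_zero.2 Real.pi_ne_zero
    have e : Complex.exp (3 * Real.pi * Complex.I * 0 ^ 2 / τ) = 1 := by simp
    rw [e]
    field_simp
    ring
  · intro z hz
    have hz1 : z + 1 ∉ latticeSet τ := by rwa [add_one_mem_latticeSet]
    -- The period `-1/τ` moves `(z + 1)/τ` back to `z/τ`, and the second coordinate `1 / conj τ` is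
    -- chosen to land at `0`.
    have h1 := appellHat_add_self hτ' (hlat _ hz1) (1 / conj τ)
    have e1 : (z + 1) / τ + -1 / τ = z / τ := by ring
    have e2 : 1 / conj τ + conj (-1 / τ) = 0 := by rw [conj_neg_one_div]; ring
    rw [e1, e2] at h1
    have h2 := appellHat_add_one hτ z 0
    rw [zero_add] at h2
    have e3 : Complex.exp (3 * Real.pi * Complex.I * (z + 1) ^ 2 / τ)
        = Complex.exp (3 * Real.pi * Complex.I * z ^ 2 / τ) * ellipticFactor (-1 / τ) ((z + 1) / τ) := by
      rw [ellipticFactor, ← Complex.exp_add]; congr 1; field_simp; ring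
    rw [hdw (z + 1) 1, h2, e3]
    simp only [hd]
    rw [h1]
    ring
  · intro z hz
    have h1 := appellHat_add_one hτ' (z / τ) 0
    rw [zero_add] at h1
    have h2 := appellHat_add_self hτ hz 0
    rw [zero_add] at h2
    have e1 : (z + τ) / τ = z / τ + 1 := by field_simp
    have e3 : Complex.exp (3 * Real.pi * Complex.I * (z + τ) ^ 2 / τ)
        = Complex.exp (3 * Real.pi * Complex.I * z ^ 2 / τ) * ellipticFactor τ z := by
      rw [ellipticFactor, ← Complex.exp_add]; congr 1; field_simp; ring
    rw [hdw (z + τ) (conj τ), h2, e3, e1, div_self hc0, h1]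
    simp only [hd]
    ring

lemma appell_vadd_one (z : ℂ) : appell (τ + 1) z = appell τ z := by
  rw [appell, appell]
  congr 2
  funext n
  rw [appellTerm, appellTerm]
  have h1 : Complex.exp (2 * Real.pi * Complex.I * (z + n * (τ + 1)))
      = Complex.exp (2 * Real.pi * Complex.I * (z + n * τ)) := by
    rw [Complex.exp_eq_exp_iff_exists_int]
    exact ⟨n, by ring⟩
  have h2 : Complex.exp (Real.pi * Complex.I * (n * (3 * n + 1)) * (τ + 1))
      = Complex.exp (Real.pi * Complex.I * (n * (3 * n + 1)) * τ) := by
    rw [Complex.exp_eq_exp_iff_exists_int]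
    obtain ⟨m, hm⟩ : ∃ m : ℤ, n * (3 * n + 1) = 2 * m := by
      rcases Int.even_or_odd' n with ⟨m, rfl | rfl⟩
      · exact ⟨m * (6 * m + 1), by ring⟩
      · exact ⟨(2 * m + 1) * (3 * m + 2), by ring⟩
    have hm' : (n : ℂ) * (3 * n + 1) = 2 * m := by exact_mod_cast hm
    exact ⟨m, by linear_combination (Real.pi * Complex.I) * hm'⟩
  rw [h1, h2]

theorem appellHat_vadd_one (hτ : 0 < τ.im) (z w : ℂ) : appellHat (τ + 1) z w = appellHat τ z w := by
  have h : Complex.exp (Real.pi * Complex.I / 12) * Complex.exp (-Real.pi * Complex.I / 12) = 1 := by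
    rw [← Complex.exp_add, Complex.exp_eq_one_iff]; exact ⟨0, by push_cast; ring⟩
  rw [appellHat, appellHat, oddJac, oddJac, appell_vadd_one, eta_vadd_one hτ, errJac_vadd_one hτ,
    errJac_vadd_one hτ]
  linear_combination (ModularForm.eta τ * (errJac τ z w - errJac τ (-z) (-w)) / 2) * h

end Completed

/-! ### The Appell function and the rank generating function -/

section AppellRank

variable {τ : ℂ}

/-- The index `0` gives `1/(1-ζ)`, and the positive indices give the first sum of `rankGF_eq`. The
negative ones, after clearing negative powers of `q`, give `ζ⁻¹` times the second. -/
lemma partGen_mul_appell (hτ : 0 < τ.im) {z : ℂ}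
    (hz : z ∉ latticeSet τ) {ρ : ℝ} (h1 : ‖Complex.exp (2 * Real.pi * Complex.I * z)‖ ≤ ρ)
    (h2 : ‖(Complex.exp (2 * Real.pi * Complex.I * z))⁻¹‖ ≤ ρ) (hρ : 1 ≤ ρ)
    (hq : ρ * ‖Complex.exp (2 * Real.pi * Complex.I * τ)‖ < 1) :
    partGen (Complex.exp (2 * Real.pi * Complex.I * τ)) * appell τ z
      = -Complex.exp (Real.pi * Complex.I * z) / (1 - Complex.exp (2 * Real.pi * Complex.I * z))
        * rankGF (Complex.exp (2 * Real.pi * Complex.I * z)) (Complex.exp (2 * Real.pi * Complex.I * τ)) := by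
  rw [rankGF_eq h1 h2 hρ hq, appell]
  have hs := summable_appellTerm hτ z
  have hd := one_sub_exp_ne_zero hz
  set ζ := Complex.exp (2 * Real.pi * Complex.I * z) with hζ
  set q := Complex.exp (2 * Real.pi * Complex.I * τ) with hqd
  have hζ0 : ζ ≠ 0 := Complex.exp_ne_zero _
  have hq0 : q ≠ 0 := Complex.exp_ne_zero _
  have hpow : ∀ n : ℕ, q ^ n = Complex.exp (2 * Real.pi * Complex.I * n * τ) := fun n => by
    rw [hqd, ← Complex.exp_nat_mul]; congr 1; ring
  have hpent : ∀ j : ℕ, 2 * (pent j : ℂ) = (j + 1) * (3 * j + 2) := fun j => by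
    exact_mod_cast two_mul_pent j
  have t1 : ∀ j : ℕ, appellTerm τ z ((j + 1 : ℕ) : ℤ)
      = -((-1) ^ j * q ^ (pent j + (j + 1)) * (1 - ζ * q ^ (j + 1))⁻¹) := by
    intro j
    rw [appellTerm, zpow_natCast, hpow, hpow, hζ, ← Complex.exp_add, div_eq_mul_inv, pow_succ]
    have e1 : Real.pi * Complex.I * ((((j + 1 : ℕ) : ℤ) : ℂ) * (3 * (((j + 1 : ℕ) : ℤ) : ℂ) + 1)) * τ
        = 2 * Real.pi * Complex.I * ((pent j + (j + 1) : ℕ) : ℂ) * τ := by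
      push_cast
      linear_combination (-Real.pi * Complex.I * τ) * hpent j
    have e2 : 2 * Real.pi * Complex.I * (z + (((j + 1 : ℕ) : ℤ) : ℂ) * τ)
        = 2 * Real.pi * Complex.I * z + 2 * Real.pi * Complex.I * ((j + 1 : ℕ) : ℂ) * τ := by
      push_cast; ring
    rw [e1, e2]
    ring
  have t2 : ∀ j : ℕ, appellTerm τ z (-((j : ℤ) + 1))
      = ζ⁻¹ * ((-1) ^ j * q ^ (pent j + (j + 1)) * (1 - ζ⁻¹ * q ^ (j + 1))⁻¹) := by
    intro j
    have h3 := hd (-((j : ℤ) + 1))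
    have e0 : (-1 : ℂ) ^ (-((j : ℤ) + 1)) = -(-1) ^ j := by
      rw [zpow_neg, ← inv_zpow, show (-1 : ℂ)⁻¹ = -1 by norm_num, ← Nat.cast_succ, zpow_natCast, pow_succ]
      ring
    have e1 : Complex.exp (Real.pi * Complex.I * (((-((j : ℤ) + 1) : ℤ) : ℂ) * (3 * ((-((j : ℤ) + 1) : ℤ) : ℂ) + 1)) * τ)
        = q ^ pent j := by
      rw [hpow]
      congr 1
      push_cast
      linear_combination (-Real.pi * Complex.I * τ) * hpent j
    have e2 : Complex.exp (2 * Real.pi * Complex.I * (z + ((-((j : ℤ) + 1) : ℤ) : ℂ) * τ)) = ζ * (q ^ (j + 1))⁻¹ := by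
      rw [hpow, hζ, ← Complex.exp_neg, ← Complex.exp_add]
      congr 1
      push_cast; ring
    rw [appellTerm, e0, e1, e2]
    rw [e2] at h3
    have hq1 : q ^ (j + 1) ≠ 0 := pow_ne_zero _ hq0
    have h6 : ζ * (q ^ (j + 1))⁻¹ ≠ 1 := fun h => h3 (by rw [h, sub_self])
    rw [pow_add q (pent j)]
    generalize q ^ (j + 1) = Q at *
    have h7 : Q - ζ ≠ 0 := fun h => h6 (by rw [sub_eq_zero.1 h, mul_inv_cancel₀ hζ0])
    have h8 : ζ - Q ≠ 0 := fun h => h7 (by linear_combination -h)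
    have h9 : (1 : ℂ) - ζ * Q⁻¹ = (Q - ζ) / Q := by field_simp
    have h10 : (1 : ℂ) - ζ⁻¹ * Q = (ζ - Q) / ζ := by field_simp
    rw [h9, h10]
    field_simp
    ring
  have hT : ∑' n : ℤ, appellTerm τ z n = 1 / (1 - ζ)
      - ∑' j : ℕ, (-1) ^ j * q ^ (pent j + (j + 1)) * (1 - ζ * q ^ (j + 1))⁻¹
      + ζ⁻¹ * ∑' j : ℕ, (-1) ^ j * q ^ (pent j + (j + 1)) * (1 - ζ⁻¹ * q ^ (j + 1))⁻¹ := by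
    have s1 : Summable fun n : ℕ => appellTerm τ z n := hs.comp_injective Nat.cast_injective
    have s2 : Summable fun n : ℕ => appellTerm τ z (-((n : ℤ) + 1)) :=
      hs.comp_injective (i := fun n : ℕ => -((n : ℤ) + 1)) fun a b h => by
        simp only at h; lia
    rw [tsum_of_nat_of_neg_add_one s1 s2, s1.tsum_eq_zero_add, tsum_congr t1, tsum_congr t2, tsum_neg,
      tsum_mul_left]
    have : appellTerm τ z ((0 : ℕ) : ℤ) = 1 / (1 - ζ) := by simp [appellTerm, hζ]
    rw [this]
    ring
  have h0 : 1 - ζ ≠ 0 := by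
    have := hd 0
    rwa [Int.cast_zero, zero_mul, add_zero] at this
  rw [hT]
  field_simp
  ring

end AppellRank

/-! ### Taylor expansions of the building blocks -/

namespace EvenExpansion

variable {f : ℂ → ℂ}

lemma of_hasSum {a : ℕ → ℂ} (h : ∀ᶠ z in 𝓝 0, HasSum (fun k => a k * z ^ k) (f z))
    (hodd : ∀ n, a (2 * n + 1) = 0) : EvenExpansion f (PowerSeries.mk fun n => a (2 * n)) := by
  apply Filter.Eventually.filter_mono nhdsWithin_le_nhds
  filter_upwards [h] with z hz
  have hinj : Function.Injective fun n : ℕ => 2 * n := fun a b h => by simpa using h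
  rw [← hinj.hasSum_iff] at hz
  · exact hz.congr_fun fun n => by rw [PowerSeries.coeff_mk, Function.comp_apply]
  · intro n hn
    obtain ⟨k, rfl⟩ : ∃ k, n = 2 * k + 1 := by
      rcases Nat.even_or_odd' n with ⟨k, rfl | rfl⟩
      · exact absurd ⟨k, rfl⟩ hn
      · exact ⟨k, rfl⟩
    rw [hodd, zero_mul]

lemma comp_sq (hf : AnalyticAt ℂ f 0) : EvenExpansion (fun z => f (z ^ 2))
    (PowerSeries.mk fun n => iteratedDeriv n f 0 / n.factorial) := by
  have h := hf.hasFPowerSeriesAt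
  rw [hasFPowerSeriesAt_iff] at h
  have ht : Tendsto (fun z : ℂ => z ^ 2) (𝓝[≠] 0) (𝓝 0) := by
    have : Continuous fun z : ℂ => z ^ 2 := by fun_prop
    exact (this.tendsto' 0 0 (by simp)).mono_left nhdsWithin_le_nhds
  filter_upwards [ht.eventually h] with z hz
  simp only [FormalMultilinearSeries.coeff_ofScalars, smul_eq_mul, zero_add] at hz
  refine hz.congr_fun fun n => ?_
  rw [PowerSeries.coeff_mk, pow_mul, mul_comm]

lemma X : EvenExpansion (fun z => z ^ 2) PowerSeries.X := by
  refine Eventually.of_forall fun z => ?_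
  have := hasSum_single (f := fun n => PowerSeries.coeff n (PowerSeries.X : PowerSeries ℂ) * z ^ (2 * n)) 1
    fun n hn => by rw [PowerSeries.coeff_X, if_neg hn, zero_mul]
  simpa using this

lemma one : EvenExpansion (fun _ => 1) 1 := by
  refine Eventually.of_forall fun z => ?_
  have := hasSum_single (f := fun n => PowerSeries.coeff n (1 : PowerSeries ℂ) * z ^ (2 * n)) 0
    fun n hn => by rw [PowerSeries.coeff_one, if_neg hn, zero_mul]
  simpa using this

/-- The expansion of `z` times the odd part of an analytic function. -/
lemma mul_odd_part (hf : AnalyticAt ℂ f 0) : EvenExpansion (fun z => z * ((f z - f (-z)) / 2))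
    (PowerSeries.mk fun n => if n = 0 then 0 else iteratedDeriv (2 * n - 1) f 0 / (2 * n - 1).factorial) := by
  have h := hf.hasFPowerSeriesAt
  rw [hasFPowerSeriesAt_iff] at h
  have ht : Tendsto (fun z : ℂ => -z) (𝓝 0) (𝓝 0) := by
    have : Continuous fun z : ℂ => -z := by fun_prop
    exact this.tendsto' 0 0 (by simp)
  have hodd : ∀ᶠ z in 𝓝 0, HasSum (fun k => (if k % 2 = 0 ∧ k ≠ 0 then
      iteratedDeriv (k - 1) f 0 / (k - 1).factorial else 0) * z ^ k) (z * ((f z - f (-z)) / 2)) := by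
    filter_upwards [h, ht.eventually h] with z h1 h2
    simp only [FormalMultilinearSeries.coeff_ofScalars, smul_eq_mul, zero_add] at h1 h2
    rw [← hasSum_nat_add_iff' 1]
    simp only [Finset.sum_range_one, ne_eq, not_true_eq_false, and_false, if_false, zero_mul, sub_zero]
    refine (((h1.sub h2).div_const 2).mul_left z).congr_fun fun k => ?_
    rw [Nat.add_sub_cancel]
    rcases Nat.even_or_odd k with hk | hk
    · have : (k + 1) % 2 ≠ 0 := by have := Nat.even_iff.1 hk; lia
      rw [if_neg (fun h => this h.1), hk.neg_pow]
      ring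
    · have : (k + 1) % 2 = 0 := by have := Nat.odd_iff.1 hk; lia
      rw [if_pos ⟨this, by lia⟩, hk.neg_pow]
      ring
  have := of_hasSum hodd fun n => if_neg (by lia)
  refine cast ?_ this
  congr 1
  ext n
  simp [Nat.mul_mod_right]

end EvenExpansion

/-- The function `y / (exp (y/2) - exp (-y/2))`, without its singularity at the origin. -/
noncomputable def bernoulliFun (y : ℂ) : ℂ := Complex.exp (y / 2) / dslope Complex.exp 0 y

lemma bernoulliFun_of_ne {y : ℂ} (hy : y ≠ 0) :
    bernoulliFun y = y * Complex.exp (y / 2) / (Complex.exp y - 1) := by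
  rw [bernoulliFun, dslope_of_ne _ hy, slope_def_field, Complex.exp_zero, sub_zero]
  field_simp

lemma analyticAt_bernoulliFun : AnalyticAt ℂ bernoulliFun 0 := by
  refine AnalyticAt.fun_div (by fun_prop) (analyticAt_dslope (by fun_prop)) ?_
  rw [dslope_same]; simp

lemma bernoulliFun_neg (y : ℂ) : bernoulliFun (-y) = bernoulliFun y := by
  by_cases hy : y = 0
  · rw [hy, neg_zero]
  rw [bernoulliFun_of_ne hy, bernoulliFun_of_ne (neg_ne_zero.2 hy)]
  have h1 : Complex.exp (-y) - 1 = -(Complex.exp (-y) * (Complex.exp y - 1)) := by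
    rw [mul_sub, ← Complex.exp_add]; simp
  have h2 : Complex.exp (-y / 2) = Complex.exp (-y) * Complex.exp (y / 2) := by
    rw [← Complex.exp_add]; congr 1; ring
  rw [h1, h2, neg_mul, neg_div_neg_eq, mul_left_comm, mul_div_mul_left _ _ (Complex.exp_ne_zero _)]

/-- The relation `f(y) (exp y - 1) = y exp(y/2)` is the Bernoulli generating function at `1/2`.
Substituting `y = z²` makes all coefficients accessible to the uniqueness of even expansions, and
`exp y - 1` is cancelled among formal power series. -/
lemma iteratedDeriv_bernoulliFun (n : ℕ) : iteratedDeriv n bernoulliFun 0 / n.factorial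
    = (((Polynomial.bernoulli n).eval (1 / 2 : ℚ) : ℚ) : ℂ) / n.factorial := by
  have hexp : ∀ c : ℂ, EvenExpansion (fun z => Complex.exp (c * z ^ 2))
      (PowerSeries.rescale c (PowerSeries.exp ℂ)) := fun c => by
    have := EvenExpansion.exp_mul_sq c
    refine cast ?_ this
    congr 1
    ext n
    rw [PowerSeries.coeff_mk, PowerSeries.coeff_rescale, PowerSeries.coeff_exp]
    simp [div_eq_mul_inv]
  have h1 := EvenExpansion.comp_sq analyticAt_bernoulliFun
  have h2 := (hexp 1).add (EvenExpansion.one.const_mul (-1))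
  have h3 := EvenExpansion.X.mul (hexp (1 / 2))
  rw [PowerSeries.rescale_one] at h2
  have h4 : EvenExpansion (fun z => z ^ 2 * Complex.exp (1 / 2 * z ^ 2)) _ := (h1.mul h2).congr (by
    have hne : ∀ᶠ y : ℂ in 𝓝[≠] 0, Complex.exp y - 1 ≠ 0 := by
      have hd : HasDerivAt (fun y => Complex.exp y - 1) 1 0 := by
        simpa using (Complex.hasDerivAt_exp 0).sub_const 1
      simpa using hd.eventually_ne one_ne_zero (c := 0)
    have ht : Tendsto (fun z : ℂ => z ^ 2) (𝓝[≠] 0) (𝓝[≠] 0) := by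
      apply tendsto_nhdsWithin_of_tendsto_nhds_of_eventually_within
      · have : Continuous fun z : ℂ => z ^ 2 := by fun_prop
        exact (this.tendsto' 0 0 (by simp)).mono_left nhdsWithin_le_nhds
      · filter_upwards [self_mem_nhdsWithin] with z hz using pow_ne_zero 2 hz
    filter_upwards [self_mem_nhdsWithin, ht.eventually hne] with z hz h
    rw [bernoulliFun_of_ne (pow_ne_zero 2 hz), one_mul, mul_one, ← sub_eq_add_neg,
      div_mul_cancel₀ _ h]
    congr 2
    ring)
  have h5 := h4.unique h3
  rw [← Polynomial.bernoulli_generating_function (1 / 2 : ℂ)] at h5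
  have h6 : (RingHom.id (PowerSeries ℂ)) (PowerSeries.exp ℂ) + PowerSeries.C (-1) * 1
      = PowerSeries.exp ℂ - 1 := by simp [sub_eq_add_neg]
  rw [h6] at h5
  have h7 : PowerSeries.exp ℂ - 1 ≠ 0 := by
    intro h
    have := congrArg (PowerSeries.coeff 1) h
    simp [PowerSeries.coeff_one] at this
  have h8 := congrArg (PowerSeries.coeff n) (mul_right_cancel₀ h7 h5)
  rw [PowerSeries.coeff_mk, PowerSeries.coeff_mk] at h8
  rw [h8, map_smul, Polynomial.aeval_def]
  have h9 : Polynomial.eval₂ (algebraMap ℚ ℂ) (1 / 2) (Polynomial.bernoulli n)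
      = (((Polynomial.bernoulli n).eval (1 / 2 : ℚ) : ℚ) : ℂ) := by
    have := Polynomial.eval₂_at_apply (p := Polynomial.bernoulli n) (algebraMap ℚ ℂ) (1 / 2 : ℚ)
    simpa using this
  rw [h9, Algebra.smul_def]
  simp [div_eq_inv_mul]

lemma evenExpansion_bernoulliFun : EvenExpansion bernoulliFun (PowerSeries.mk fun n =>
    (((Polynomial.bernoulli (2 * n)).eval (1 / 2 : ℚ) : ℚ) : ℂ) / (2 * n).factorial) := by
  have h := EvenExpansion.of_analyticAt analyticAt_bernoulliFun
    (Eventually.of_forall bernoulliFun_neg)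
  simp_rw [iteratedDeriv_bernoulliFun] at h
  exact h

lemma evenExpansion_rankGF {q : ℂ} (hq : ‖q‖ < 1) :
    EvenExpansion (fun x => rankGF (Complex.exp x) q)
      (PowerSeries.mk fun n => (∑' m : ℕ, (rankMoment (2 * n) m : ℂ) * q ^ m) / (2 * n).factorial) := by
  refine EvenExpansion.of_hasSum (a := fun k => (∑' m : ℕ, (rankMoment k m : ℂ) * q ^ m) / k.factorial)
    ?_ fun n => ?_
  · have hc : Continuous fun x : ℂ => Real.exp ‖x‖ * ‖q‖ := by fun_prop
    have := hc.tendsto 0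
    simp only [norm_zero, Real.exp_zero, one_mul] at this
    filter_upwards [this.eventually_lt_const hq] with x hx using hasSum_rankGF hx
  · simp only [rankMoment_odd ⟨n, rfl⟩]
    simp

/-! ### The completed rank moments as Taylor coefficients -/

section Coefficients

lemma qPow_natCast (n : ℕ) (τ : ℂ) : qPow n τ = Complex.exp (2 * Real.pi * Complex.I * τ) ^ n := by
  rw [qPow, ← Complex.exp_nat_mul]; congr 1; ring

lemma rankGen_eq (k : ℕ) (τ : ℍ) : rankGen k τ
    = ∑' n : ℕ, (rankMoment k n : ℂ) * Complex.exp (2 * Real.pi * Complex.I * τ) ^ n := by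
  simp_rw [rankGen, qPow_natCast]

lemma summable_rankMoment_mul_qPow (k : ℕ) (τ : ℍ) :
    Summable fun n : ℕ => (rankMoment k n : ℂ) * qPow n τ := by
  simp_rw [qPow_natCast]
  exact summable_rankMoment k (norm_exp_two_pi_I_lt_one τ.im_pos)

lemma sum_antidiagonal_antidiagonal (ℓ : ℕ) (F : ℕ → ℕ → ℕ → ℂ) :
    ∑ p ∈ Finset.HasAntidiagonal.antidiagonal ℓ, ∑ r ∈ Finset.HasAntidiagonal.antidiagonal p.2, F p.1 r.1 r.2
      = ∑ p ∈ (Finset.range (ℓ + 1) ×ˢ Finset.range (ℓ + 1)).filter (fun p => p.1 + p.2 ≤ ℓ),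
        F p.1 p.2 (ℓ - p.1 - p.2) := by
  rw [Finset.Nat.sum_antidiagonal_eq_sum_range_succ_mk, Finset.sum_filter, Finset.sum_product]
  refine Finset.sum_congr rfl fun a ha => ?_
  rw [Finset.mem_range] at ha
  rw [Finset.Nat.sum_antidiagonal_eq_sum_range_succ_mk, ← Finset.sum_filter]
  refine Finset.sum_congr ?_ fun _ _ => rfl
  ext c
  simp only [Finset.mem_range, Finset.mem_filter]
  lia

/-- The Taylor coefficients of the holomorphic part. -/
noncomputable def plusSeries (τ : ℍ) : PowerSeries ℂ :=
  (PowerSeries.mk fun n => rankGen (2 * n) τ / (2 * n).factorial)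
    * ((PowerSeries.mk fun n =>
        (((Polynomial.bernoulli (2 * n)).eval (1 / 2 : ℚ) : ℚ) : ℂ) / (2 * n).factorial)
      * PowerSeries.mk fun n => (EisensteinSeries.E2 τ / 8) ^ n / n.factorial)

lemma rPlus_eq (ℓ : ℕ) (τ : ℍ) : rPlus ℓ τ = (2 * Real.pi * Complex.I) ^ (2 * ℓ - 1)
    * qPow (-1 / 24) τ * PowerSeries.coeff ℓ (plusSeries τ) := by
  have h : PowerSeries.coeff ℓ (plusSeries τ) = ∑ p ∈ Finset.HasAntidiagonal.antidiagonal ℓ,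
      ∑ r ∈ Finset.HasAntidiagonal.antidiagonal p.2, (rankGen (2 * p.1) τ / (2 * p.1).factorial)
        * ((((Polynomial.bernoulli (2 * r.1)).eval (1 / 2 : ℚ) : ℚ) : ℂ) / (2 * r.1).factorial
          * ((EisensteinSeries.E2 τ / 8) ^ r.2 / r.2.factorial)) := by
    rw [plusSeries, PowerSeries.coeff_mul]
    refine Finset.sum_congr rfl fun p _ => ?_
    rw [PowerSeries.coeff_mul, PowerSeries.coeff_mk, Finset.mul_sum]
    simp_rw [PowerSeries.coeff_mk]
  rw [h, sum_antidiagonal_antidiagonal ℓ fun j n m => (rankGen (2 * j) τ / (2 * j).factorial)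
        * ((((Polynomial.bernoulli (2 * n)).eval (1 / 2 : ℚ) : ℚ) : ℂ) / (2 * n).factorial
          * ((EisensteinSeries.E2 τ / 8) ^ m / m.factorial)), rPlus, mul_assoc (_ ^ _)]
  congr 1
  rw [Finset.mul_sum]
  refine Finset.sum_congr rfl fun p _ => ?_
  field_simp

/-- The generating function of the completed rank moments. -/
noncomputable def completedFun (τ : ℍ) (z : ℂ) : ℂ :=
  z * appellHat τ z 0 * Complex.exp (-(Real.pi : ℂ) ^ 2 / 2 * EisensteinSeries.E2 τ * z ^ 2)

/-- With `x = 2πiz` the function is, up to the constant factor, a product of three even functions: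
`R(exp x, q)`, `bernoulliFun x` and `exp(E₂ x² / 8)`. Their coefficients are the three factors of
`plusSeries`. -/
lemma evenExpansion_plus (τ : ℍ) : EvenExpansion
    (fun z => z * appell τ z * Complex.exp (-(Real.pi : ℂ) ^ 2 / 2 * EisensteinSeries.E2 τ * z ^ 2))
    (PowerSeries.C (ModularForm.eta τ * qPow (-1 / 24) τ / (2 * Real.pi * Complex.I))
      * PowerSeries.rescale ((2 * Real.pi * Complex.I) ^ 2) (plusSeries τ)) := by
  set q := Complex.exp (2 * Real.pi * Complex.I * τ) with hq
  have hq1 : ‖q‖ < 1 := norm_exp_two_pi_I_lt_one τ.im_pos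
  have hI := Complex.two_pi_I_ne_zero
  have h1 := evenExpansion_rankGF hq1
  simp_rw [hq, ← rankGen_eq] at h1
  have h2 := ((h1.mul (evenExpansion_bernoulliFun.mul
    (EvenExpansion.exp_mul_sq (EisensteinSeries.E2 τ / 8)))).comp_const_mul hI).const_mul
      (ModularForm.eta τ * qPow (-1 / 24) τ / (2 * Real.pi * Complex.I))
  refine h2.congr ?_
  have hP : ModularForm.eta τ * qPow (-1 / 24) τ = 1 - partialTheta 0 q - partialTheta 1 q := by
    rw [eta_eq_partialTheta τ.im_pos, qPow, mul_right_comm, ← Complex.exp_add]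
    have : Real.pi * Complex.I * τ / 12 + 2 * Real.pi * Complex.I * (-1 / 24) * τ = (0 : ℂ) := by ring
    rw [this, Complex.exp_zero, one_mul]
  have hPP := partGen_mul hq1
  -- Both `ζ` and `ζ⁻¹` must be bounded by some `ρ` with `ρ |q| < 1`; since `ρ > 1` is available,
  -- this holds for `z` near `0`.
  obtain ⟨ρ, hρ1, hρ2⟩ : ∃ ρ : ℝ, 1 < ρ ∧ ρ * ‖q‖ < 1 := by
    have hc : Continuous fun ρ : ℝ => ρ * ‖q‖ := by fun_prop
    have := hc.tendsto 1
    rw [one_mul] at this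
    have h3 := (this.eventually_lt_const hq1).filter_mono (nhdsWithin_le_nhds (s := Set.Ioi 1))
    obtain ⟨ρ, h4, h5⟩ := (h3.and self_mem_nhdsWithin).exists
    exact ⟨ρ, h5, h4⟩
  have hζ1 : ∀ᶠ z : ℂ in 𝓝 0, ‖Complex.exp (2 * Real.pi * Complex.I * z)‖ < ρ := by
    have hc : Continuous fun z : ℂ => ‖Complex.exp (2 * Real.pi * Complex.I * z)‖ := by fun_prop
    have := hc.tendsto 0
    simp only [mul_zero, Complex.exp_zero, norm_one] at this
    exact this.eventually_lt_const hρ1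
  have hζ2 : ∀ᶠ z : ℂ in 𝓝 0, ‖(Complex.exp (2 * Real.pi * Complex.I * z))⁻¹‖ < ρ := by
    have hc : Continuous fun z : ℂ => ‖(Complex.exp (2 * Real.pi * Complex.I * z))⁻¹‖ := by
      simp_rw [← Complex.exp_neg]; fun_prop
    have := hc.tendsto 0
    simp only [mul_zero, Complex.exp_zero, inv_one, norm_one] at this
    exact this.eventually_lt_const hρ1
  filter_upwards [eventually_notMem_latticeSet τ.im_pos 0, hζ1.filter_mono nhdsWithin_le_nhds,
    hζ2.filter_mono nhdsWithin_le_nhds, self_mem_nhdsWithin] with z hz a1 a2 hz0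
  have hz0' : z ≠ 0 := hz0
  have h3 := partGen_mul_appell τ.im_pos hz a1.le a2.le hρ1.le hρ2
  rw [← hq] at h3 ⊢
  have h4 : appell τ z = (1 - partialTheta 0 q - partialTheta 1 q)
      * (-Complex.exp (Real.pi * Complex.I * z) / (1 - Complex.exp (2 * Real.pi * Complex.I * z))
        * rankGF (Complex.exp (2 * Real.pi * Complex.I * z)) q) := by
    rw [← h3]; linear_combination (-appell τ z) * hPP
  have h5 : bernoulliFun (2 * Real.pi * Complex.I * z) = 2 * Real.pi * Complex.I * z
      * (-Complex.exp (Real.pi * Complex.I * z) / (1 - Complex.exp (2 * Real.pi * Complex.I * z))) := by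
    rw [bernoulliFun_of_ne (mul_ne_zero hI hz0'), ← neg_sub (1 : ℂ), div_neg, neg_div, mul_neg,
      mul_div_assoc]
    congr 4
    ring
  have h6 : EisensteinSeries.E2 τ / 8 * (2 * Real.pi * Complex.I * z) ^ 2
      = -(Real.pi : ℂ) ^ 2 / 2 * EisensteinSeries.E2 τ * z ^ 2 := by
    linear_combination (EisensteinSeries.E2 τ * Real.pi ^ 2 * z ^ 2 / 2) * Complex.I_sq
  rw [hP, h4, h5, h6]
  have := Complex.ofReal_ne_zero.2 Real.pi_ne_zero
  have := Complex.I_ne_zero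
  field_simp

/-- The Gaussian is even, so the odd Taylor coefficients of the product see only the odd part of
`errJac`; the factor `z` moves the exponent `2n - 1` to `2n`. -/
lemma evenExpansion_minus (τ : ℍ) : EvenExpansion
    (fun z => z * oddJac τ z 0 * Complex.exp (-(Real.pi : ℂ) ^ 2 / 2 * EisensteinSeries.E2 τ * z ^ 2))
    (PowerSeries.mk fun n => if n = 0 then 0 else rMinus n τ) := by
  have h1 : AnalyticAt ℂ (fun z => errJac τ z 0
      * Complex.exp (-(Real.pi : ℂ) ^ 2 / 2 * EisensteinSeries.E2 τ * z ^ 2)) 0 :=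
    ((differentiable_errJac τ.im_pos).analyticAt 0).fun_mul (by fun_prop)
  have h2 := EvenExpansion.mul_odd_part h1
  have h3 : (PowerSeries.mk fun n => if n = 0 then 0 else rMinus n τ) = PowerSeries.mk fun n =>
      if n = 0 then 0 else iteratedDeriv (2 * n - 1) (fun z => errJac τ z 0
        * Complex.exp (-(Real.pi : ℂ) ^ 2 / 2 * EisensteinSeries.E2 τ * z ^ 2)) 0
          / (2 * n - 1).factorial := by
    ext n
    rw [PowerSeries.coeff_mk, PowerSeries.coeff_mk, rMinus_eq]
    split_ifs
    · rfl
    · ring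
  rw [h3]
  refine h2.congr (Eventually.of_forall fun z => ?_)
  simp only [oddJac, neg_zero, neg_sq]
  ring

lemma exists_evenExpansion_completedFun (τ : ℍ) : ∃ a : PowerSeries ℂ,
    EvenExpansion (completedFun τ) a ∧ ∀ ℓ, 1 ≤ ℓ → PowerSeries.coeff ℓ a = ModularForm.eta τ * r ℓ τ := by
  refine ⟨_, ((evenExpansion_plus τ).add ((evenExpansion_minus τ).const_mul (ModularForm.eta τ))).congr
    (Eventually.of_forall fun z => ?_), fun ℓ hℓ => ?_⟩
  · simp only [completedFun, appellHat]; ring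
  · rw [map_add, PowerSeries.coeff_C_mul, PowerSeries.coeff_C_mul, PowerSeries.coeff_mk, if_neg (by lia),
      PowerSeries.coeff_rescale, r, rPlus_eq]
    have hI := Complex.two_pi_I_ne_zero
    have : ((2 * Real.pi * Complex.I) ^ 2) ^ ℓ = (2 * Real.pi * Complex.I) ^ (2 * ℓ - 1)
        * (2 * Real.pi * Complex.I) := by
      rw [← pow_mul, ← pow_succ]; congr 1; lia
    rw [this]
    have := Complex.ofReal_ne_zero.2 Real.pi_ne_zero
    have := Complex.I_ne_zero
    field_simp

end Coefficients

/-! ### Modularity -/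

section Modularity

lemma coe_S_smul (τ : ℍ) : ((ModularGroup.S • τ : ℍ) : ℂ) = -1 / τ := by
  rw [UpperHalfPlane.modular_S_smul]
  simp [neg_div, inv_neg]

lemma coe_T_smul (τ : ℍ) : ((ModularGroup.T • τ : ℍ) : ℂ) = τ + 1 := by
  rw [UpperHalfPlane.modular_T_smul, UpperHalfPlane.coe_vadd]
  push_cast; ring

lemma E2_S_smul (τ : ℍ) : EisensteinSeries.E2 (ModularGroup.S • τ)
    = τ ^ 2 * EisensteinSeries.E2 τ + 6 * τ / (Real.pi * Complex.I) := by
  have h := congrFun (EisensteinSeries.E2_slash_action ModularGroup.S) τ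
  rw [ModularForm.SL_slash_apply, ModularGroup.denom_apply, Pi.sub_apply, Pi.smul_apply,
    EisensteinSeries.D2_S, riemannZeta_two, smul_eq_mul] at h
  have h1 : ((ModularGroup.S 1 0 : ℤ) : ℂ) * τ + ((ModularGroup.S 1 1 : ℤ) : ℂ) = τ := by
    simp [ModularGroup.S]
  rw [h1] at h
  have hτ := τ.ne_zero
  have := Complex.ofReal_ne_zero.2 Real.pi_ne_zero
  have := Complex.I_ne_zero
  rw [zpow_neg] at h
  have h2 : EisensteinSeries.E2 (ModularGroup.S • τ) = (τ : ℂ) ^ 2 * (EisensteinSeries.E2 (ModularGroup.S • τ)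
      * ((τ : ℂ) ^ (2 : ℤ))⁻¹) := by
    rw [zpow_ofNat]; field_simp
  rw [h2, h]
  field_simp
  linear_combination -6 * Complex.I_sq

lemma E2_T_smul (τ : ℍ) : EisensteinSeries.E2 (ModularGroup.T • τ) = EisensteinSeries.E2 τ := by
  have h := congrFun (EisensteinSeries.E2_slash_action ModularGroup.T) τ
  rw [ModularForm.SL_slash_apply, ModularGroup.denom_apply, EisensteinSeries.D2_T] at h
  simpa [ModularGroup.T] using h

/-- The anomalous term of `E₂` contributes `exp(3πiz²/τ)`, and the prefactor `z/τ` contributes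
`1/τ`: exactly the factor in `appellHat_inv`. Hence `completedFun` at `(-1/τ, z/τ)` equals
`completedFun` at `(τ, z)`, and coefficients can be compared. -/
lemma eta_mul_r_S_smul {ℓ : ℕ} (hℓ : 1 ≤ ℓ) (τ : ℍ) :
    ModularForm.eta ((ModularGroup.S • τ : ℍ) : ℂ) * r ℓ (ModularGroup.S • τ)
      = (τ : ℂ) ^ (2 * ℓ) * (ModularForm.eta τ * r ℓ τ) := by
  obtain ⟨a, ha, ha'⟩ := exists_evenExpansion_completedFun τ
  obtain ⟨b, hb, hb'⟩ := exists_evenExpansion_completedFun (ModularGroup.S • τ)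
  have hτ := τ.ne_zero
  have h1 := (hb.comp_const_mul (inv_ne_zero hτ)).congr (g := completedFun τ) (by
    filter_upwards [eventually_notMem_latticeSet τ.im_pos 0] with z hz
    have h2 := appellHat_inv τ.im_pos hz
    rw [completedFun, completedFun, coe_S_smul, E2_S_smul, ← h2, inv_mul_eq_div]
    have h3 : -(Real.pi : ℂ) ^ 2 / 2 * ((τ : ℂ) ^ 2 * EisensteinSeries.E2 τ
        + 6 * τ / (Real.pi * Complex.I)) * (z / τ) ^ 2
        = 3 * Real.pi * Complex.I * z ^ 2 / τ + -(Real.pi : ℂ) ^ 2 / 2 * EisensteinSeries.E2 τ * z ^ 2 := by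
      have := Complex.ofReal_ne_zero.2 Real.pi_ne_zero
      have := Complex.I_ne_zero
      field_simp
      linear_combination (-6 * z ^ 2) * Complex.I_sq
    rw [h3, Complex.exp_add]
    ring)
  have h4 := congrArg (PowerSeries.coeff ℓ) (h1.unique ha)
  rw [PowerSeries.coeff_rescale, ha' ℓ hℓ, hb' ℓ hℓ] at h4
  rw [← h4, pow_mul, ← mul_assoc, ← mul_pow, ← mul_pow, mul_inv_cancel₀ hτ, one_pow, one_pow, one_mul]

lemma eta_mul_r_T_smul {ℓ : ℕ} (hℓ : 1 ≤ ℓ) (τ : ℍ) :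
    ModularForm.eta ((ModularGroup.T • τ : ℍ) : ℂ) * r ℓ (ModularGroup.T • τ)
      = ModularForm.eta τ * r ℓ τ := by
  obtain ⟨a, ha, ha'⟩ := exists_evenExpansion_completedFun τ
  obtain ⟨b, hb, hb'⟩ := exists_evenExpansion_completedFun (ModularGroup.T • τ)
  have h1 := hb.congr (g := completedFun τ) (by
    refine Eventually.of_forall fun z => ?_
    rw [completedFun, completedFun, coe_T_smul, E2_T_smul, appellHat_vadd_one τ.im_pos])
  rw [← ha' ℓ hℓ, ← hb' ℓ hℓ, h1.unique ha]

/-- The product of `η` and a completed rank moment is modular of weight `2ℓ`. -/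
theorem eta_mul_r_smul {ℓ : ℕ} (hℓ : 1 ≤ ℓ) (γ : SL(2, ℤ)) (τ : ℍ) :
    ModularForm.eta ((γ • τ : ℍ) : ℂ) * r ℓ (γ • τ)
      = (cd γ τ) ^ (2 * ℓ) * (ModularForm.eta τ * r ℓ τ) := by
  set f : ℍ → ℂ := fun τ => ModularForm.eta τ * r ℓ τ with hf
  have hcd : ∀ (γ : SL(2, ℤ)) (τ : ℍ), UpperHalfPlane.denom (Matrix.SpecialLinearGroup.toGL
      ((Matrix.SpecialLinearGroup.map (Int.castRingHom ℝ)) γ)) τ = cd γ τ := fun γ τ => by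
    rw [ModularGroup.denom_apply, cd]
  have hne : ∀ (γ : SL(2, ℤ)) (τ : ℍ), cd γ τ ≠ 0 := fun γ τ => by
    rw [← hcd]; exact UpperHalfPlane.denom_ne_zero _ _
  -- The product with `η` has integral weight and trivial multiplier, so the slash action reduces
  -- everything to the generators `S` and `T`.
  have hslash : ∀ γ : SL(2, ℤ), SlashAction.map (2 * ℓ : ℤ) γ f = f := by
    intro γ
    have hγ : γ ∈ Subgroup.closure {ModularGroup.S, ModularGroup.T} := by
      simp [SpecialLinearGroup.SL2Z_generators]
    induction hγ using Subgroup.closure_induction with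
    | one => exact SlashAction.slash_one _ _
    | mem g hg =>
      rcases hg with rfl | rfl
      · funext τ
        rw [ModularForm.SL_slash_apply, hcd]
        have h1 : cd ModularGroup.S τ = τ := by simp [cd, ModularGroup.S]
        simp only [hf]
        rw [eta_mul_r_S_smul hℓ, h1, zpow_neg, mul_comm, ← mul_assoc]
        have : (τ : ℂ) ^ (2 * ℓ : ℤ) = (τ : ℂ) ^ (2 * ℓ) := by exact_mod_cast zpow_natCast (τ : ℂ) (2 * ℓ)
        rw [this, inv_mul_cancel₀ (pow_ne_zero _ τ.ne_zero), one_mul]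
      · funext τ
        rw [ModularForm.SL_slash_apply, hcd]
        have h1 : cd ModularGroup.T τ = 1 := by simp [cd, ModularGroup.T]
        simp only [hf]
        rw [eta_mul_r_T_smul hℓ, h1, one_zpow, mul_one]
    | mul g h _ _ hg hh => rw [SlashAction.slash_mul, hg, hh]
    | inv g _ hg =>
      have := SlashAction.slash_mul (2 * ℓ : ℤ) g g⁻¹ f
      rw [mul_inv_cancel, SlashAction.slash_one, hg] at this
      exact this.symm
  have h := congrFun (hslash γ) τ
  rw [ModularForm.SL_slash_apply, hcd, zpow_neg] at h
  have h2 : (cd γ τ) ^ (2 * ℓ : ℤ) = (cd γ τ) ^ (2 * ℓ) := by exact_mod_cast zpow_natCast (cd γ τ) (2 * ℓ)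
  rw [h2] at h
  have h3 := pow_ne_zero (2 * ℓ) (hne γ τ)
  change f (γ • τ) = _ * f τ
  rw [← h]
  field_simp

end Modularity

/-! ### The multiplier of the eta function -/

section Multiplier

lemma cd_ne_zero (γ : SL(2, ℤ)) (τ : ℍ) : cd γ τ ≠ 0 := by
  have := UpperHalfPlane.denom_ne_zero (Matrix.SpecialLinearGroup.toGL
    ((Matrix.SpecialLinearGroup.map (Int.castRingHom ℝ)) γ)) τ
  rwa [ModularGroup.denom_apply] at this

lemma coe_smul_eq (γ : SL(2, ℤ)) (τ : ℍ) :
    ((γ • τ : ℍ) : ℂ) = ((γ 0 0 : ℂ) * τ + γ 0 1) / ((γ 1 0 : ℂ) * τ + γ 1 1) := by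
  rw [UpperHalfPlane.coe_specialLinearGroup_apply]
  simp

lemma hasDerivAt_smul (γ : SL(2, ℤ)) (τ : ℍ) :
    HasDerivAt (fun w : ℂ => ((γ 0 0 : ℂ) * w + γ 0 1) / ((γ 1 0 : ℂ) * w + γ 1 1))
      (1 / (cd γ τ) ^ 2) τ := by
  have h0 : ((γ 1 0 : ℂ) * τ + γ 1 1) ≠ 0 := cd_ne_zero γ τ
  have h1 := (((hasDerivAt_id (τ : ℂ)).const_mul (γ 0 0 : ℂ)).add_const (γ 0 1 : ℂ)).div
    (((hasDerivAt_id (τ : ℂ)).const_mul (γ 1 0 : ℂ)).add_const (γ 1 1 : ℂ)) h0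
  refine h1.congr_deriv ?_
  have hdet : (γ 0 0 : ℂ) * γ 1 1 - (γ 0 1 : ℂ) * γ 1 0 = 1 := by
    have := γ.det_coe
    rw [Matrix.det_fin_two] at this
    exact_mod_cast this
  rw [cd]
  congr 1
  simp only [id]
  linear_combination hdet

/-- If `c = 0`, the base may be `-1`, on the cut of the principal branch, but the function is then
constant. Otherwise `cτ + d` is not real. -/
lemma hasDerivAt_cd_cpow (γ : SL(2, ℤ)) (τ : ℍ) :
    HasDerivAt (fun w : ℂ => ((γ 1 0 : ℂ) * w + γ 1 1) ^ (1 / 2 : ℂ))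
      ((cd γ τ) ^ (1 / 2 : ℂ) * ((γ 1 0 : ℂ) / (2 * cd γ τ))) τ := by
  by_cases hc : γ 1 0 = 0
  · rw [hc]
    simpa using hasDerivAt_const (τ : ℂ) ((γ 1 1 : ℂ) ^ (1 / 2 : ℂ))
  · have hs : (γ 1 0 : ℂ) * τ + γ 1 1 ∈ Complex.slitPlane := by
      right
      simp [hc, τ.im_pos.ne']
    have h1 := ((((hasDerivAt_id (τ : ℂ)).const_mul (γ 1 0 : ℂ)).add_const (γ 1 1 : ℂ))).cpow_const
      (c := 1 / 2) hs
    refine h1.congr_deriv ?_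
    simp only [id]
    have h0 := cd_ne_zero γ τ
    rw [← cd, Complex.cpow_sub _ _ h0, Complex.cpow_one]
    field_simp

lemma hasDerivAt_eta (τ : ℍ) : HasDerivAt ModularForm.eta
    (Real.pi * Complex.I / 12 * EisensteinSeries.E2 τ * ModularForm.eta τ) τ := by
  have h1 := (ModularForm.differentiableAt_eta_of_mem_upperHalfPlaneSet (z := τ) τ.im_pos).hasDerivAt
  refine h1.congr_deriv ?_
  have h2 := ModularForm.logDeriv_eta_eq_E2 τ
  rw [logDeriv_apply, div_eq_iff (ModularForm.eta_ne_zero τ.im_pos)] at h2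
  exact h2

lemma E2_smul (γ : SL(2, ℤ)) (τ : ℍ) : EisensteinSeries.E2 (γ • τ) / (cd γ τ) ^ 2
    = EisensteinSeries.E2 τ - 6 * Complex.I * γ 1 0 / (Real.pi * cd γ τ) := by
  have h := congrFun (EisensteinSeries.E2_slash_action γ) τ
  rw [ModularForm.SL_slash_apply, Pi.sub_apply, Pi.smul_apply, EisensteinSeries.D2,
    ModularGroup.denom_apply, riemannZeta_two, smul_eq_mul, ← cd, zpow_neg, zpow_ofNat] at h
  rw [div_eq_mul_inv, h]
  have := Complex.ofReal_ne_zero.2 Real.pi_ne_zero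
  have := cd_ne_zero γ τ
  field_simp

/-- The logarithmic derivative of `η` is `(πi/12) E₂`, and the anomaly of `E₂` under `γ` is
accounted for by that of `(cτ + d)^(1/2)`. So the quotient has zero derivative on the upper half
plane, and its value at `i` is `etaMultiplier γ`. -/
theorem eta_smul (γ : SL(2, ℤ)) (τ : ℍ) : ModularForm.eta ((γ • τ : ℍ) : ℂ)
    = etaMultiplier γ * (cd γ τ) ^ (1 / 2 : ℂ) * ModularForm.eta τ := by
  set F : ℂ → ℂ := fun w => ModularForm.eta (((γ 0 0 : ℂ) * w + γ 0 1) / ((γ 1 0 : ℂ) * w + γ 1 1))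
    / (((γ 1 0 : ℂ) * w + γ 1 1) ^ (1 / 2 : ℂ) * ModularForm.eta w) with hF
  have hu : ∀ τ : ℍ, (cd γ τ) ^ (1 / 2 : ℂ) ≠ 0 := fun τ => by
    rw [Ne, Complex.cpow_eq_zero_iff]; simp [cd_ne_zero]
  have hη : ∀ τ : ℍ, ModularForm.eta τ ≠ 0 := fun τ => ModularForm.eta_ne_zero τ.im_pos
  have hd : ∀ τ : ℍ, HasDerivAt F 0 τ := by
    intro τ
    have h1 : HasDerivAt (fun w : ℂ => ModularForm.eta
        (((γ 0 0 : ℂ) * w + γ 0 1) / ((γ 1 0 : ℂ) * w + γ 1 1)))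
        (Real.pi * Complex.I / 12 * EisensteinSeries.E2 (γ • τ) * ModularForm.eta ((γ • τ : ℍ) : ℂ)
          * (1 / (cd γ τ) ^ 2)) τ := by
      refine HasDerivAt.comp (h₂ := ModularForm.eta) (τ : ℂ) ?_ (hasDerivAt_smul γ τ)
      rw [← coe_smul_eq]
      exact hasDerivAt_eta (γ • τ)
    have h2 := h1.div ((hasDerivAt_cd_cpow γ τ).mul (hasDerivAt_eta τ)) (mul_ne_zero (hu τ) (hη τ))
    refine h2.congr_deriv ?_
    rw [div_eq_zero_iff]
    left
    simp only [Pi.mul_apply]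
    rw [← coe_smul_eq, ← cd]
    have h3 := E2_smul γ τ
    have hπ := Complex.ofReal_ne_zero.2 Real.pi_ne_zero
    have hc := cd_ne_zero γ τ
    have h4 : Real.pi * Complex.I / 12 * EisensteinSeries.E2 (γ • τ) * (1 / (cd γ τ) ^ 2)
        = Real.pi * Complex.I / 12 * EisensteinSeries.E2 τ + (γ 1 0 : ℂ) / (2 * cd γ τ) := by
      rw [mul_assoc, mul_one_div, h3]
      field_simp
      linear_combination (-12 * (γ 1 0 : ℂ)) * Complex.I_sq
    linear_combination (ModularForm.eta ((γ • τ : ℍ) : ℂ) * (cd γ τ) ^ (1 / 2 : ℂ) * ModularForm.eta τ) * h4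
  have hconst : ∀ τ τ' : ℍ, F τ = F τ' := by
    intro τ τ'
    have hconv : Convex ℝ {z : ℂ | 0 < z.im} := convex_halfSpace_im_gt 0
    refine (isOpen_lt continuous_const Complex.continuous_im).is_const_of_deriv_eq_zero
      hconv.isPreconnected (f := F) (fun z hz => ?_) (fun z hz => ?_) τ.im_pos τ'.im_pos
    · exact (hd ⟨z, hz⟩).differentiableAt.differentiableWithinAt
    · exact (hd ⟨z, hz⟩).deriv
  have h := hconst τ UpperHalfPlane.I
  have hFτ : ∀ τ : ℍ, F τ = ModularForm.eta ((γ • τ : ℍ) : ℂ)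
      / ((cd γ τ) ^ (1 / 2 : ℂ) * ModularForm.eta τ) := fun τ => by
    rw [coe_smul_eq]; rfl
  rw [hFτ, hFτ, div_eq_iff (mul_ne_zero (hu τ) (hη τ))] at h
  rw [h, etaMultiplier, ← mul_assoc]

theorem r_smul {ℓ : ℕ} (hℓ : 1 ≤ ℓ) (γ : SL(2, ℤ)) (τ : ℍ) :
    r ℓ (γ • τ) = (etaMultiplier γ)⁻¹ * (cd γ τ) ^ (2 * (ℓ : ℂ) - 1 / 2) * r ℓ τ := by
  have h1 := eta_mul_r_smul hℓ γ τ
  have h2 := eta_smul γ τ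
  have hη : ∀ τ : ℍ, ModularForm.eta τ ≠ 0 := fun τ => ModularForm.eta_ne_zero τ.im_pos
  have hc := cd_ne_zero γ τ
  have hu : (cd γ τ) ^ (1 / 2 : ℂ) ≠ 0 := by
    rw [Ne, Complex.cpow_eq_zero_iff]; simp [hc]
  have hψ : etaMultiplier γ ≠ 0 := by
    intro h
    rw [h, zero_mul, zero_mul] at h2
    exact hη _ h2
  have h3 : (cd γ τ) ^ (2 * (ℓ : ℂ) - 1 / 2) = (cd γ τ) ^ (2 * ℓ) / (cd γ τ) ^ (1 / 2 : ℂ) := by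
    rw [Complex.cpow_sub _ _ hc, ← Complex.cpow_natCast]
    push_cast; rfl
  rw [h2] at h1
  have h4 := hη τ
  rw [h3]
  field_simp
  apply mul_left_cancel₀ h4
  linear_combination h1

end Multiplier

/-! ### The image under the lowering operator -/

section Lowering

lemma isOpen_im_pos : IsOpen {τ : ℂ | 0 < τ.im} := isOpen_lt continuous_const Complex.continuous_im

lemma differentiableOn_E2 :
    DifferentiableOn ℂ (EisensteinSeries.E2 ∘ UpperHalfPlane.ofComplex) {τ : ℂ | 0 < τ.im} :=
  UpperHalfPlane.mdifferentiable_iff.1 E2_mdifferentiable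

lemma differentiableOn_rankSeries (k : ℕ) :
    DifferentiableOn ℂ (fun q : ℂ => ∑' n : ℕ, (rankMoment k n : ℂ) * q ^ n) (Metric.ball 0 1) := by
  intro q hq
  rw [mem_ball_zero_iff] at hq
  obtain ⟨ρ, h1, h2⟩ := exists_between hq
  have hρ : 0 ≤ ρ := (norm_nonneg q).trans h1.le
  have hs := (summable_rankMoment k (q := (ρ : ℂ)) (by rwa [Complex.norm_real, Real.norm_of_nonneg hρ])).norm
  have h3 : DifferentiableOn ℂ (fun q : ℂ => ∑' n : ℕ, (rankMoment k n : ℂ) * q ^ n) (Metric.ball 0 ρ) := by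
    refine Complex.differentiableOn_tsum_of_summable_norm hs (fun n => by fun_prop) Metric.isOpen_ball
      fun n w hw => ?_
    rw [mem_ball_zero_iff] at hw
    rw [norm_mul, norm_mul, norm_pow, norm_pow, Complex.norm_real, Real.norm_of_nonneg hρ]
    gcongr
  exact (h3.differentiableAt (Metric.isOpen_ball.mem_nhds (by simpa using h1))).differentiableWithinAt

lemma differentiableOn_rankGen (k : ℕ) :
    DifferentiableOn ℂ (rankGen k ∘ UpperHalfPlane.ofComplex) {τ : ℂ | 0 < τ.im} := by
  have h1 : DifferentiableOn ℂ (fun τ : ℂ => ∑' n : ℕ, (rankMoment k n : ℂ)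
      * Complex.exp (2 * Real.pi * Complex.I * τ) ^ n) {τ : ℂ | 0 < τ.im} :=
    (differentiableOn_rankSeries k).comp (f := fun τ : ℂ => Complex.exp (2 * Real.pi * Complex.I * τ))
      (by fun_prop) fun τ hτ => by simpa using norm_exp_two_pi_I_lt_one hτ
  refine h1.congr fun τ hτ => ?_
  rw [Function.comp_apply, rankGen_eq, UpperHalfPlane.ofComplex_apply_of_im_pos hτ]

lemma differentiableOn_rPlus (ℓ : ℕ) :
    DifferentiableOn ℂ (rPlus ℓ ∘ UpperHalfPlane.ofComplex) {τ : ℂ | 0 < τ.im} := by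
  have h1 : DifferentiableOn ℂ (fun τ : ℂ => (UpperHalfPlane.ofComplex τ : ℂ)) {τ : ℂ | 0 < τ.im} :=
    differentiableOn_id.congr fun τ hτ => by
      rw [UpperHalfPlane.ofComplex_apply_of_im_pos hτ]; rfl
  have h2 : DifferentiableOn ℂ (fun τ : ℂ => qPow (-1 / 24) (UpperHalfPlane.ofComplex τ))
      {τ : ℂ | 0 < τ.im} := (h1.const_mul _).cexp
  refine DifferentiableOn.const_mul (DifferentiableOn.fun_sum fun p _ => ?_) _
  exact ((differentiableOn_E2.div_const 8).pow _).const_mul _ |>.mul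
    (((differentiableOn_rankGen _).mul h2).div_const _)

/-- The domain of `minusExt`. -/
def minusDomain : Set (ℂ × ℂ × ℂ) := {p | 0 < p.1.re ∧ 0 < p.2.1.im ∧ p.2.1.im < 12 * (p.1 ^ 2).re}

lemma isOpen_minusDomain : IsOpen minusDomain := by
  refine IsOpen.and (isOpen_lt ?_ ?_) (IsOpen.and (isOpen_lt ?_ ?_) (isOpen_lt ?_ ?_)) <;> fun_prop

/-- The function `errJac τ z 0 * exp (-π² E₂(τ) z² / 2)`, with `sqrtIm τ` replaced by an independent
variable `s`. -/
noncomputable def minusExt (p : ℂ × ℂ × ℂ) : ℂ :=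
  errSum (p.1, p.2.2 / (2 * Complex.I * p.1), p.2.1, p.2.2)
    * Complex.exp (-(Real.pi : ℂ) ^ 2 / 2 * EisensteinSeries.E2 (UpperHalfPlane.ofComplex p.2.1) * p.2.2 ^ 2)

lemma ne_zero_of_mem_minusDomain {p : ℂ × ℂ × ℂ} (hp : p ∈ minusDomain) : p.1 ≠ 0 := fun h => by
  have := hp.1
  rw [h] at this
  simp at this

lemma contDiffOn_minusExt : ContDiffOn ℂ ∞ minusExt minusDomain := by
  refine ContDiffOn.mul (contDiffOn_errSum.comp (f := fun p : ℂ × ℂ × ℂ =>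
    (p.1, p.2.2 / (2 * Complex.I * p.1), p.2.1, p.2.2)) ?_ fun p hp => ⟨hp.1, hp.2.2⟩) ?_
  · have h1 : ContDiffOn ℂ ∞ (fun p : ℂ × ℂ × ℂ => p.2.2 / (2 * Complex.I * p.1)) minusDomain := by
      refine ContDiffOn.div (by fun_prop) (by fun_prop) fun p hp => ?_
      simp [ne_zero_of_mem_minusDomain hp]
    fun_prop
  · have h2 : ContDiffOn ℂ ∞ (fun p : ℂ × ℂ × ℂ => EisensteinSeries.E2 (UpperHalfPlane.ofComplex p.2.1))
        minusDomain := (differentiableOn_E2.contDiffOn isOpen_im_pos).comp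
          (f := fun p : ℂ × ℂ × ℂ => p.2.1) (by fun_prop) fun p hp => hp.2.1
    have h3 : ContDiffOn ℂ ∞ (fun p : ℂ × ℂ × ℂ => p.2.2 ^ 2) minusDomain := by fun_prop
    exact ((contDiffOn_const.mul h2).mul h3).cexp

variable {τ : ℂ}

lemma mem_minusDomain (hτ : 0 < τ.im) (z : ℂ) : (sqrtIm τ, τ, z) ∈ minusDomain :=
  ⟨(mem_errDomain hτ 0 z).1, hτ, (mem_errDomain hτ 0 z).2⟩

/-- This exhibits `rMinus` as a holomorphic function of `(s, τ)` evaluated at `s = √(v/6)`, the only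
place where `conj τ` enters. -/
lemma rMinus_eq_dirDeriv (ℓ : ℕ) (hτ : 0 < τ.im) : rMinus ℓ (UpperHalfPlane.ofComplex τ)
    = 1 / ((2 * ℓ - 1).factorial : ℂ) * (dirDeriv (0, 0, 1))^[2 * ℓ - 1] minusExt (sqrtIm τ, τ, 0) := by
  have h := iteratedDeriv_comp_line isOpen_minusDomain contDiffOn_minusExt (sqrtIm τ, τ, 0) (0, 0, 1)
    (2 * ℓ - 1) 0 (by simpa using mem_minusDomain hτ 0)
  simp only [Prod.smul_mk, Prod.mk_add_mk, mul_zero, add_zero, smul_eq_mul, mul_one, zero_add] at h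
  rw [rMinus_eq, ← h]
  simp only [minusExt, errJac, sub_zero, UpperHalfPlane.ofComplex_apply_of_im_pos hτ]

/-- The derivative of `minusExt` in the direction of `s`. -/
lemma dirDeriv_minusExt (hτ : 0 < τ.im) (z : ℂ) : dirDeriv (1, 0, 0) minusExt (sqrtIm τ, τ, z)
    = (dirDeriv (1, 0, 0, 0) errSum (sqrtIm τ, 0, τ, 0)
      + Complex.I / sqrtIm τ ^ 2 * ModularForm.eta (-conj τ) * z)
      * Complex.exp (-((Real.pi : ℂ) ^ 2 * E2hat (UpperHalfPlane.ofComplex τ)) / 2 * z ^ 2) := by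
  have hs := sqrtIm_ne_zero hτ
  have hI := Complex.I_ne_zero
  set s := sqrtIm τ with hsdef
  have hline : HasDerivAt (fun t : ℂ => ((t, τ, z) : ℂ × ℂ × ℂ)) (1, 0, 0) s :=
    (hasDerivAt_id s).prodMk ((hasDerivAt_const _ _).prodMk (hasDerivAt_const _ _))
  have hd : DifferentiableAt ℂ minusExt (s, τ, z) := (contDiffOn_minusExt.differentiableOn
    (by simp)).differentiableAt (isOpen_minusDomain.mem_nhds (mem_minusDomain hτ z))
  have h1 := hd.hasFDerivAt.comp_hasDerivAt s hline
  set e₂ := Complex.I * z / (2 * s ^ 2) with he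
  have h2 : HasDerivAt (fun t : ℂ => ((t, z / (2 * Complex.I * t), τ, z) : ℂ × ℂ × ℂ × ℂ))
      (1, e₂, 0, 0) s := by
    refine (hasDerivAt_id s).prodMk (HasDerivAt.prodMk ?_ ((hasDerivAt_const _ _).prodMk
      (hasDerivAt_const _ _)))
    refine ((hasDerivAt_const s z).div ((hasDerivAt_id s).const_mul (2 * Complex.I))
      (by simp [hs])).congr_deriv ?_
    rw [he]
    simp only [id]
    field_simp
    linear_combination (-z) * Complex.I_sq
  have hdom := mem_errDomain hτ (z / (2 * Complex.I * s)) z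
  have h3 := (((contDiffOn_errSum.contDiffAt (isOpen_errDomain.mem_nhds hdom)).differentiableAt
      (by simp)).hasFDerivAt.comp_hasDerivAt s h2).mul_const (Complex.exp (-(Real.pi : ℂ) ^ 2 / 2
        * EisensteinSeries.E2 (UpperHalfPlane.ofComplex τ) * z ^ 2))
  have h4 := h1.unique h3
  have h5 := hasSum_dirDeriv_errSum hdom 1 e₂
  have h6 := hasSum_dirDeriv_errSum (mem_errDomain hτ 0 0) 1 0
  have h7 := (hasSum_thetaFive (σ := -conj τ) (by rwa [neg_conj_im]) 0).mul_left (-2 * e₂)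
  rw [thetaFive_zero (by rwa [neg_conj_im])] at h7
  -- With the Gaussian factored out, the weights `6k + 5` and `e₂` separate. The first part is the
  -- same derivative at `z = 0`, a constant in `z`; the second is a multiple of `e₂` times the theta
  -- series with value `-η(-conj τ)`.
  have h8 := h5.unique (((h6.add h7).mul_left (Complex.exp (-Real.pi
    * (z / (2 * Complex.I * s)) ^ 2))).congr_fun fun k => ?_)
  · rw [dirDeriv, h4]
    change dirDeriv (1, e₂, 0, 0) errSum (s, z / (2 * Complex.I * s), τ, z) * _ = _
    rw [h8]
    -- Since `s² = v/6`, the Gaussian is `exp(3πz²/(2v))`, exactly what replaces `E₂` by `E₂ -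
    -- 3/(πv)`.
    have h9 : Complex.exp (-Real.pi * (z / (2 * Complex.I * s)) ^ 2) * Complex.exp (-(Real.pi : ℂ) ^ 2 / 2
        * EisensteinSeries.E2 (UpperHalfPlane.ofComplex τ) * z ^ 2)
        = Complex.exp (-((Real.pi : ℂ) ^ 2 * E2hat (UpperHalfPlane.ofComplex τ)) / 2 * z ^ 2) := by
      rw [← Complex.exp_add]
      congr 1
      have hv : (τ.im : ℂ) = 6 * s ^ 2 := by rw [hsdef, sqrtIm_sq hτ]; ring
      have hπ := Complex.ofReal_ne_zero.2 Real.pi_ne_zero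
      have hv' : ((UpperHalfPlane.ofComplex τ).im : ℂ) = 6 * s ^ 2 := by
        rw [UpperHalfPlane.ofComplex_apply_of_im_pos hτ]; exact hv
      rw [E2hat, hv', div_pow, mul_pow, mul_pow, Complex.I_sq]
      field_simp
      ring
    rw [← h9, he]
    ring
  · have h9 := exp_mul_thetaExp hτ z 0 k
    have h10 := exp_mul_thetaExp hτ 0 0 k
    simp only [sub_zero, zero_div, neg_zero, ← hsdef] at h9 h10 ⊢
    rw [show (-Real.pi * (0 : ℂ) ^ 2) = 0 by ring, Complex.exp_zero, one_mul] at h10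
    linear_combination (-2 * (-1) ^ k * (6 * k + 5 + e₂)) * h9 + Complex.exp (-Real.pi
      * (z / (2 * Complex.I * s)) ^ 2) * 2 * (-1) ^ k * (6 * k + 5) * h10

/-- The constant `a` contributes only even powers of `z`; this is why the derivative left
unevaluated in `dirDeriv_minusExt` drops out. -/
lemma iteratedDeriv_affine_mul_exp {ℓ : ℕ} (hℓ : 1 ≤ ℓ) (a b c : ℂ) :
    iteratedDeriv (2 * ℓ - 1) (fun z => (a + b * z) * Complex.exp (c * z ^ 2)) 0
      = (2 * ℓ - 1).factorial * (b * c ^ (ℓ - 1) / (ℓ - 1).factorial) := by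
  obtain ⟨m, rfl⟩ : ∃ m, ℓ = m + 1 := ⟨ℓ - 1, by lia⟩
  have h1 := EvenExpansion.mul_odd_part (f := fun z => (a + b * z) * Complex.exp (c * z ^ 2)) (by fun_prop)
  have h2 := (EvenExpansion.X.mul (EvenExpansion.exp_mul_sq c)).const_mul b
  have h3 := congrArg (PowerSeries.coeff (m + 1)) (h1.unique (h2.congr (Eventually.of_forall fun z => by
    simp only [neg_sq]; ring)))
  rw [PowerSeries.coeff_mk, if_neg (by lia), PowerSeries.coeff_C_mul, PowerSeries.coeff_succ_X_mul,
    PowerSeries.coeff_mk, div_eq_iff (by exact_mod_cast Nat.factorial_ne_zero _)] at h3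
  rw [h3, Nat.add_sub_cancel]
  ring

lemma hasDerivAt_sqrt_div_six {v : ℝ} (hv : 0 < v) : HasDerivAt (fun t : ℝ => ((Real.sqrt (t / 6) : ℝ) : ℂ))
    (1 / (12 * Real.sqrt (v / 6) : ℝ) : ℝ) v := by
  have h := ((hasDerivAt_id v).div_const 6).sqrt (by simp [hv.ne'])
  have h2 : Real.sqrt (v / 6) ≠ 0 := by positivity
  refine HasDerivAt.ofReal_comp (h.congr_deriv ?_)
  simp only [id]
  field_simp
  norm_num

lemma hasFDerivAt_sqrtIm (hτ : 0 < τ.im) : ∃ J : ℂ →L[ℝ] ℂ, HasFDerivAt sqrtIm J τ ∧ J 1 = 0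
    ∧ J Complex.I = 1 / (12 * sqrtIm τ) := by
  refine ⟨_, (hasDerivAt_sqrt_div_six hτ).hasFDerivAt.comp τ Complex.imCLM.hasFDerivAt, ?_, ?_⟩
  · simp
  · simp [sqrtIm]

lemma dzbar_eq {f : ℂ → ℂ} {f' : ℂ →L[ℝ] ℂ} {z : ℂ} (h : HasFDerivAt f f' z) :
    dzbar f z = 1 / 2 * (f' 1 + Complex.I * f' Complex.I) := by
  rw [dzbar, h.fderiv]

/-- The part `rPlus` is holomorphic, and `rMinus` is holomorphic in `(s, τ)`. Hence `∂/∂τ̄` acts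
through `s` alone, with `∂s/∂τ̄ = i/(24s)`, and it remains to find one odd Taylor coefficient of the
`s`-derivative. -/
theorem r_lowering {ℓ : ℕ} (hℓ : 1 ≤ ℓ) (τ : ℍ) :
    DifferentiableAt ℝ (r ℓ ∘ UpperHalfPlane.ofComplex) (τ : ℂ) ∧
    lowering (r ℓ) τ = Complex.I * (Real.sqrt 3 : ℂ) / (Real.sqrt 2 : ℂ)
      * ((Real.sqrt τ.im : ℂ) * ModularForm.eta (-conj (τ : ℂ)) / ((ℓ - 1).factorial : ℂ))
      * (-((Real.pi : ℂ) ^ 2 * E2hat τ) / 2) ^ (ℓ - 1) := by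
  have hτ : 0 < (τ : ℂ).im := τ.im_pos
  obtain ⟨J, hJ, hJ1, hJI⟩ := hasFDerivAt_sqrtIm hτ
  set k := 2 * ℓ - 1 with hk
  set G := (dirDeriv ((0, 0, 1) : ℂ × ℂ × ℂ))^[k] minusExt with hG
  set p : ℂ × ℂ × ℂ := (sqrtIm τ, τ, 0) with hp
  have hpm : p ∈ minusDomain := mem_minusDomain hτ 0
  have hGd : DifferentiableAt ℂ G p := ((contDiffOn_dirDeriv_iterate isOpen_minusDomain
    contDiffOn_minusExt _ k).differentiableOn (by simp)).differentiableAt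
      (isOpen_minusDomain.mem_nhds hpm)
  have h1 := (hGd.hasFDerivAt.restrictScalars ℝ).comp (τ : ℂ)
    (hJ.prodMk ((hasFDerivAt_id (𝕜 := ℝ) (τ : ℂ)).prodMk (hasFDerivAt_const (0 : ℂ) (τ : ℂ))))
  have h2 := ((differentiableOn_rPlus ℓ).differentiableAt
    (isOpen_im_pos.mem_nhds hτ)).hasFDerivAt.restrictScalars ℝ
  have h3 := (h2.add (h1.const_mul (1 / (k.factorial : ℂ)))).congr_of_eventuallyEq
    (f₁ := r ℓ ∘ UpperHalfPlane.ofComplex) (by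
      filter_upwards [isOpen_im_pos.mem_nhds hτ] with w hw
      rw [Function.comp_apply, r, rMinus_eq_dirDeriv ℓ hw]
      rfl)
  refine ⟨h3.differentiableAt, ?_⟩
  have h4 : fderiv ℂ G p (1, 0, 0) = k.factorial * (Complex.I / sqrtIm τ ^ 2 * ModularForm.eta (-conj (τ : ℂ))
      * (-((Real.pi : ℂ) ^ 2 * E2hat τ) / 2) ^ (ℓ - 1) / (ℓ - 1).factorial) := by
    change dirDeriv (1, 0, 0) G p = _
    -- Mixed derivatives commute, so the `s`-derivative is taken before the `z`-derivatives, where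
    -- it has a closed form.
    rw [dirDeriv_iterate_comm isOpen_minusDomain contDiffOn_minusExt (1, 0, 0) (0, 0, 1) k hpm]
    have h := iteratedDeriv_comp_line isOpen_minusDomain (contDiffOn_dirDeriv isOpen_minusDomain
      contDiffOn_minusExt (1, 0, 0)) p (0, 0, 1) k 0 (by simpa using hpm)
    simp only [hp, Prod.smul_mk, Prod.mk_add_mk, mul_zero, add_zero, smul_eq_mul, mul_one, zero_add] at h
    rw [← h]
    simp only [dirDeriv_minusExt hτ, UpperHalfPlane.ofComplex_apply]
    exact iteratedDeriv_affine_mul_exp hℓ _ _ _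
  have h5 : fderiv ℂ G p (1 / (12 * sqrtIm τ), Complex.I, 0)
      = 1 / (12 * sqrtIm τ) * fderiv ℂ G p (1, 0, 0) + Complex.I * fderiv ℂ G p (0, 1, 0) := by
    have h : ((1 / (12 * sqrtIm τ), Complex.I, 0) : ℂ × ℂ × ℂ)
        = (1 / (12 * sqrtIm τ)) • (1, 0, 0) + Complex.I • (0, 1, 0) := by simp
    rw [h, map_add, map_smul, map_smul, smul_eq_mul, smul_eq_mul]
  have h6 : fderiv ℂ (rPlus ℓ ∘ UpperHalfPlane.ofComplex) τ Complex.I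
      = Complex.I * fderiv ℂ (rPlus ℓ ∘ UpperHalfPlane.ofComplex) τ 1 := by
    rw [← smul_eq_mul, ← map_smul, smul_eq_mul, mul_one]
  have h7 : dzbar (r ℓ ∘ UpperHalfPlane.ofComplex) τ = Complex.I / (24 * sqrtIm τ)
      * (Complex.I / sqrtIm τ ^ 2 * ModularForm.eta (-conj (τ : ℂ))
      * (-((Real.pi : ℂ) ^ 2 * E2hat τ) / 2) ^ (ℓ - 1) / (ℓ - 1).factorial) := by
    rw [dzbar_eq h3]
    simp only [add_apply, smul_apply, smul_eq_mul,
      ContinuousLinearMap.comp_apply, ContinuousLinearMap.prod_apply, hJ1, hJI,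
      ContinuousLinearMap.coe_restrictScalars', ContinuousLinearMap.id_apply,
      zero_apply]
    rw [h5, h6, h4]
    set X := Complex.I / sqrtIm τ ^ 2 * ModularForm.eta (-conj (τ : ℂ))
      * (-((Real.pi : ℂ) ^ 2 * E2hat τ) / 2) ^ (ℓ - 1) / (ℓ - 1).factorial
    have h8 : 1 / (k.factorial : ℂ) * k.factorial = 1 :=
      one_div_mul_cancel (by exact_mod_cast Nat.factorial_ne_zero k)
    linear_combination (fderiv ℂ (rPlus ℓ ∘ UpperHalfPlane.ofComplex) τ 1 / 2
      + 1 / (k.factorial : ℂ) * fderiv ℂ G p (0, 1, 0) / 2) * Complex.I_sq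
      + Complex.I / (24 * sqrtIm τ) * X * h8
  rw [lowering, h7]
  -- With `v = 6s²` the constants collapse to `3is`, and this splitting of `√v` rewrites it as `i
  -- (√3/√2) √v`.
  have hv : Real.sqrt τ.im = Real.sqrt 2 * Real.sqrt 3 * Real.sqrt (τ.im / 6) := by
    rw [← Real.sqrt_mul (by norm_num), ← Real.sqrt_mul (by norm_num)]
    congr 1; ring
  have hv' : (τ.im : ℂ) = 6 * sqrtIm τ ^ 2 := by rw [sqrtIm_sq hτ, UpperHalfPlane.coe_im]; ring
  have hv'' : (Real.sqrt τ.im : ℂ) = (Real.sqrt 2 : ℂ) * Real.sqrt 3 * sqrtIm τ := by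
    rw [hv, sqrtIm, UpperHalfPlane.coe_im]; push_cast; rfl
  have hs := sqrtIm_ne_zero hτ
  have h2' : (Real.sqrt 2 : ℂ) ≠ 0 := Complex.ofReal_ne_zero.2 (by positivity)
  have h3' : (Real.sqrt 3 : ℂ) ^ 2 = 3 := by
    rw [← Complex.ofReal_pow, Real.sq_sqrt (by norm_num)]; norm_num
  have hf : ((ℓ - 1).factorial : ℂ) ≠ 0 := by exact_mod_cast Nat.factorial_ne_zero _
  rw [hv', hv'']
  field_simp
  rw [h3', Complex.I_sq]
  ring

end Lowering

end RankMoment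

theorem theorem1p1 :
    -- `ψ` is the multiplier of `η`
    (∀ (γ : SL(2, ℤ)) (τ : ℍ),
      ModularForm.eta ((γ • τ : ℍ) : ℂ)
        = RankMoment.etaMultiplier γ * (RankMoment.cd γ τ) ^ (1 / 2 : ℂ) * ModularForm.eta τ) ∧
    -- the defining series converge absolutely, and the Taylor coefficients in `z` make sense
    (∀ (k : ℕ) (τ : ℍ),
      Summable fun n : ℕ => (RankMoment.rankMoment k n : ℂ) * RankMoment.qPow n τ) ∧
    (∀ z τ : ℂ, 0 < τ.im → Summable (RankMoment.STerm z τ)) ∧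
    (∀ τ : ℍ, ContDiff ℝ ∞ (RankMoment.minusFun τ)) ∧
    ∀ ℓ : ℕ, 1 ≤ ℓ →
      -- the transformation law of weight `2ℓ - 1/2`
      (∀ (γ : SL(2, ℤ)) (τ : ℍ),
        RankMoment.r ℓ (γ • τ)
          = (RankMoment.etaMultiplier γ)⁻¹ * (RankMoment.cd γ τ) ^ (2 * (ℓ : ℂ) - 1 / 2)
              * RankMoment.r ℓ τ) ∧
      -- the image under the lowering operator
      (∀ τ : ℍ,
        DifferentiableAt ℝ (RankMoment.r ℓ ∘ UpperHalfPlane.ofComplex) (τ : ℂ) ∧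
        RankMoment.lowering (RankMoment.r ℓ) τ
          = Complex.I * (Real.sqrt 3 : ℂ) / (Real.sqrt 2 : ℂ)
              * ((Real.sqrt τ.im : ℂ) * ModularForm.eta (-conj (τ : ℂ)) / ((ℓ - 1).factorial : ℂ))
              * (-((Real.pi : ℂ) ^ 2 * RankMoment.E2hat τ) / 2) ^ (ℓ - 1)) := by
  refine ⟨RankMoment.eta_smul, RankMoment.summable_rankMoment_mul_qPow,
    fun z τ hτ => RankMoment.summable_STerm hτ, RankMoment.contDiff_minusFun,
    fun ℓ hℓ => ⟨RankMoment.r_smul hℓ, RankMoment.r_lowering hℓ⟩⟩
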